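/- Setting. Represent points of the hyperbolic plane $\mathbb{H}$ by the upper half-plane with measure $dx\,dy/y^2$, let $k(\theta)=\begin{pmatrix}\cos\theta/2&\sin\theta/2\\-\sin\theta/2&\cos\theta/2\end{pmatrix}$ and $a(y)=\begin{pmatrix}e^{y}&0\\0&1\end{pmatrix}$ in $PSL_2(\mathbb{R})$, $A=\{a(y):y\in\mathbb{R}\}$, and let $d_G$ be the distance on $PSL_2(\mathbb{R})$ of the left-invariant Riemannian metric given at the identity by the norm $\sqrt{X_1^2+X_2^2+X_3^2}$ of $\begin{pmatrix}X_1&X_2\\X_3&-X_1\end{pmatrix}$. Let $\varphi_s(z)=\frac1{2\pi}\int_0^{2\pi}\mathrm{Im}(k(\theta)z)^{1/2+is}\,d\theta$ be the spherical function. Fix a real-valued, even, nonnegative Schwartz function $h$ on $\mathbb{R}$ whose Fourier transform has compact support, with $h\ge 1$ on $[-1,1]$, and a function $b\in C_0^\infty(\mathbb{R})$ with $\mathrm{supp}(b)\subseteq[0,1]$. Put $h_t(s)=h(s-t)+h(-s-t)$, and let $k_t$ be the function on $\mathbb{H}$, continuous and invariant under rotations about $i$, whose Harish-Chandra transform is $h_t^2$,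 i.e. $\int_{\mathbb{H}}k_t(z)\varphi_s(z)\,\frac{dx\,dy}{y^2}=h_t(s)^2$ for all $s\in\mathbb{R}$; assume that $k_t$ is supported in the ball of radius $1$ about $i$. Let $K_t$ be the associated point-pair invariant, $K_t(gi,w)=k_t(g^{-1}w)$. Let $\ell_0(x)=a(x)i$, $0\le x\le 1$, be the upwards pointing unit geodesic segment based at $i$. A unit geodesic segment, with its arc length parametrisation, has the form $\ell=g\ell_0$ with $g\in PSL_2(\mathbb{R})$. For $\ell_1=g_1\ell_0$, $\ell_2=g_2\ell_0$ let $d(\ell_1,\ell_2)$ be the infimum of the hyperbolic distances between points of $\ell_1$ and points of $\ell_2$, let $n(\ell_1,\ell_2)=\inf\{d_G(g_1^{-1}g_2,a):a\in A\}$, and for $\phi\in L^2(\mathbb{R})$ let $$I(t,\phi,\ell_1,\ell_2)=\iint b(x_1)b(x_2)\phi(x_1)\overline{\phi(x_2)}K_t(\ell_1(x_1),\ell_2(x_2))\,dx_1\,dx_2 .$$ Proposition. (a) There is a constant $C>0$, depending only on $h$ and $b$, such that $$|I(t,\phi,\ell_1,\ell_2)|\le C\,t^{1/2}$$ whenever $1\le\beta\le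 t^{2/3}$ (so $t \ge 1$), $\phi\in L^2(\mathbb{R})$ satisfies $\|\phi\|_2=1$ and has Fourier transform $\widehat\phi(\xi)=\int\phi(x)e^{-i\xi x}dx$ supported in $[t-\beta,t+\beta]$, and $d(\ell_1,\ell_2)\le 1$. (b) For every $\epsilon>0$ and every real $A$ there is a constant $C>0$, depending only on $\epsilon$, $A$, $h$ and $b$, such that $$|I(t,\phi,\ell_1,\ell_2)|\le C\,t^{-A}$$ whenever $t,\beta,\phi,\ell_1,\ell_2$ are as in (a) and in addition $n(\ell_1,\ell_2)\ge t^{-1/2+\epsilon}\beta^{1/2}$. -/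

import Mathlib

open MeasureTheory
open scoped MatrixGroups UpperHalfPlane FourierTransform SchwartzMap ContDiff

noncomputable section

namespace GeodesicPeriod

/-! Elements of `PSL₂(ℝ)` are represented by elements of `SL(2, ℝ)`, up to sign. All notions below
are unchanged when a representative is replaced by its negative. -/

/-- `k(θ)`, the rotation by the angle `θ` about `i`. -/
def rot (θ : ℝ) : SL(2, ℝ) :=
  ⟨!![Real.cos (θ / 2), Real.sin (θ / 2); -Real.sin (θ / 2), Real.cos (θ / 2)], by
    rw [Matrix.det_fin_two_of]; nlinarith [Real.sin_sq_add_cos_sq (θ / 2)]⟩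

/-- `a(y)`, the class of `diag(e^y, 1)` in `PSL₂(ℝ)`, normalised to have determinant one. -/
def diagA (y : ℝ) : SL(2, ℝ) :=
  ⟨!![Real.exp (y / 2), 0; 0, Real.exp (-(y / 2))], by
    rw [Matrix.det_fin_two_of, ← Real.exp_add]; simp⟩

/-- The norm `(X₁² + X₂² + X₃²)^{1/2}` of the matrix with rows `(X₁, X₂)`, `(X₃, -X₁)`
in the Lie algebra of `PSL₂(ℝ)`. -/
def lieNorm (X : Matrix (Fin 2) (Fin 2) ℝ) : ℝ :=
  Real.sqrt (X 0 0 ^ 2 + X 0 1 ^ 2 + X 1 0 ^ 2)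

/-- The entrywise derivative of a path in `SL(2, ℝ)`. -/
def velocity (γ : ℝ → SL(2, ℝ)) (τ : ℝ) : Matrix (Fin 2) (Fin 2) ℝ :=
  Matrix.of fun i j => deriv (fun u => (γ u) i j) τ

/-- The length of the path `γ` on `[0, 1]` for the left-invariant Riemannian metric which is
`lieNorm` at the identity. -/
def pathLength (γ : ℝ → SL(2, ℝ)) : ℝ :=
  ∫ τ in (0 : ℝ)..1, lieNorm (((γ τ)⁻¹ : SL(2, ℝ)).1 * velocity γ τ)

/-- The Riemannian distance `d_G` of `PSL₂(ℝ)` between the classes of `g₁` and `g₂`: the infimum of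
the lengths of `C¹` paths between the classes. A path in `PSL₂(ℝ)` from the class of `g₁` to the
class of `g₂` lifts to a path in `SL(2, ℝ)` from `g₁` to one of `±g₂`. -/
def distG (g₁ g₂ : SL(2, ℝ)) : ℝ :=
  sInf {L : ℝ | ∃ γ : ℝ → SL(2, ℝ),
    (∀ i j, ContDiff ℝ 1 fun τ => (γ τ) i j) ∧
    γ 0 = g₁ ∧ (γ 1 = g₂ ∨ γ 1 = -g₂) ∧ L = pathLength γ}

/-- The arc length parametrised geodesic `x ↦ g a(x) i`. Its restriction to `[0, 1]` is the
unit segment `g ℓ₀`, where `ℓ₀` is the upwards pointing unit geodesic segment based at `i`. -/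
def geod (g : SL(2, ℝ)) (x : ℝ) : ℍ :=
  g • diagA x • UpperHalfPlane.I

/-- The distance `d(ℓ₁, ℓ₂) = inf {d(p, q) | p ∈ ℓ₁, q ∈ ℓ₂}` of the unit segments
`ℓ₁ = g₁ ℓ₀` and `ℓ₂ = g₂ ℓ₀`. -/
def segDist (g₁ g₂ : SL(2, ℝ)) : ℝ :=
  sInf {r : ℝ | ∃ x₁ ∈ Set.Icc (0 : ℝ) 1, ∃ x₂ ∈ Set.Icc (0 : ℝ) 1,
    r = dist (geod g₁ x₁) (geod g₂ x₂)}

/-- `n(ℓ₁, ℓ₂) = inf {d_G(g₁⁻¹ g₂, a) | a ∈ A}` for `ℓ₁ = g₁ ℓ₀` and `ℓ₂ = g₂ ℓ₀`. -/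
def segAngle (g₁ g₂ : SL(2, ℝ)) : ℝ :=
  sInf {r : ℝ | ∃ y : ℝ, r = distG (g₁⁻¹ * g₂) (diagA y)}

/-- The standard spherical function `φ_s` on `ℍ`: the average over the rotations about `i` of
the plane wave `z ↦ (Im z)^{1/2 + is}`. -/
def spherical (s : ℝ) (z : ℍ) : ℂ :=
  (1 / (2 * Real.pi) : ℂ) *
    ∫ θ in (0 : ℝ)..(2 * Real.pi), ((rot θ • z).im : ℂ) ^ (1 / 2 + s * Complex.I : ℂ)

/-- The Harish-Chandra transform, with respect to the measure `dx dy / y²` on `ℍ`. -/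
def harishChandra (k : ℍ → ℂ) (s : ℝ) : ℂ :=
  ∫ z : ℍ, k z * spherical s z

/-- The conditions on the test function `h ∈ 𝓢(ℝ)`: it is real valued (by its type),
of Paley-Wiener type, even, nonnegative, and at least one on `[-1, 1]`. -/
structure IsAdmissible (h : 𝓢(ℝ, ℝ)) : Prop where
  paleyWiener : HasCompactSupport (𝓕 fun x : ℝ => (h x : ℂ))
  even : ∀ x, h (-x) = h x
  nonneg : ∀ x, 0 ≤ h x
  one_le : ∀ x ∈ Set.Icc (-1 : ℝ) 1, 1 ≤ h x

/-- `h_t(s) = h(s - t) + h(-s - t)`. -/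
def shifted (h : 𝓢(ℝ, ℝ)) (t s : ℝ) : ℝ :=
  h (s - t) + h (-s - t)

/-- `k` is the function `k_t`: the (continuous) function on `ℍ`, invariant under rotations about
`i` and supported in the ball of radius one about `i`, whose Harish-Chandra transform is `h_t²`. -/
structure IsSpectralKernel (h : 𝓢(ℝ, ℝ)) (t : ℝ) (k : ℍ → ℂ) : Prop where
  continuous : Continuous k
  invariant : ∀ θ z, k (rot θ • z) = k z
  support : ∀ z, k z ≠ 0 → dist z UpperHalfPlane.I ≤ 1
  transform : ∀ s : ℝ, harishChandra k s = (shifted h t s : ℂ) ^ 2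

/-- The point-pair invariant associated to `k`, namely `K(z, w) = k(g⁻¹ w)` where `z = g i`. -/
def pointPair (k : ℍ → ℂ) (z w : ℍ) : ℂ :=
  k (z.toSL2R⁻¹ • w)

/-- `φ ∈ H_β⁺`: the Fourier transform `∫ φ(x) e^{-iξx} dx` is supported in `[t - β, t + β]`.
Mathlib's `𝓕 φ` at `η` is the value of this transform at `ξ = 2πη`. -/
def HasSpectrumNear (t β : ℝ) (φ : Lp ℂ 2 (volume : Measure ℝ)) : Prop :=
  ∀ᵐ η : ℝ, 2 * Real.pi * η ∉ Set.Icc (t - β) (t + β) →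
    (𝓕 φ : Lp ℂ 2 (volume : Measure ℝ)) η = 0

/-- The integral `I(t, φ, ℓ₁, ℓ₂)`, where `k` is the function `k_t`. -/
def periodIntegral (b : ℝ → ℂ) (k : ℍ → ℂ) (φ : Lp ℂ 2 (volume : Measure ℝ))
    (g₁ g₂ : SL(2, ℝ)) : ℂ :=
  ∫ x₁ : ℝ, ∫ x₂ : ℝ, b x₁ * b x₂ * φ x₁ * (starRingEnd ℂ) (φ x₂) *
    pointPair k (geod g₁ x₁) (geod g₂ x₂)

end GeodesicPeriod

end

open MeasureTheory
open scoped MatrixGroups UpperHalfPlane FourierTransform SchwartzMap ContDiff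

noncomputable section

namespace GeodesicPeriod

/-! The kernel depends only on $w=\cosh d$, and along the two geodesics $w=c(x_1,x_2)$ is an
explicit combination of $e^{\pm(x_1-x_2)}$ and $e^{\pm(x_1+x_2)}$, whose coefficients are the
squared entries of $g=g_1^{-1}g_2$ (`cosh_dist_geod`, `pointPair_geod`). In horocyclic coordinates
the Harish-Chandra transform is the Fourier transform of the Abel transform
(`harishChandra_eq_fourier_abel`). Two inversions therefore express $k_t$ through $h_t^2$, as the
inverse Abel transform of a function on the line that oscillates at frequency about $t$
(`abel_radialProfile`, `eq_invAbel`).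

Part (a). Splitting the inverse Abel integral at $v_0=(w-1)^{1/4}t^{-1/2}$ gives $|k_t|\ll
t^{1/2}(w-1)^{-1/4}$ (`exists_norm_kernelIter_zero_le`). With one variable fixed,
$c-1\ge(x-x_0)^2/2$ in the other, for some $x_0$. The kernel is thus $O(t^{1/2}|x-x_0|^{-1/2})$, and
Schur's test gives the bound (`exists_norm_periodIntegral_le`).

Part (b). Since $\widehat\phi$ is integrable with norm at most $2\beta$, the form is controlled by
its values at pairs of exponentials, that is, by integrals of $k_t(c)$ against a fixed cutoff and a
plane wave with frequency $\xi$ in $x_1-x_2$ and $\zeta$ in $x_1+x_2$, where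
$|\xi-t|,|\zeta|\le\beta$ (`norm_sesquilinear_le`). These are integrated by parts using the radial
Laplace equation, not an asymptotic expansion of the kernel. Let $k_{t,j}$ be the function obtained
by putting the factor $(t^2-s^2)^j$ on the spectral side. It is $O(t^{j+2})$, because $h_t$
concentrates near $\pm t$ and each factor costs only one power of $t$. Moreover
$(\Delta+t^2+\tfrac14)k_{t,j}=k_{t,j+1}$ (`IsProfile.laplacian_invAbel`).

Suppose a second-order operator $\alpha\partial_-^2+\gamma\partial_+^2+\dots$ in $x_1\mp x_2$ acts
on functions of $c$ as $\eta\Delta$. Moving it to the amplitude produces the factor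
$\xi^2\alpha+\zeta^2\gamma-\eta(t^2+\tfrac14)\approx t^2(\alpha-\eta)$, against the next iterate and
terms of lower order (`oscIntegral_by_parts`). Let $n=g_{01}^2+g_{10}^2$. If $\alpha-\eta=n\kappa$
with $\kappa$ bounded below, the factor has size $t^2n$, while the losses are $O(t)$ and, since the
$\partial_+$ coefficients may carry $1/n$, $O(\beta/n)$. The angle hypothesis gives $n\gg
t^{-1+2\epsilon}\beta$ (`exists_le_offDiag`), so every step gains $t^{-2\epsilon}$
(`exists_norm_oscIntegral_le`). Many steps give any power of $t$.

It remains to exhibit the operators. Polynomial choices exist in three ranges of $g_{01}g_{10}$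
(`exists_norm_oscIntegral_le_of_nonneg`, `exists_norm_oscIntegral_le_of_mem_Icc`,
`exists_norm_oscIntegral_le_of_lt`). The last one uses that $k_t$ lives in the unit ball. The
coefficients are smooth even where the geodesics cross, so only integration by parts across the null
set $c=1$ needs care (`IsRadialOperator.integral_laplacian`). -/

/-! ### Hyperbolic distances along two geodesics. -/

lemma det_eq (g : SL(2, ℝ)) : g 0 0 * g 1 1 - g 0 1 * g 1 0 = 1 := by
  have := g.2
  rwa [Matrix.det_fin_two] at this

lemma coe_smul_I (g : SL(2, ℝ)) :
    ((g • UpperHalfPlane.I : ℍ) : ℂ) =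
      ((g 0 0 : ℂ) * Complex.I + g 0 1) / ((g 1 0 : ℂ) * Complex.I + g 1 1) := by
  rw [UpperHalfPlane.coe_specialLinearGroup_apply]
  simp

lemma row_sq_pos (g : SL(2, ℝ)) : 0 < g 1 0 ^ 2 + g 1 1 ^ 2 := by
  have h := det_eq g
  by_contra hn
  have h0 : g 1 0 = 0 := by nlinarith [sq_nonneg (g 1 0), sq_nonneg (g 1 1)]
  have h1 : g 1 1 = 0 := by nlinarith [sq_nonneg (g 1 0), sq_nonneg (g 1 1)]
  simp [h0, h1] at h

lemma smul_I_im (g : SL(2, ℝ)) :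
    (g • UpperHalfPlane.I : ℍ).im = 1 / (g 1 0 ^ 2 + g 1 1 ^ 2) := by
  rw [← UpperHalfPlane.coe_im, coe_smul_I, Complex.div_im]
  have h := det_eq g
  have hp := row_sq_pos g
  simp only [Complex.normSq_apply, Complex.add_re, Complex.mul_re, Complex.ofReal_re,
    Complex.I_re, Complex.ofReal_im, Complex.I_im, Complex.add_im, Complex.mul_im]
  rw [← sub_div]
  congr 1 <;> linarith

lemma smul_I_re (g : SL(2, ℝ)) :
    (g • UpperHalfPlane.I : ℍ).re =
      (g 0 0 * g 1 0 + g 0 1 * g 1 1) / (g 1 0 ^ 2 + g 1 1 ^ 2) := by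
  rw [← UpperHalfPlane.coe_re, coe_smul_I, Complex.div_re]
  simp only [Complex.normSq_apply, Complex.add_re, Complex.mul_re, Complex.ofReal_re,
    Complex.I_re, Complex.ofReal_im, Complex.I_im, Complex.add_im, Complex.mul_im]
  rw [← add_div]
  congr 1 <;> ring

lemma cosh_dist_I (z : ℍ) :
    Real.cosh (dist z UpperHalfPlane.I) = (z.re ^ 2 + z.im ^ 2 + 1) / (2 * z.im) := by
  rw [UpperHalfPlane.cosh_dist']
  simp

lemma cosh_dist_smul_I (g : SL(2, ℝ)) :
    Real.cosh (dist (g • UpperHalfPlane.I) UpperHalfPlane.I) =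
      (g 0 0 ^ 2 + g 0 1 ^ 2 + g 1 0 ^ 2 + g 1 1 ^ 2) / 2 := by
  rw [cosh_dist_I, smul_I_im, smul_I_re]
  have h := det_eq g
  have hp := row_sq_pos g
  field_simp
  have h2 : (g 0 0 * g 1 1 - g 0 1 * g 1 0) ^ 2 = 1 := by rw [h]; norm_num
  linear_combination -h2

lemma diagA_00 (y : ℝ) : diagA y 0 0 = Real.exp (y / 2) := rfl
lemma diagA_01 (y : ℝ) : diagA y 0 1 = 0 := rfl
lemma diagA_10 (y : ℝ) : diagA y 1 0 = 0 := rfl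
lemma diagA_11 (y : ℝ) : diagA y 1 1 = Real.exp (-(y / 2)) := rfl
lemma rot_00 (θ : ℝ) : rot θ 0 0 = Real.cos (θ / 2) := rfl
lemma rot_01 (θ : ℝ) : rot θ 0 1 = Real.sin (θ / 2) := rfl
lemma rot_10 (θ : ℝ) : rot θ 1 0 = -Real.sin (θ / 2) := rfl
lemma rot_11 (θ : ℝ) : rot θ 1 1 = Real.cos (θ / 2) := rfl

lemma mul_entry (g h : SL(2, ℝ)) (i j : Fin 2) :
    (g * h) i j = g i 0 * h 0 j + g i 1 * h 1 j := by
  rw [Matrix.SpecialLinearGroup.coe_mul, Matrix.mul_apply, Fin.sum_univ_two]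

lemma diagA_smul_I_im (y : ℝ) : (diagA y • UpperHalfPlane.I : ℍ).im = Real.exp y := by
  rw [smul_I_im]
  simp [diagA, ← Real.exp_nat_mul, ← Real.exp_neg]
  ring

lemma diagA_smul_I_re (y : ℝ) : (diagA y • UpperHalfPlane.I : ℍ).re = 0 := by
  rw [smul_I_re]
  simp [diagA]

/-- The hyperbolic cosine of the distance from `a(x₁) i` to `g a(x₂) i`. -/
def coshDist (g : SL(2, ℝ)) (x : ℝ × ℝ) : ℝ :=
  (g 0 0 ^ 2 * Real.exp (-(x.1 - x.2)) + g 1 1 ^ 2 * Real.exp (x.1 - x.2)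
    + g 0 1 ^ 2 * Real.exp (-(x.1 + x.2)) + g 1 0 ^ 2 * Real.exp (x.1 + x.2)) / 2

lemma diagA_inv (y : ℝ) : (diagA y)⁻¹ = diagA (-y) := by
  rw [inv_eq_iff_mul_eq_one]
  ext i j
  fin_cases i <;> fin_cases j <;>
    simp [mul_entry, diagA_00, diagA_01, diagA_10, diagA_11, ← Real.exp_add] <;> ring

lemma cosh_dist_smul_smul (g h : SL(2, ℝ)) :
    Real.cosh (dist (g • UpperHalfPlane.I) (h • UpperHalfPlane.I)) =
      Real.cosh (dist ((g⁻¹ * h) • UpperHalfPlane.I) UpperHalfPlane.I) := by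
  rw [dist_comm (g • _), ← dist_smul g⁻¹ (h • UpperHalfPlane.I), smul_smul, smul_smul,
    inv_mul_cancel, one_smul]

/-- By invariance the distance is that of $a(-x_1)\,g_1^{-1}g_2\,a(x_2)\,i$ from $i$. Its hyperbolic
cosine is half the squared Frobenius norm, and the diagonal factors only rescale the four entries.
-/
lemma cosh_dist_geod (g₁ g₂ : SL(2, ℝ)) (x₁ x₂ : ℝ) :
    Real.cosh (dist (geod g₁ x₁) (geod g₂ x₂)) = coshDist (g₁⁻¹ * g₂) (x₁, x₂) := by
  have : (g₁ * diagA x₁)⁻¹ * (g₂ * diagA x₂) = diagA (-x₁) * (g₁⁻¹ * g₂) * diagA x₂ := by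
    rw [mul_inv_rev, diagA_inv]; group
  rw [geod, geod, smul_smul, smul_smul, cosh_dist_smul_smul, this, cosh_dist_smul_I]
  generalize g₁⁻¹ * g₂ = g
  simp only [mul_entry, diagA_00, diagA_01, diagA_10, diagA_11, coshDist]
  simp only [mul_zero, zero_mul, add_zero, zero_add]
  simp only [mul_pow, ← Real.exp_nat_mul]
  have e (u v : ℝ) (c : ℝ) :
      Real.exp u * c * Real.exp v = c * Real.exp (u + v) := by
    rw [Real.exp_add]; ring
  simp only [e]
  push_cast
  ring_nf

lemma one_le_coshDist (g : SL(2, ℝ)) (x : ℝ × ℝ) : 1 ≤ coshDist g x := by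
  have := cosh_dist_geod 1 g x.1 x.2
  simp only [inv_one, one_mul] at this
  rw [← this]
  exact Real.one_le_cosh _

/-! ### Rotation-invariant functions as functions of $\cosh d(\cdot,i)$. -/

lemma rot_smul_I (θ : ℝ) : rot θ • UpperHalfPlane.I = UpperHalfPlane.I := by
  have h := Real.sin_sq_add_cos_sq (θ / 2)
  have h' : Real.cos (θ / 2) ^ 2 + Real.sin (θ / 2) ^ 2 = 1 := by linarith
  apply UpperHalfPlane.ext_re_im
  · rw [smul_I_re]; simp [rot_00, rot_01, rot_10, rot_11]; ring
  · rw [smul_I_im]; simp [rot_10, rot_11, h]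

lemma rot_smul_re (θ : ℝ) (z : ℍ) :
    (rot θ • z).re = (Real.cos θ * z.re + Real.sin θ * ((1 - z.re ^ 2 - z.im ^ 2) / 2)) /
      ((Real.cos (θ / 2) - Real.sin (θ / 2) * z.re) ^ 2 + (Real.sin (θ / 2) * z.im) ^ 2) := by
  rw [← UpperHalfPlane.coe_re, UpperHalfPlane.coe_specialLinearGroup_apply, Complex.div_re]
  have h1 : Real.cos θ = Real.cos (θ / 2) ^ 2 - Real.sin (θ / 2) ^ 2 := by
    rw [← Real.cos_two_mul']; ring_nf
  have h2 : Real.sin θ = 2 * Real.sin (θ / 2) * Real.cos (θ / 2) := by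
    rw [← Real.sin_two_mul]; ring_nf
  rw [h1, h2, ← add_div]
  simp only [rot_00, rot_01, rot_10, rot_11, Complex.normSq_apply, Complex.add_re,
    Complex.mul_re, Complex.ofReal_re, Complex.ofReal_im, Complex.add_im, Complex.mul_im,
    UpperHalfPlane.coe_re, UpperHalfPlane.coe_im, Algebra.algebraMap_self, RingHom.id_apply]
  congr 1 <;> ring

lemma exists_rot_smul_re_eq_zero (z : ℍ) : ∃ θ, (rot θ • z).re = 0 := by
  set w : ℂ := ⟨z.re, (1 - z.re ^ 2 - z.im ^ 2) / 2⟩ with hw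
  have h1 : ‖w‖ * Real.cos w.arg = z.re := by simp [hw]
  have h2 : ‖w‖ * Real.sin w.arg = (1 - z.re ^ 2 - z.im ^ 2) / 2 := by simp [hw]
  -- The numerator of the rotated real part is the inner product of $(\cos\theta,\sin\theta)$ with
  -- $w$, so any direction orthogonal to $w$ works.
  refine ⟨w.arg + Real.pi / 2, ?_⟩
  rw [rot_smul_re, Real.cos_add_pi_div_two, Real.sin_add_pi_div_two, ← h2]
  nth_rewrite 1 [← h1]
  ring_nf

lemma diagA_smul_I_of_re {z : ℍ} (hz : z.re = 0) : z = diagA (Real.log z.im) • UpperHalfPlane.I := by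
  apply UpperHalfPlane.ext_re_im
  · rw [diagA_smul_I_re, hz]
  · rw [diagA_smul_I_im, Real.exp_log z.im_pos]

lemma dist_diagA_smul_I (y : ℝ) : dist (diagA y • UpperHalfPlane.I) UpperHalfPlane.I = |y| := by
  rw [UpperHalfPlane.dist_of_re_eq (by rw [diagA_smul_I_re]; simp), diagA_smul_I_im]
  simp

lemma rot_pi_smul_diagA (y : ℝ) :
    rot Real.pi • diagA y • UpperHalfPlane.I = diagA (-y) • UpperHalfPlane.I := by
  have : rot Real.pi * diagA y = diagA (-y) * rot Real.pi := by
    ext i j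
    fin_cases i <;> fin_cases j <;>
      simp [mul_entry, rot_00, rot_01, rot_10, rot_11, diagA_00, diagA_01, diagA_10, diagA_11,
        neg_div]
  rw [smul_smul, this, ← smul_smul, rot_smul_I]

/-- A rotation invariant function on `ℍ`, as a function of the hyperbolic cosine of the distance
to `i`. -/
def radialProfile (k : ℍ → ℂ) (w : ℝ) : ℂ :=
  k (diagA (Real.arcosh (max 1 w)) • UpperHalfPlane.I)

/-- A rotation about $i$ carries any point to the imaginary axis, and the half turn exchanges the
two points of the axis at a given distance from $i$. -/
lemma eq_radialProfile {k : ℍ → ℂ} (hk : ∀ θ z, k (rot θ • z) = k z) (z : ℍ) :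
    k z = radialProfile k (Real.cosh (dist z UpperHalfPlane.I)) := by
  obtain ⟨θ, hθ⟩ := exists_rot_smul_re_eq_zero z
  have h1 := diagA_smul_I_of_re hθ
  have h2 : dist z UpperHalfPlane.I = |Real.log (rot θ • z).im| := by
    rw [← dist_smul (rot θ) z, rot_smul_I, h1, dist_diagA_smul_I, ← h1]
  rw [radialProfile, max_eq_right (Real.one_le_cosh _), Real.arcosh_cosh dist_nonneg, h2, ← hk θ z]
  conv_lhs => rw [h1]
  rcases abs_choice (Real.log (rot θ • z).im) with h | h <;> rw [h]
  rw [← rot_pi_smul_diagA, hk]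

lemma pointPair_geod {k : ℍ → ℂ} (hk : ∀ θ z, k (rot θ • z) = k z) (g₁ g₂ : SL(2, ℝ))
    (x₁ x₂ : ℝ) :
    pointPair k (geod g₁ x₁) (geod g₂ x₂) = radialProfile k (coshDist (g₁⁻¹ * g₂) (x₁, x₂)) := by
  rw [pointPair, eq_radialProfile hk, ← cosh_dist_geod]
  congr 2
  rw [← dist_smul (geod g₁ x₁).toSL2R, smul_smul, mul_inv_cancel, one_smul,
    UpperHalfPlane.toSL2R_smul_I, dist_comm]


/-! ### The Harish-Chandra transform as the Fourier transform of the Abel transform. -/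

instance : SMulInvariantMeasure SL(2, ℝ) ℍ volume where
  measure_preimage_smul g _ hs :=
    measure_preimage_smul_of_nullMeasurableSet (μ := (volume : Measure ℍ))
      hs.nullMeasurableSet (Matrix.SpecialLinearGroup.mapGL ℝ g)

lemma hasCompactSupport_of_dist_le {k : ℍ → ℂ}
    (hs : ∀ z, k z ≠ 0 → dist z UpperHalfPlane.I ≤ 1) : HasCompactSupport k :=
  HasCompactSupport.of_support_subset_isCompact
    (isCompact_closedBall UpperHalfPlane.I 1) fun z hz => hs z hz

lemma continuous_im_cpow (c : ℂ) : Continuous fun z : ℍ => (z.im : ℂ) ^ c := by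
  refine Continuous.cpow (by fun_prop) continuous_const fun z => ?_
  left
  simpa using z.im_pos

lemma continuous_rot : Continuous rot := by
  refine Continuous.subtype_mk (continuous_matrix fun i j => ?_) _
  fin_cases i <;> fin_cases j <;> simp <;> fun_prop

/-- The average over rotations in the spherical function can be dropped: after Fubini, each rotation
is absorbed by the invariance of $k$ and of the measure. -/
lemma harishChandra_eq_integral_im {k : ℍ → ℂ} (hc : Continuous k)
    (hk : ∀ θ z, k (rot θ • z) = k z)
    (hs : ∀ z, k z ≠ 0 → dist z UpperHalfPlane.I ≤ 1) (s : ℝ) :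
    harishChandra k s = ∫ z : ℍ, k z * (z.im : ℂ) ^ (1 / 2 + s * Complex.I : ℂ) := by
  set c : ℂ := 1 / 2 + s * Complex.I
  set F : ℍ → ℝ → ℂ := fun z θ => k z * ((rot θ • z).im : ℂ) ^ c
  have hF : Continuous (Function.uncurry F) := by
    have h1 : Continuous fun p : ℍ × ℝ => rot p.2 • p.1 :=
      (continuous_rot.comp continuous_snd).smul continuous_fst
    exact (hc.comp continuous_fst).mul ((continuous_im_cpow c).comp h1)
  have hpi : (0 : ℝ) ≤ 2 * Real.pi := by positivity
  have hint : Integrable (Function.uncurry F)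
      ((volume : Measure ℍ).prod (volume.restrict (Set.Ioc 0 (2 * Real.pi)))) := by
    have hK : IsCompact (Metric.closedBall UpperHalfPlane.I 1 ×ˢ Set.Icc 0 (2 * Real.pi)) :=
      (isCompact_closedBall _ _).prod isCompact_Icc
    have h1 : IntegrableOn (Function.uncurry F)
        (Metric.closedBall UpperHalfPlane.I 1 ×ˢ Set.Icc 0 (2 * Real.pi))
        ((volume : Measure ℍ).prod volume) := hF.continuousOn.integrableOn_compact hK
    have h2 : IntegrableOn (Function.uncurry F)
        (Set.univ ×ˢ Set.Ioc 0 (2 * Real.pi)) ((volume : Measure ℍ).prod volume) := by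
      refine (h1.of_forall_sdiff_eq_zero ?_ ?_)
      · exact MeasurableSet.univ.prod measurableSet_Ioc
      · rintro ⟨z, θ⟩ ⟨hz, hz'⟩
        have : k z = 0 := by
          by_contra h
          exact hz' ⟨hs z h, Set.Ioc_subset_Icc_self hz.2⟩
        simp [F, this]
    rwa [IntegrableOn, ← Measure.prod_restrict, Measure.restrict_univ] at h2
  have hθ (θ : ℝ) : ∫ z : ℍ, F z θ = ∫ z : ℍ, k z * (z.im : ℂ) ^ c := by
    rw [← integral_smul_eq_self (μ := (volume : Measure ℍ))
      (fun z : ℍ => k z * (z.im : ℂ) ^ c) (g := rot θ)]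
    simp only [hk, F]
  calc harishChandra k s
      = ∫ z : ℍ, (1 / (2 * Real.pi) : ℂ) * ∫ θ in Set.Ioc 0 (2 * Real.pi), F z θ := by
        refine integral_congr_ae (Filter.Eventually.of_forall fun z => ?_)
        simp only [spherical, intervalIntegral.integral_of_le hpi, F, integral_const_mul, c]
        ring
    _ = (1 / (2 * Real.pi) : ℂ) * ∫ θ in Set.Ioc 0 (2 * Real.pi), ∫ z : ℍ, F z θ := by
        rw [integral_const_mul, integral_integral_swap hint]
    _ = _ := by
        simp only [hθ]
        rw [setIntegral_const, Measure.real, Real.volume_Ioc, sub_zero, ENNReal.toReal_ofReal hpi,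
          Complex.real_smul]
        have : (Real.pi : ℂ) ≠ 0 := by exact_mod_cast Real.pi_ne_zero
        push_cast
        field_simp

/-- The point with given coordinates, if it lies in the upper half-plane. -/
def ofCoords (p : ℝ × ℝ) : ℍ := UpperHalfPlane.ofComplex ⟨p.1, p.2⟩

lemma ofCoords_re {p : ℝ × ℝ} (hp : 0 < p.2) : (ofCoords p).re = p.1 := by
  rw [ofCoords, UpperHalfPlane.ofComplex_apply_of_im_pos (z := ⟨p.1, p.2⟩) hp]
  rfl

lemma ofCoords_im {p : ℝ × ℝ} (hp : 0 < p.2) : (ofCoords p).im = p.2 := by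
  rw [ofCoords, UpperHalfPlane.ofComplex_apply_of_im_pos (z := ⟨p.1, p.2⟩) hp]
  rfl

lemma integral_upperHalfPlane {f : ℍ → ℂ} (hf : Integrable f) :
    IntegrableOn (fun p : ℝ × ℝ => (1 / p.2 ^ 2) • f (ofCoords p)) (Set.univ ×ˢ Set.Ioi 0) ∧
    ∫ z : ℍ, f z = ∫ p : ℝ × ℝ in Set.univ ×ˢ Set.Ioi 0, (1 / p.2 ^ 2) • f (ofCoords p) := by
  have hm : Measurable fun z : ℍ => (1 / NNReal.mk z.im z.im_pos.le : NNReal) ^ 2 := by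
    refine Measurable.pow_const (Measurable.div measurable_const ?_) 2
    exact (UpperHalfPlane.continuous_im.measurable).subtype_mk
  set G : ℂ → ℂ := fun w => (1 / w.im ^ 2) • f (UpperHalfPlane.ofComplex w)
  have hG (z : ℍ) : ((1 / NNReal.mk z.im z.im_pos.le : NNReal) ^ 2) • f z = G z := by
    simp only [G, UpperHalfPlane.ofComplex_apply, NNReal.smul_def, UpperHalfPlane.coe_im]
    congr 1
    push_cast
    rw [one_div_pow]
  have hmap : (volume.comap UpperHalfPlane.coe).map UpperHalfPlane.coe =
      (volume : Measure ℂ).restrict (Set.range UpperHalfPlane.coe) :=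
    UpperHalfPlane.measurableEmbedding_coe.map_comap _
  have hrange : Complex.measurableEquivRealProd.symm ⁻¹' (Set.range UpperHalfPlane.coe) =
      Set.univ ×ˢ Set.Ioi (0 : ℝ) := by
    ext p
    simp only [Set.mem_preimage, Set.mem_prod, Set.mem_univ, true_and, Set.mem_Ioi]
    constructor
    · rintro ⟨z, hz⟩
      have := z.im_pos
      rw [← UpperHalfPlane.coe_im, hz] at this
      exact this
    · intro h
      exact ⟨⟨⟨p.1, p.2⟩, h⟩, rfl⟩
  have hmp := Complex.volume_preserving_equiv_real_prod.symm
  have hme := Complex.measurableEquivRealProd.symm.measurableEmbedding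
  constructor
  · rw [UpperHalfPlane.volume_def, integrable_withDensity_iff_integrable_smul hm] at hf
    simp only [hG] at hf
    have h1 : Integrable G ((volume.comap UpperHalfPlane.coe).map UpperHalfPlane.coe) :=
      UpperHalfPlane.measurableEmbedding_coe.integrable_map_iff.2 hf
    rw [hmap] at h1
    have h2 := (hmp.integrableOn_comp_preimage hme).2 h1
    rw [hrange] at h2
    exact h2
  · rw [UpperHalfPlane.volume_def, integral_withDensity_eq_integral_smul hm]
    simp only [hG]
    rw [← UpperHalfPlane.measurableEmbedding_coe.integral_map, hmap,
      ← hmp.setIntegral_preimage_emb hme, hrange]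
    rfl

lemma integral_Ioi_eq_integral_exp (f : ℝ → ℂ) :
    ∫ y in Set.Ioi (0 : ℝ), f y = ∫ u : ℝ, Real.exp u • f (Real.exp u) := by
  have h := integral_image_eq_integral_abs_deriv_smul (s := Set.univ) (f := Real.exp)
    (f' := Real.exp) MeasurableSet.univ (fun x _ => (Real.hasDerivAt_exp x).hasDerivWithinAt)
    Real.exp_injective.injOn f
  rw [Set.image_univ, Real.range_exp] at h
  simpa using h

/-- The Abel transform of a radial function, in terms of the hyperbolic cosine. -/
def abel (κ : ℝ → ℂ) (w : ℝ) : ℂ := ∫ v : ℝ, κ (w + v ^ 2 / 2)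

lemma harishChandra_eq_fourier_abel {k : ℍ → ℂ} (hc : Continuous k)
    (hk : ∀ θ z, k (rot θ • z) = k z)
    (hs : ∀ z, k z ≠ 0 → dist z UpperHalfPlane.I ≤ 1) (s : ℝ) :
    harishChandra k s =
      ∫ u : ℝ, Complex.exp (s * u * Complex.I) * abel (radialProfile k) (Real.cosh u) := by
  rw [harishChandra_eq_integral_im hc hk hs]
  have hint : Integrable fun z : ℍ => k z * (z.im : ℂ) ^ (1 / 2 + s * Complex.I : ℂ) :=
    (hc.mul (continuous_im_cpow _)).integrable_of_hasCompactSupport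
      (hasCompactSupport_of_dist_le hs).mul_right
  obtain ⟨h1, h2⟩ := integral_upperHalfPlane hint
  rw [h2]
  rw [IntegrableOn, Measure.volume_eq_prod, ← Measure.prod_restrict] at h1
  rw [Measure.volume_eq_prod, ← Measure.prod_restrict, integral_prod_symm _ h1,
    integral_Ioi_eq_integral_exp]
  refine integral_congr_ae (Filter.Eventually.of_forall fun u => ?_)
  simp only [Measure.restrict_univ]
  have hy := Real.exp_pos u
  have hc1 : (Real.exp u : ℂ) ^ (1 / 2 + s * Complex.I : ℂ) =
      Real.exp (u / 2) * Complex.exp (s * u * Complex.I) := by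
    rw [Complex.cpow_def_of_ne_zero (by exact_mod_cast hy.ne'), ← Complex.ofReal_log hy.le,
      Real.log_exp, Complex.ofReal_exp, ← Complex.exp_add]
    push_cast
    ring_nf
  have hx (x : ℝ) : k (ofCoords (x, Real.exp u)) =
      radialProfile k ((x ^ 2 + Real.exp u ^ 2 + 1) / (2 * Real.exp u)) := by
    rw [eq_radialProfile hk, cosh_dist_I, ofCoords_re hy, ofCoords_im hy]
  -- The substitution $y=e^u$, $x=e^{u/2}v$ turns $\cosh d(z,i)$ into $\cosh u+v^2/2$. The Jacobians
  -- $e^u$ and $e^{u/2}$, the modulus $y^{1/2}=e^{u/2}$ and the density $y^{-2}$ cancel exactly.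
  have hv (v : ℝ) : ((Real.exp (u / 2) * v) ^ 2 + Real.exp u ^ 2 + 1) / (2 * Real.exp u) =
      Real.cosh u + v ^ 2 / 2 := by
    have : Real.exp u = Real.exp (u / 2) ^ 2 := by rw [← Real.exp_nat_mul]; ring_nf
    rw [Real.cosh_eq, Real.exp_neg, this]
    field_simp
    ring
  have hcv := Measure.integral_comp_mul_left
    (fun x => radialProfile k ((x ^ 2 + Real.exp u ^ 2 + 1) / (2 * Real.exp u)))
    (Real.exp (u / 2))
  simp only [hv] at hcv
  rw [abs_of_pos (by positivity)] at hcv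
  have him (x : ℝ) : (ofCoords (x, Real.exp u)).im = Real.exp u := ofCoords_im hy
  simp only [hx, him, hc1]
  rw [abel, hcv, integral_smul, integral_mul_const]
  have he : Real.exp u = Real.exp (u / 2) * Real.exp (u / 2) := by
    rw [← Real.exp_add]; ring_nf
  have h0 : (Real.exp (u / 2) : ℂ) ≠ 0 := by exact_mod_cast (Real.exp_pos _).ne'
  simp only [Complex.real_smul, he]
  push_cast
  push_cast at h0
  field_simp


lemma continuous_radialProfile {k : ℍ → ℂ} (hc : Continuous k) : Continuous (radialProfile k) := by
  have h1 : Continuous diagA := by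
    refine Continuous.subtype_mk (continuous_matrix fun i j => ?_) _
    fin_cases i <;> fin_cases j <;> simp <;> fun_prop
  have h2 : Continuous fun w : ℝ => Real.arcosh (max 1 w) :=
    Real.continuousOn_arcosh.comp_continuous (by fun_prop) fun w => le_max_left (1 : ℝ) w
  exact hc.comp ((h1.comp h2).smul continuous_const)

lemma radialProfile_eq_zero {k : ℍ → ℂ} (hs : ∀ z, k z ≠ 0 → dist z UpperHalfPlane.I ≤ 1)
    {w : ℝ} (hw : Real.cosh 1 < w) : radialProfile k w = 0 := by
  by_contra h
  have h1 := hs _ h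
  have hw1 : 1 ≤ w := (Real.one_le_cosh 1).trans hw.le
  rw [dist_diagA_smul_I, max_eq_right hw1, abs_of_nonneg (Real.arcosh_nonneg hw1)] at h1
  have := Real.cosh_le_cosh.2 (show |Real.arcosh w| ≤ |1| by
    rwa [abs_of_nonneg (Real.arcosh_nonneg hw1), abs_one])
  rw [Real.cosh_arcosh hw1] at this
  linarith

lemma cosh_one_lt : Real.cosh 1 < 1.55 := by
  rw [Real.cosh_eq]
  have h1 := Real.exp_one_lt_d9
  have h2 := Real.exp_one_gt_d9
  have h3 : Real.exp (-1) < 0.37 := by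
    rw [Real.exp_neg, inv_lt_comm₀ (by positivity) (by norm_num)]
    linarith
  linarith

/-- For $w\ge1$ and $|v|\ge2$ the argument is at least $3>\cosh1$. Hence all Abel integrals may be
taken over $[-2,2]$. -/
lemma eq_zero_of_two_lt_abs {F : ℝ → ℂ} (hF : ∀ w, Real.cosh 1 < w → F w = 0) {w v : ℝ}
    (hw : 1 ≤ w) (hv : 2 ≤ |v|) : F (w + v ^ 2 / 2) = 0 := by
  apply hF
  have := cosh_one_lt
  have : 2 ^ 2 ≤ v ^ 2 := by rw [← sq_abs v]; gcongr
  linarith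

lemma abel_eq_setIntegral {F : ℝ → ℂ} (hF : ∀ w, Real.cosh 1 < w → F w = 0) {w : ℝ}
    (hw : 1 ≤ w) : abel F w = ∫ v in Set.Icc (-2 : ℝ) 2, F (w + v ^ 2 / 2) := by
  rw [abel, setIntegral_eq_integral_of_forall_compl_eq_zero]
  intro v hv
  apply eq_zero_of_two_lt_abs hF hw
  by_contra h
  rw [not_le, abs_lt] at h
  exact hv ⟨h.1.le, h.2.le⟩

lemma continuous_abel_cosh {F : ℝ → ℂ} (hc : Continuous F)
    (hF : ∀ w, Real.cosh 1 < w → F w = 0) : Continuous fun u => abel F (Real.cosh u) := by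
  have : (fun u => abel F (Real.cosh u)) =
      fun u => ∫ v in Set.Icc (-2 : ℝ) 2, F (Real.cosh u + v ^ 2 / 2) := by
    ext u
    exact abel_eq_setIntegral hF (Real.one_le_cosh u)
  rw [this]
  exact continuous_parametric_integral_of_continuous (by fun_prop) isCompact_Icc

lemma abel_eq_zero {F : ℝ → ℂ} (hF : ∀ w, Real.cosh 1 < w → F w = 0) {w : ℝ}
    (hw : Real.cosh 1 < w) : abel F w = 0 := by
  rw [abel, integral_eq_zero_of_ae]
  refine Filter.Eventually.of_forall fun v => hF _ ?_
  have := sq_nonneg v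
  linarith

/-! ### The Abel transform of $k_t$ and its iterates, from the spectral side. -/

/-- The inverse Fourier transform, with the normalisation `∫ ρ(s) e^{isu} ds`. -/
def specInt (ρ : ℝ → ℂ) (u : ℝ) : ℂ := ∫ s : ℝ, ρ s * Complex.exp (s * u * Complex.I)

/-- The spectral density of the kernel `k_t`. -/
def specDensity (h : 𝓢(ℝ, ℝ)) (t s : ℝ) : ℂ := ((shifted h t s) ^ 2 / (2 * Real.pi) : ℝ)

/-- All moments of the density are finite. -/
def HasMoments (ρ : ℝ → ℂ) : Prop := ∀ n : ℕ, Integrable fun s : ℝ => (s : ℂ) ^ n * ρ s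

lemma HasMoments.integrable {ρ : ℝ → ℂ} (hρ : HasMoments ρ) : Integrable ρ := by
  simpa using hρ 0

lemma HasMoments.mul_id {ρ : ℝ → ℂ} (hρ : HasMoments ρ) (c : ℂ) :
    HasMoments fun s => c * s * ρ s := by
  intro n
  refine ((hρ (n + 1)).const_mul c).congr (Filter.Eventually.of_forall fun s => ?_)
  simp only
  ring

lemma norm_exp_mul_I (s u : ℝ) : ‖Complex.exp (s * u * Complex.I)‖ = 1 := by
  rw [← Complex.ofReal_mul, Complex.norm_exp_ofReal_mul_I]

lemma norm_specInt_le (ρ : ℝ → ℂ) (u : ℝ) : ‖specInt ρ u‖ ≤ ∫ s, ‖ρ s‖ := by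
  refine (norm_integral_le_integral_norm _).trans_eq ?_
  simp only [norm_mul, norm_exp_mul_I, mul_one]

lemma integrable_mul_exp {ρ : ℝ → ℂ} (hρ : Integrable ρ) (u : ℝ) :
    Integrable fun s : ℝ => ρ s * Complex.exp (s * u * Complex.I) := by
  refine hρ.mul_bdd (c := 1) (by fun_prop) (Filter.Eventually.of_forall fun s => ?_)
  rw [norm_exp_mul_I]

lemma HasMoments.hasDerivAt {ρ : ℝ → ℂ} (hρ : HasMoments ρ) (u : ℝ) :
    HasDerivAt (specInt ρ) (specInt (fun s => Complex.I * s * ρ s) u) u := by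
  have h := hasDerivAt_integral_of_dominated_loc_of_deriv_le (μ := volume) (𝕜 := ℝ)
    (F := fun u s : ℝ => ρ s * Complex.exp (s * u * Complex.I))
    (F' := fun u s : ℝ => Complex.I * s * ρ s * Complex.exp (s * u * Complex.I))
    (x₀ := u) (s := Set.univ) (bound := fun s => ‖Complex.I * s * ρ s‖) Filter.univ_mem
    (Filter.Eventually.of_forall fun u => (integrable_mul_exp hρ.integrable u).aestronglyMeasurable)
    (integrable_mul_exp hρ.integrable u)
    (integrable_mul_exp (hρ.mul_id Complex.I).integrable u).aestronglyMeasurable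
    (Filter.Eventually.of_forall fun s v _ => by rw [norm_mul, norm_exp_mul_I, mul_one])
    (hρ.mul_id Complex.I).integrable.norm
    (Filter.Eventually.of_forall fun s v _ => by
      have h1 : HasDerivAt (fun v : ℝ => (s * v * Complex.I : ℂ)) (s * 1 * Complex.I) v :=
        ((hasDerivAt_id v).ofReal_comp.const_mul (s : ℂ)).mul_const Complex.I
      have := h1.cexp.const_mul (ρ s)
      exact this.congr_deriv (by ring))
  exact h.2

lemma HasMoments.deriv_eq {ρ : ℝ → ℂ} (hρ : HasMoments ρ) :
    deriv (specInt ρ) = specInt (fun s => Complex.I * s * ρ s) :=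
  funext fun u => (hρ.hasDerivAt u).deriv

lemma HasMoments.contDiff {ρ : ℝ → ℂ} (hρ : HasMoments ρ) : ContDiff ℝ ∞ (specInt ρ) := by
  rw [contDiff_infty]
  intro n
  induction n generalizing ρ with
  | zero =>
    rw [Nat.cast_zero, contDiff_zero]
    exact continuous_iff_continuousAt.2 fun u => (hρ.hasDerivAt u).continuousAt
  | succ n ih =>
    rw [Nat.cast_succ, contDiff_succ_iff_deriv]
    refine ⟨fun u => (hρ.hasDerivAt u).differentiableAt, by simp, ?_⟩
    rw [hρ.deriv_eq]
    exact ih (hρ.mul_id _)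

lemma integrable_weight_mul_sq (h : 𝓢(ℝ, ℝ)) (N : ℕ) :
    Integrable fun σ : ℝ => (1 + |σ|) ^ N * h σ ^ 2 := by
  obtain ⟨C, hC⟩ := h.decay 0 0
  have hb : ∀ σ, ‖h σ‖ ≤ C := fun σ => by simpa using hC.2 σ
  have h1 := (h.integrable_pow_mul volume 0).add (h.integrable_pow_mul volume N)
  refine ((h1.const_mul (2 ^ N * C))).mono' (by fun_prop) (Filter.Eventually.of_forall fun σ => ?_)
  have h2 : (1 + |σ|) ^ N ≤ 2 ^ N * (1 + |σ| ^ N) := by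
    rcases le_total 1 |σ| with hs | hs
    · calc (1 + |σ|) ^ N ≤ (2 * |σ|) ^ N := by gcongr; linarith
        _ = 2 ^ N * |σ| ^ N := mul_pow _ _ _
        _ ≤ _ := by gcongr; linarith
    · calc (1 + |σ|) ^ N ≤ 2 ^ N := by gcongr; linarith
        _ ≤ _ := le_mul_of_one_le_right (by positivity) (by linarith [pow_nonneg (abs_nonneg σ) N])
  rw [Real.norm_of_nonneg (by positivity)]
  simp only [Pi.add_apply, pow_zero, one_mul, Real.norm_eq_abs]
  have h3 : h σ ^ 2 = |h σ| * |h σ| := by rw [← sq, sq_abs]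
  have h4 : |h σ| ≤ C := hb σ
  rw [h3]
  calc (1 + |σ|) ^ N * (|h σ| * |h σ|) ≤ (2 ^ N * (1 + |σ| ^ N)) * (C * |h σ|) := by gcongr
    _ = _ := by ring

lemma shifted_sq_le {h : 𝓢(ℝ, ℝ)} (he : ∀ x, h (-x) = h x) (t s : ℝ) :
    shifted h t s ^ 2 ≤ 2 * (h (s - t) ^ 2 + h (s + t) ^ 2) := by
  have : h (-s - t) = h (s + t) := by rw [← he]; ring_nf
  rw [shifted, this]
  nlinarith [sq_nonneg (h (s - t) - h (s + t))]

/-- The density consists of bumps at $t$ and $-t$. Since $|P|$ is even, a bound for $P$ near $t$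
serves both, and the result depends on $t$ only through $M$. -/
lemma weighted_specDensity {h : 𝓢(ℝ, ℝ)} (he : ∀ x, h (-x) = h x) (t : ℝ) {P : ℝ → ℂ}
    (hP : Continuous P) (hPe : ∀ s, ‖P (-s)‖ = ‖P s‖) {M : ℝ} {N : ℕ}
    (hM : ∀ σ, ‖P (σ + t)‖ ≤ M * (1 + |σ|) ^ N) :
    (Integrable fun s => P s * specDensity h t s) ∧
      ∫ s, ‖P s * specDensity h t s‖ ≤ M * ∫ σ, (1 + |σ|) ^ N * h σ ^ 2 := by
  have hi := (integrable_weight_mul_sq h N).const_mul M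
  have hi1 : Integrable fun s => M * ((1 + |s - t|) ^ N * h (s - t) ^ 2) :=
    hi.comp_sub_right t
  have hi2 : Integrable fun s => M * ((1 + |s + t|) ^ N * h (s + t) ^ 2) :=
    hi.comp_add_right t
  have hM1 (s : ℝ) : ‖P s‖ ≤ M * (1 + |s - t|) ^ N := by simpa using hM (s - t)
  have hM2 (s : ℝ) : ‖P s‖ ≤ M * (1 + |s + t|) ^ N := by
    rw [← hPe s, ← abs_neg (s + t)]
    simpa [sub_eq_add_neg, add_comm] using hM1 (-s)
  have hb (s : ℝ) : ‖P s * specDensity h t s‖ ≤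
      (M * ((1 + |s - t|) ^ N * h (s - t) ^ 2) + M * ((1 + |s + t|) ^ N * h (s + t) ^ 2)) / 2 := by
    rw [norm_mul, specDensity, Complex.norm_real, Real.norm_of_nonneg (by positivity)]
    have h1 := shifted_sq_le he t s
    have hpi := Real.pi_gt_three
    -- The constant is $2/(2\pi)\le1/2$, so the two bumps together contribute a single copy of the
    -- integral.
    have h2 : shifted h t s ^ 2 / (2 * Real.pi) ≤ (h (s - t) ^ 2 + h (s + t) ^ 2) / 2 := by
      rw [div_le_div_iff₀ (by positivity) (by norm_num)]
      nlinarith [sq_nonneg (h (s - t)), sq_nonneg (h (s + t))]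
    calc ‖P s‖ * (shifted h t s ^ 2 / (2 * Real.pi))
        ≤ ‖P s‖ * ((h (s - t) ^ 2 + h (s + t) ^ 2) / 2) := by gcongr
      _ = (‖P s‖ * h (s - t) ^ 2 + ‖P s‖ * h (s + t) ^ 2) / 2 := by ring
      _ ≤ (M * (1 + |s - t|) ^ N * h (s - t) ^ 2 + M * (1 + |s + t|) ^ N * h (s + t) ^ 2) / 2 := by
        gcongr
        · exact hM1 s
        · exact hM2 s
      _ = _ := by ring
  have hmeas : AEStronglyMeasurable (fun s => P s * specDensity h t s) := by
    have : Continuous (specDensity h t) := by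
      unfold specDensity shifted
      fun_prop
    exact (hP.mul this).aestronglyMeasurable
  have hI : Integrable fun s => P s * specDensity h t s :=
    ((hi1.add hi2).div_const 2).mono' hmeas (Filter.Eventually.of_forall hb)
  refine ⟨hI, (integral_mono hI.norm ((hi1.add hi2).div_const 2) hb).trans_eq ?_⟩
  rw [← integral_const_mul]
  simp only [Pi.add_apply]
  rw [integral_div, integral_add hi1 hi2,
    integral_sub_right_eq_self (fun s => M * ((1 + |s|) ^ N * h s ^ 2)) t,
    integral_add_right_eq_self (fun s => M * ((1 + |s|) ^ N * h s ^ 2)) t]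
  ring


/-- The iterates of `d²/du² + t²` applied to the Abel transform of `k_t`. -/
def abelIter (h : 𝓢(ℝ, ℝ)) (t : ℝ) (j : ℕ) : ℝ → ℂ :=
  specInt fun s => ((t : ℂ) ^ 2 - s ^ 2) ^ j * specDensity h t s

/-- With $s=t+\sigma$ one has $t^2-s^2=-\sigma(2t+\sigma)$, which is of order $t$ rather than $t^2$
up to powers of $1+|\sigma|$. This saving makes the iteration in $j$ profitable. -/
lemma norm_weight_le {t : ℝ} (ht : 1 ≤ t) (n j : ℕ) (σ : ℝ) :
    ‖((σ + t : ℝ) : ℂ) ^ n * ((t : ℂ) ^ 2 - ((σ + t : ℝ) : ℂ) ^ 2) ^ j‖ ≤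
      t ^ (n + j) * 2 ^ j * (1 + |σ|) ^ (n + 2 * j) := by
  have h0 := abs_nonneg σ
  have h1 : |σ + t| ≤ t * (1 + |σ|) := by
    refine (abs_add_le _ _).trans ?_
    rw [abs_of_pos (by linarith : 0 < t)]
    nlinarith
  have h2 : |t ^ 2 - (σ + t) ^ 2| ≤ 2 * t * (1 + |σ|) ^ 2 := by
    have : t ^ 2 - (σ + t) ^ 2 = -(σ * (2 * t + σ)) := by ring
    rw [this, abs_neg, abs_mul]
    have h3 : |2 * t + σ| ≤ 2 * t * (1 + |σ|) := by
      refine (abs_add_le _ _).trans ?_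
      rw [abs_of_pos (by linarith : 0 < 2 * t)]
      nlinarith
    calc |σ| * |2 * t + σ| ≤ (1 + |σ|) * (2 * t * (1 + |σ|)) := by gcongr; linarith
      _ = _ := by ring
  have h4 : ‖((σ + t : ℝ) : ℂ) ^ n * ((t : ℂ) ^ 2 - ((σ + t : ℝ) : ℂ) ^ 2) ^ j‖ =
      |σ + t| ^ n * |t ^ 2 - (σ + t) ^ 2| ^ j := by
    rw [norm_mul, norm_pow, norm_pow, Complex.norm_real, Real.norm_eq_abs, ← Real.norm_eq_abs
      (t ^ 2 - _), ← Complex.norm_real]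
    push_cast
    rfl
  rw [h4]
  calc |σ + t| ^ n * |t ^ 2 - (σ + t) ^ 2| ^ j
      ≤ (t * (1 + |σ|)) ^ n * (2 * t * (1 + |σ|) ^ 2) ^ j := by gcongr
    _ = _ := by rw [mul_pow, mul_pow, mul_pow, ← pow_mul, pow_add, pow_add]; ring

lemma weighted_specDensity_iter {h : 𝓢(ℝ, ℝ)} (he : ∀ x, h (-x) = h x) {t : ℝ} (ht : 1 ≤ t)
    (n j : ℕ) :
    (Integrable fun s : ℝ => (s : ℂ) ^ n * (((t : ℂ) ^ 2 - s ^ 2) ^ j * specDensity h t s)) ∧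
      ∫ s : ℝ, ‖(s : ℂ) ^ n * (((t : ℂ) ^ 2 - s ^ 2) ^ j * specDensity h t s)‖ ≤
        t ^ (n + j) * 2 ^ j * ∫ σ, (1 + |σ|) ^ (n + 2 * j) * h σ ^ 2 := by
  simp only [← mul_assoc]
  refine weighted_specDensity he t (P := fun s : ℝ => (s : ℂ) ^ n * ((t : ℂ) ^ 2 - s ^ 2) ^ j)
    (by fun_prop) (fun s => ?_) (norm_weight_le ht n j)
  simp

lemma hasMoments_iter {h : 𝓢(ℝ, ℝ)} (he : ∀ x, h (-x) = h x) {t : ℝ} (ht : 1 ≤ t) (j : ℕ) :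
    HasMoments fun s : ℝ => ((t : ℂ) ^ 2 - s ^ 2) ^ j * specDensity h t s :=
  fun n => (weighted_specDensity_iter he ht n j).1

lemma contDiff_abelIter {h : 𝓢(ℝ, ℝ)} (he : ∀ x, h (-x) = h x) {t : ℝ} (ht : 1 ≤ t) (j : ℕ) :
    ContDiff ℝ ∞ (abelIter h t j) := (hasMoments_iter he ht j).contDiff

lemma iteratedDeriv_specInt {ρ : ℝ → ℂ} (hρ : HasMoments ρ) (n : ℕ) :
    deriv^[n] (specInt ρ) = specInt (fun s => Complex.I ^ n * (s ^ n * ρ s)) := by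
  induction n generalizing ρ with
  | zero => simp
  | succ n ih =>
    rw [Function.iterate_succ_apply, hρ.deriv_eq, ih (hρ.mul_id _)]
    congr 1
    ext s
    ring

/-- A derivative costs one factor $t$ because the frequencies lie near $\pm t$; an iterate also
costs only one factor $t$. -/
lemma norm_deriv_abelIter_le {h : 𝓢(ℝ, ℝ)} (he : ∀ x, h (-x) = h x) (j n : ℕ) :
    ∃ C, 0 < C ∧ ∀ t : ℝ, 1 ≤ t → ∀ u, ‖deriv^[n] (abelIter h t j) u‖ ≤ C * t ^ (n + j) := by
  have h0 : 0 ≤ ∫ σ, (1 + |σ|) ^ (n + 2 * j) * h σ ^ 2 :=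
    integral_nonneg fun σ => by positivity
  refine ⟨2 ^ j * (∫ σ, (1 + |σ|) ^ (n + 2 * j) * h σ ^ 2) + 1, by positivity, fun t ht u => ?_⟩
  rw [abelIter, iteratedDeriv_specInt (hasMoments_iter he ht j)]
  refine (norm_specInt_le _ _).trans ?_
  simp only [norm_mul, norm_pow, Complex.norm_I, one_pow, one_mul]
  have := (weighted_specDensity_iter he ht n j).2
  simp only [norm_mul, norm_pow] at this
  refine this.trans ?_
  have : 0 < t ^ (n + j) := by positivity
  nlinarith

lemma abelIter_succ {h : 𝓢(ℝ, ℝ)} (he : ∀ x, h (-x) = h x) {t : ℝ} (ht : 1 ≤ t) (j : ℕ) (u : ℝ) :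
    abelIter h t (j + 1) u =
      deriv (deriv (abelIter h t j)) u + t ^ 2 * abelIter h t j u := by
  have hm := hasMoments_iter he ht j
  rw [abelIter, abelIter, hm.deriv_eq, (hm.mul_id _).deriv_eq]
  simp only [specInt]
  rw [← integral_const_mul, ← integral_add (integrable_mul_exp ((hm.mul_id _).mul_id _).integrable u)
    ((integrable_mul_exp hm.integrable u).const_mul _)]
  refine integral_congr_ae (Filter.Eventually.of_forall fun s => ?_)
  simp only
  have := Complex.I_sq
  linear_combination (-(s : ℂ) ^ 2 * ((t : ℂ) ^ 2 - s ^ 2) ^ j * specDensity h t s *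
    Complex.exp (s * u * Complex.I)) * this

lemma abelIter_neg {h : 𝓢(ℝ, ℝ)} (t : ℝ) (j : ℕ) (u : ℝ) :
    abelIter h t j (-u) = abelIter h t j u := by
  simp only [abelIter, specInt]
  rw [← integral_neg_eq_self]
  refine integral_congr_ae (Filter.Eventually.of_forall fun s => ?_)
  simp only [specDensity, shifted]
  push_cast
  rw [neg_mul_neg, neg_sq, neg_neg, add_comm (h (-s - t) : ℂ)]

/-- The iterates arise by applying differential operators, which do not enlarge supports. -/
lemma abelIter_eq_zero {h : 𝓢(ℝ, ℝ)} (he : ∀ x, h (-x) = h x) {t : ℝ} (ht : 1 ≤ t)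
    (h0 : ∀ u, 1 < |u| → abelIter h t 0 u = 0) (j : ℕ) (u : ℝ) (hu : 1 < |u|) :
    abelIter h t j u = 0 := by
  induction j generalizing u with
  | zero => exact h0 u hu
  | succ j ih =>
    have hd {f : ℝ → ℂ} (hf : ∀ u, 1 < |u| → f u = 0) (u : ℝ) (hu : 1 < |u|) : deriv f u = 0 := by
      have : f =ᶠ[nhds u] fun _ => 0 :=
        Filter.eventually_of_mem ((isOpen_lt continuous_const continuous_abs).mem_nhds hu) hf
      rw [this.deriv_eq, deriv_const]
    rw [abelIter_succ he ht, ih u hu, hd (hd ih) u hu]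
    simp

/-- The Abel transform is continuous with compact support, and its Fourier transform is the
prescribed $h_t^2$, which is integrable, so Fourier inversion identifies it. -/
lemma abel_radialProfile {h : 𝓢(ℝ, ℝ)} (hh : IsAdmissible h) {t : ℝ} (ht : 1 ≤ t) {k : ℍ → ℂ}
    (hk : IsSpectralKernel h t k) (u : ℝ) :
    abel (radialProfile k) (Real.cosh u) = abelIter h t 0 u := by
  have hz : ∀ w, Real.cosh 1 < w → radialProfile k w = 0 :=
    fun w hw => radialProfile_eq_zero hk.support hw
  set f : ℝ → ℂ := fun u => abel (radialProfile k) (Real.cosh u) with hf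
  have hc : Continuous f := continuous_abel_cosh (continuous_radialProfile hk.continuous) hz
  have hsupp : HasCompactSupport f := by
    refine HasCompactSupport.of_support_subset_isCompact (isCompact_Icc (a := -1) (b := 1)) ?_
    intro u hu
    rw [Set.mem_Icc, ← abs_le]
    by_contra hn
    rw [not_le] at hn
    refine hu (abel_eq_zero hz ?_)
    rw [Real.cosh_lt_cosh]
    simpa using hn
  have hF (ξ : ℝ) : 𝓕 f ξ = 2 * Real.pi * specDensity h t (2 * Real.pi * ξ) := by
    -- The Harish-Chandra transform is written with $e^{+isu}$, the Fourier transform with $e^{-2\pi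
    -- i\xi u}$; hence the sign, which is removed below by the evenness of $h_t$.
    have h1 := hk.transform (-(2 * Real.pi * ξ))
    rw [harishChandra_eq_fourier_abel hk.continuous hk.invariant hk.support] at h1
    have h2 : 𝓕 f ξ = ∫ u : ℝ, Complex.exp ((-(2 * Real.pi * ξ) : ℝ) * u * Complex.I) * f u := by
      rw [Real.fourier_real_eq_integral_exp_smul]
      refine integral_congr_ae (Filter.Eventually.of_forall fun s => ?_)
      simp only [smul_eq_mul]
      congr 2
      push_cast
      ring
    rw [h2, h1, specDensity]
    have : shifted h t (-(2 * Real.pi * ξ)) = shifted h t (2 * Real.pi * ξ) := by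
      simp only [shifted, neg_neg]
      ring
    rw [this]
    have hpi : (Real.pi : ℂ) ≠ 0 := by exact_mod_cast Real.pi_ne_zero
    push_cast
    field_simp
  have hm := (hasMoments_iter hh.even ht 0).integrable
  simp only [pow_zero, one_mul] at hm
  have hFi : Integrable (𝓕 f) := by
    have := (hm.comp_mul_left' (R := 2 * Real.pi) (by positivity)).const_mul (2 * Real.pi : ℂ)
    exact this.congr (Filter.Eventually.of_forall fun ξ => (hF ξ).symm)
  have hinv := congrFun (hc.fourierInv_fourier_eq (hc.integrable_of_hasCompactSupport hsupp) hFi) u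
  rw [Real.fourierInv_eq'] at hinv
  change f u = _
  rw [← hinv]
  simp only [hF]
  have hcv := Measure.integral_comp_mul_left
    (fun s : ℝ => 2 * Real.pi * specDensity h t s * Complex.exp (s * u * Complex.I)) (2 * Real.pi)
  calc _ = ∫ ξ : ℝ, 2 * Real.pi * specDensity h t (2 * Real.pi * ξ) *
        Complex.exp ((2 * Real.pi * ξ : ℝ) * u * Complex.I) := by
        refine integral_congr_ae (Filter.Eventually.of_forall fun s => ?_)
        simp only [smul_eq_mul]
        rw [mul_comm]
        congr 2
        simp
        ring
    _ = _ := by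
        rw [hcv, abs_of_pos (by positivity), abelIter, specInt, ← integral_smul]
        refine integral_congr_ae (Filter.Eventually.of_forall fun s => ?_)
        have hpi : (Real.pi : ℂ) ≠ 0 := by exact_mod_cast Real.pi_ne_zero
        simp only [Complex.real_smul]
        push_cast
        field_simp


/-! ### Functions of $\cosh u$ and their regularity at $u=0$. -/

/-- Functions of `w = cosh u` which are smooth for `u ≠ 0` and vanish for `|u| > 1`. -/
structure IsTail (F : ℝ → ℂ) : Prop where
  contDiffOn : ContDiffOn ℝ ∞ F (Set.Ioi 1)
  eq_zero : ∀ w, Real.cosh 1 < w → F w = 0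

lemma IsTail.deriv {F : ℝ → ℂ} (hF : IsTail F) : IsTail (deriv F) where
  contDiffOn := ((contDiffOn_infty_iff_deriv_of_isOpen isOpen_Ioi).1 hF.contDiffOn).2
  eq_zero w hw := by
    have : F =ᶠ[nhds w] fun _ => 0 :=
      Filter.eventually_of_mem (isOpen_Ioi.mem_nhds hw) fun v hv => hF.eq_zero v hv
    rw [this.deriv_eq, deriv_const]

lemma IsTail.hasDerivAt {F : ℝ → ℂ} (hF : IsTail F) {w : ℝ} (hw : 1 < w) :
    HasDerivAt F (_root_.deriv F w) w :=
  ((hF.contDiffOn.differentiableOn (by simp)).differentiableAt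
    (isOpen_Ioi.mem_nhds hw)).hasDerivAt

lemma IsTail.bounded {F : ℝ → ℂ} (hF : IsTail F) {a : ℝ} (ha : 1 < a) :
    ∃ M, 0 ≤ M ∧ ∀ w, a ≤ w → ‖F w‖ ≤ M := by
  obtain ⟨M, hM⟩ := (isCompact_Icc (a := a) (b := Real.cosh 1)).exists_bound_of_continuousOn
    (hF.contDiffOn.continuousOn.mono fun x hx => lt_of_lt_of_le ha hx.1)
  refine ⟨max M 0, le_max_right _ _, fun w hw => ?_⟩
  rcases le_or_gt w (Real.cosh 1) with h | h
  · exact (hM w ⟨hw, h⟩).trans (le_max_left _ _)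
  · rw [hF.eq_zero w h, norm_zero]
    exact le_max_right _ _

lemma IsTail.continuous_comp {F : ℝ → ℂ} (hF : IsTail F) {w : ℝ} (hw : 1 < w) :
    Continuous fun v : ℝ => F (w + v ^ 2 / 2) :=
  hF.contDiffOn.continuousOn.comp_continuous (by fun_prop) fun v => by
    have := sq_nonneg v
    simp only [Set.mem_Ioi]
    linarith

lemma IsTail.norm_le_indicator {F : ℝ → ℂ} (hF : IsTail F) {a M : ℝ} (ha : 1 ≤ a)
    (hM : ∀ w, a < w → ‖F w‖ ≤ M) {v : ℝ} (hv : v ≠ 0) {w : ℝ} (hw : a ≤ w) :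
    ‖F (w + v ^ 2 / 2)‖ ≤ (Set.Icc (-2 : ℝ) 2).indicator (fun _ => M) v := by
  by_cases h : v ∈ Set.Icc (-2 : ℝ) 2
  · rw [Set.indicator_of_mem h]
    apply hM
    have : 0 < v ^ 2 := by positivity
    linarith
  · rw [Set.indicator_of_notMem h, eq_zero_of_two_lt_abs hF.eq_zero (ha.trans hw), norm_zero]
    by_contra h'
    rw [not_le, abs_lt] at h'
    exact h ⟨h'.1.le, h'.2.le⟩

lemma ae_ne_zero : ∀ᵐ v : ℝ, v ≠ 0 := by
  simp [ae_iff, measure_singleton]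

lemma integrable_indicator_const (M : ℝ) :
    Integrable ((Set.Icc (-2 : ℝ) 2).indicator fun _ => M) :=
  (integrable_indicator_iff measurableSet_Icc).2 (by simp)

lemma IsTail.integrable {F : ℝ → ℂ} (hF : IsTail F) {w : ℝ} (hw : 1 < w) :
    Integrable fun v : ℝ => F (w + v ^ 2 / 2) := by
  obtain ⟨M, hM0, hM⟩ := hF.bounded hw
  refine (integrable_indicator_const M).mono' (hF.continuous_comp hw).aestronglyMeasurable ?_
  filter_upwards [ae_ne_zero] with v hv
  exact hF.norm_le_indicator hw.le (fun w' h => hM w' h.le) hv le_rfl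

lemma IsTail.hasDerivAt_abel {F : ℝ → ℂ} (hF : IsTail F) {w : ℝ} (hw : 1 < w) :
    HasDerivAt (abel F) (abel (_root_.deriv F) w) w := by
  have ha : 1 < (1 + w) / 2 := by linarith
  obtain ⟨M, hM0, hM⟩ := hF.deriv.bounded ha
  have h := hasDerivAt_integral_of_dominated_loc_of_deriv_le (μ := volume) (𝕜 := ℝ)
    (F := fun w v : ℝ => F (w + v ^ 2 / 2))
    (F' := fun w v : ℝ => _root_.deriv F (w + v ^ 2 / 2))
    (x₀ := w) (s := Set.Ioi ((1 + w) / 2)) (bound := (Set.Icc (-2 : ℝ) 2).indicator fun _ => M)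
    (isOpen_Ioi.mem_nhds (by simp only [Set.mem_Ioi]; linarith))
    (Filter.eventually_of_mem (isOpen_Ioi.mem_nhds hw) fun w' hw' =>
      (hF.continuous_comp hw').aestronglyMeasurable)
    (hF.integrable hw)
    (hF.deriv.continuous_comp hw).aestronglyMeasurable
    (by
      filter_upwards [ae_ne_zero] with v hv w' hw'
      exact hF.deriv.norm_le_indicator ha.le (fun w' h => hM w' h.le) hv (le_of_lt hw'))
    (integrable_indicator_const M)
    (Filter.Eventually.of_forall fun v w' hw' => by
      have h1 : 1 < w' + v ^ 2 / 2 := by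
        have := sq_nonneg v
        have : (1 + w) / 2 < w' := hw'
        linarith
      simpa [Function.comp_def] using (hF.hasDerivAt h1).scomp w' ((hasDerivAt_id w').add_const (v ^ 2 / 2)))
  exact h.2

lemma IsTail.norm_abel_le {F : ℝ → ℂ} (hF : IsTail F) {M : ℝ}
    (hM : ∀ w, 1 < w → ‖F w‖ ≤ M) {w : ℝ} (hw : 1 ≤ w) : ‖abel F w‖ ≤ 4 * M := by
  refine (norm_integral_le_of_norm_le (integrable_indicator_const M) ?_).trans_eq ?_
  · filter_upwards [ae_ne_zero] with v hv
    exact hF.norm_le_indicator le_rfl hM hv hw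
  · rw [integral_indicator measurableSet_Icc]
    simp
    norm_num

/-- Even test functions on the line supported in `[-1, 1]`. -/
structure IsProfile (g : ℝ → ℂ) : Prop where
  contDiff : ContDiff ℝ ∞ g
  even : ∀ u, g (-u) = g u
  eq_zero : ∀ u, 1 < |u| → g u = 0

lemma IsProfile.isTail {g : ℝ → ℂ} (hg : IsProfile g) : IsTail (g ∘ Real.arcosh) where
  contDiffOn := hg.contDiff.comp_contDiffOn Real.contDiffOn_arcosh
  eq_zero w hw := by
    have hw1 : 1 ≤ w := (Real.one_le_cosh 1).trans hw.le
    apply hg.eq_zero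
    rw [← Real.cosh_arcosh hw1, Real.cosh_lt_cosh] at hw
    simpa using hw

lemma IsProfile.deriv_deriv {g : ℝ → ℂ} (hg : IsProfile g) : IsProfile (deriv (deriv g)) := by
  have h1 : ContDiff ℝ ∞ (deriv g) := (contDiff_infty_iff_deriv.1 hg.contDiff).2
  refine ⟨(contDiff_infty_iff_deriv.1 h1).2, fun u => ?_, fun u hu => ?_⟩
  · have e : (fun u => g (-u)) = g := funext hg.even
    have e1 (u : ℝ) : deriv g u = -deriv g (-u) := by
      conv_lhs => rw [← e]
      rw [deriv_comp_neg]
    have e2 : deriv g = fun u => -deriv g (-u) := funext e1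
    conv_rhs => rw [e2]
    rw [deriv.fun_neg, deriv_comp_neg, neg_neg]
  · have hd {f : ℝ → ℂ} (hf : ∀ u, 1 < |u| → f u = 0) (u : ℝ) (hu : 1 < |u|) : deriv f u = 0 := by
      have : f =ᶠ[nhds u] fun _ => 0 :=
        Filter.eventually_of_mem ((isOpen_lt continuous_const continuous_abs).mem_nhds hu) hf
      rw [this.deriv_eq, deriv_const]
    exact hd (hd hg.eq_zero) u hu

lemma IsProfile.deriv_zero {g : ℝ → ℂ} (hg : IsProfile g) : deriv g 0 = 0 := by
  have e : (fun u => g (-u)) = g := funext hg.even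
  have e1 : deriv g 0 = -deriv g (-0) := by
    conv_lhs => rw [← e]
    rw [deriv_comp_neg]
  rw [neg_zero] at e1
  exact self_eq_neg.1 e1

lemma IsProfile.bounded {g : ℝ → ℂ} (hg : IsProfile g) : ∃ M, 0 ≤ M ∧ ∀ u, ‖g u‖ ≤ M := by
  obtain ⟨M, hM⟩ := (isCompact_Icc (a := (-1 : ℝ)) (b := 1)).exists_bound_of_continuousOn
    hg.contDiff.continuous.continuousOn
  refine ⟨max M 0, le_max_right _ _, fun u => ?_⟩
  rcases le_or_gt |u| 1 with h | h
  · exact (hM u (abs_le.1 h)).trans (le_max_left _ _)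
  · rw [hg.eq_zero u h, norm_zero]
    exact le_max_right _ _

lemma IsProfile.hasDerivAt {g : ℝ → ℂ} (hg : IsProfile g) (u : ℝ) :
    HasDerivAt g (deriv g u) u :=
  ((contDiff_infty_iff_deriv.1 hg.contDiff).1 u).hasDerivAt

lemma IsProfile.hasDerivAt_deriv {g : ℝ → ℂ} (hg : IsProfile g) (u : ℝ) :
    HasDerivAt (deriv g) (deriv (deriv g) u) u :=
  ((contDiff_infty_iff_deriv.1 (contDiff_infty_iff_deriv.1 hg.contDiff).2).1 u).hasDerivAt

lemma IsProfile.norm_deriv_le {g : ℝ → ℂ} (hg : IsProfile g) {M : ℝ}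
    (hM : ∀ u, ‖deriv (deriv g) u‖ ≤ M) {u : ℝ} (hu : 0 ≤ u) : ‖deriv g u‖ ≤ M * u := by
  have := (convex_univ (𝕜 := ℝ) (E := ℝ)).norm_image_sub_le_of_norm_hasDerivWithin_le
    (fun x _ => (hg.hasDerivAt_deriv x).hasDerivWithinAt) (fun x _ => hM x)
    (Set.mem_univ 0) (Set.mem_univ u)
  rwa [hg.deriv_zero, sub_zero, sub_zero, Real.norm_of_nonneg hu] at this

lemma IsProfile.deriv_eq {g : ℝ → ℂ} (hg : IsProfile g) {u : ℝ} (hu : 0 < u) :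
    deriv g u = Real.sinh u * deriv (g ∘ Real.arcosh) (Real.cosh u) := by
  have h1 := (hg.isTail.hasDerivAt (Real.one_lt_cosh.2 hu.ne')).scomp u (Real.hasDerivAt_cosh u)
  have h2 : ((g ∘ Real.arcosh) ∘ Real.cosh) =ᶠ[nhds u] g :=
    Filter.eventually_of_mem (isOpen_Ioi.mem_nhds hu) fun v hv => by
      simp [Real.arcosh_cosh (le_of_lt hv)]
  rw [← h2.deriv_eq, h1.deriv, Complex.real_smul]

lemma IsProfile.deriv_deriv_eq {g : ℝ → ℂ} (hg : IsProfile g) {u : ℝ} (hu : 0 < u) :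
    deriv (deriv g) u = Real.cosh u * deriv (g ∘ Real.arcosh) (Real.cosh u) +
      Real.sinh u ^ 2 * deriv (deriv (g ∘ Real.arcosh)) (Real.cosh u) := by
  have h1 := (hg.isTail.deriv.hasDerivAt (Real.one_lt_cosh.2 hu.ne')).scomp u
    (Real.hasDerivAt_cosh u)
  have h2 := ((Real.hasDerivAt_sinh u).ofReal_comp).mul h1
  have h3 : (fun u => (Real.sinh u : ℂ)) * (deriv (g ∘ Real.arcosh) ∘ Real.cosh) =ᶠ[nhds u]
      deriv g :=
    Filter.eventually_of_mem (isOpen_Ioi.mem_nhds hu) fun v hv => (hg.deriv_eq hv).symm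
  rw [← h3.deriv_eq, h2.deriv, Complex.real_smul]
  simp only [Function.comp_apply]
  ring

/-- Writing $G=g\circ\operatorname{arcosh}$, one has $G'(\cosh u)=g'(u)/\sinh u$. Evenness gives
$g'(0)=0$, so $|g'(u)|\le Mu\le M\sinh u$ and there is no singularity at $u=0$. -/
lemma IsProfile.norm_deriv_tail_le {g : ℝ → ℂ} (hg : IsProfile g) {M : ℝ}
    (hM : ∀ u, ‖deriv (deriv g) u‖ ≤ M) {w : ℝ} (hw : 1 < w) :
    ‖deriv (g ∘ Real.arcosh) w‖ ≤ M := by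
  have hu := Real.arcosh_pos hw
  have h1 := hg.deriv_eq hu
  rw [Real.cosh_arcosh hw.le] at h1
  have h2 := hg.norm_deriv_le hM hu.le
  have hs := Real.self_le_sinh_iff.2 hu.le
  have hM0 : 0 ≤ M := (norm_nonneg _).trans (hM 0)
  rw [h1, norm_mul, Complex.norm_real, Real.norm_of_nonneg (hu.le.trans hs)] at h2
  have h3 : Real.sinh (Real.arcosh w) * ‖deriv (g ∘ Real.arcosh) w‖ ≤
      Real.sinh (Real.arcosh w) * M := by nlinarith
  exact le_of_mul_le_mul_left h3 (hu.trans_le hs)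

/-- The companion of the previous bound that uses $g'$ instead of $g''$. It is singular at $w=1$,
but for $k_t$ it costs $t$ instead of $t^2$. -/
lemma IsProfile.norm_deriv_tail_le' {g : ℝ → ℂ} (hg : IsProfile g) {M : ℝ}
    (hM : ∀ u, ‖deriv g u‖ ≤ M) {w : ℝ} (hw : 1 < w) :
    ‖deriv (g ∘ Real.arcosh) w‖ ≤ M / √(w - 1) := by
  have hu := Real.arcosh_pos hw
  have h1 := hg.deriv_eq hu
  rw [Real.cosh_arcosh hw.le, Real.sinh_arcosh hw.le] at h1
  have h2 := hM (Real.arcosh w)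
  have h3 : √(w - 1) ≤ √(w ^ 2 - 1) := Real.sqrt_le_sqrt (by nlinarith)
  rw [h1, norm_mul, Complex.norm_real, Real.norm_of_nonneg (Real.sqrt_nonneg _)] at h2
  rw [le_div_iff₀ (Real.sqrt_pos.2 (by linarith))]
  nlinarith [norm_nonneg (deriv (g ∘ Real.arcosh) w)]

/-- Here $\sinh^3u\;G''(\cosh u)=g''\sinh u-g'\cosh u$. The right side vanishes at $0$ and has
derivative $(g'''-g')\sinh u$, where $g'''$ and $g'$ are odd and so $O(u)$. Integration gives
$O(u^2\sinh u)=O(\sinh^3u)$. -/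
lemma IsProfile.exists_norm_deriv_deriv_tail_le {g : ℝ → ℂ} (hg : IsProfile g) :
    ∃ M, 0 ≤ M ∧ ∀ w, 1 < w → ‖deriv (deriv (g ∘ Real.arcosh)) w‖ ≤ M := by
  obtain ⟨M₂, hM₂, hb₂⟩ := hg.deriv_deriv.bounded
  obtain ⟨M₄, hM₄, hb₄⟩ := hg.deriv_deriv.deriv_deriv.bounded
  set M := M₂ + M₄ with hMdef
  refine ⟨M, by positivity, fun w hw => ?_⟩
  have hu := Real.arcosh_pos hw
  set u := Real.arcosh w with hudef
  have hcosh : Real.cosh u = w := Real.cosh_arcosh hw.le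
  have hs := Real.self_le_sinh_iff.2 hu.le
  have hs0 : 0 < Real.sinh u := hu.trans_le hs
  set N : ℝ → ℂ := fun x => deriv (deriv g) x * Real.sinh x - deriv g x * Real.cosh x
  have hN (x : ℝ) : HasDerivAt N ((deriv (deriv (deriv g)) x - deriv g x) * Real.sinh x) x := by
    have h1 := (hg.deriv_deriv.hasDerivAt x).mul (Real.hasDerivAt_sinh x).ofReal_comp
    have h2 := (hg.hasDerivAt_deriv x).mul (Real.hasDerivAt_cosh x).ofReal_comp
    exact (h1.sub h2).congr_deriv (by ring)
  have hN' (x : ℝ) (hx : x ∈ Set.Icc 0 u) :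
      ‖(deriv (deriv (deriv g)) x - deriv g x) * Real.sinh x‖ ≤ M * u * Real.sinh u := by
    have h1 := hg.deriv_deriv.norm_deriv_le hb₄ hx.1
    have h2 := hg.norm_deriv_le hb₂ hx.1
    have h3 : 0 ≤ Real.sinh x := Real.sinh_nonneg_iff.2 hx.1
    have h4 : Real.sinh x ≤ Real.sinh u := Real.sinh_le_sinh.2 hx.2
    rw [norm_mul, Complex.norm_real, Real.norm_of_nonneg h3]
    have h5 : ‖deriv (deriv (deriv g)) x - deriv g x‖ ≤ M * u :=
      calc _ ≤ M₄ * x + M₂ * x := (norm_sub_le _ _).trans (add_le_add h1 h2)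
        _ = M * x := by rw [hMdef]; ring
        _ ≤ M * u := by gcongr; exact hx.2
    gcongr
  have h0 : N 0 = 0 := by simp [N, hg.deriv_zero]
  have h1 := (convex_Icc (0 : ℝ) u).norm_image_sub_le_of_norm_hasDerivWithin_le
    (fun x _ => (hN x).hasDerivWithinAt) hN' (Set.left_mem_Icc.2 hu.le) (Set.right_mem_Icc.2 hu.le)
  rw [h0, sub_zero, sub_zero, Real.norm_of_nonneg hu.le] at h1
  have h2 : N u = Real.sinh u ^ 3 * deriv (deriv (g ∘ Real.arcosh)) w := by
    have e1 := hg.deriv_eq hu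
    have e2 := hg.deriv_deriv_eq hu
    rw [hcosh] at e1 e2
    simp only [N, e1, e2, hcosh]
    ring
  rw [h2, norm_mul, norm_pow, Complex.norm_real, Real.norm_of_nonneg hs0.le] at h1
  have h3 : M * u * Real.sinh u * u ≤ Real.sinh u ^ 3 * M := by
    have : u * u ≤ Real.sinh u * Real.sinh u := by gcongr
    nlinarith [mul_le_mul_of_nonneg_left this (show 0 ≤ M * Real.sinh u by positivity)]
  exact le_of_mul_le_mul_left (h1.trans h3) (by positivity)


/-! ### Inversion of the Abel transform and the radial Laplacian. -/

/-- The inverse Abel transform. -/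
def invAbel (g : ℝ → ℂ) (w : ℝ) : ℂ := -(1 / (2 * Real.pi)) * abel (deriv (g ∘ Real.arcosh)) w

lemma norm_inv_two_pi : ‖(-(1 / (2 * Real.pi)) : ℂ)‖ = 1 / (2 * Real.pi) := by
  rw [norm_neg, norm_div, norm_one, norm_mul, Complex.norm_real,
    Real.norm_of_nonneg Real.pi_pos.le]
  norm_num

/-- The Abel integral has length $4$, and $4/(2\pi)\le1$. -/
lemma IsProfile.norm_invAbel_le {g : ℝ → ℂ} (hg : IsProfile g) {M : ℝ}
    (hM : ∀ u, ‖deriv (deriv g) u‖ ≤ M) {w : ℝ} (hw : 1 ≤ w) : ‖invAbel g w‖ ≤ M := by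
  have h1 := hg.isTail.deriv.norm_abel_le (fun w hw => hg.norm_deriv_tail_le hM hw) hw
  have hM0 : 0 ≤ M := (norm_nonneg _).trans (hM 0)
  have hpi := Real.pi_gt_three
  rw [invAbel, norm_mul, norm_inv_two_pi, div_mul_eq_mul_div, one_mul, div_le_iff₀ (by positivity)]
  nlinarith

/-- The derivative of the inverse Abel transform. -/
def invAbel' (g : ℝ → ℂ) (w : ℝ) : ℂ :=
  -(1 / (2 * Real.pi)) * abel (deriv (deriv (g ∘ Real.arcosh))) w

/-- The second derivative of the inverse Abel transform. -/
def invAbel'' (g : ℝ → ℂ) (w : ℝ) : ℂ :=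
  -(1 / (2 * Real.pi)) * abel (deriv (deriv (deriv (g ∘ Real.arcosh)))) w

lemma IsProfile.hasDerivAt_invAbel {g : ℝ → ℂ} (hg : IsProfile g) {w : ℝ} (hw : 1 < w) :
    HasDerivAt (invAbel g) (invAbel' g w) w :=
  (hg.isTail.deriv.hasDerivAt_abel hw).const_mul _

lemma IsProfile.hasDerivAt_invAbel' {g : ℝ → ℂ} (hg : IsProfile g) {w : ℝ} (hw : 1 < w) :
    HasDerivAt (invAbel' g) (invAbel'' g w) w :=
  (hg.isTail.deriv.deriv.hasDerivAt_abel hw).const_mul _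

lemma IsProfile.exists_norm_invAbel'_le {g : ℝ → ℂ} (hg : IsProfile g) :
    ∃ M, 0 ≤ M ∧ ∀ w, 1 < w → ‖invAbel' g w‖ ≤ M := by
  obtain ⟨M, hM0, hM⟩ := hg.exists_norm_deriv_deriv_tail_le
  refine ⟨1 / (2 * Real.pi) * (4 * M), by positivity, fun w hw => ?_⟩
  rw [invAbel', norm_mul, norm_inv_two_pi]
  have := hg.isTail.deriv.deriv.norm_abel_le hM hw.le
  gcongr

lemma IsProfile.invAbel_eq_zero {g : ℝ → ℂ} (hg : IsProfile g) {w : ℝ} (hw : Real.cosh 1 < w) :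
    invAbel g w = 0 := by
  rw [invAbel, abel_eq_zero hg.isTail.deriv.eq_zero hw, mul_zero]

/-- The radial part of the hyperbolic Laplacian becomes `d²/du² - 1/4` under the Abel transform. -/
lemma IsProfile.laplacian_invAbel {g : ℝ → ℂ} (hg : IsProfile g) {w : ℝ} (hw : 1 < w) :
    (w ^ 2 - 1) * invAbel'' g w + 2 * w * invAbel' g w =
      invAbel (deriv (deriv g)) w - 1 / 4 * invAbel g w := by
  set G := g ∘ Real.arcosh with hG
  set G₁ := deriv G
  set G₂ := deriv G₁ with hG₂
  set G₃ := deriv G₂ with hG₃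
  have t1 : IsTail G₁ := hg.isTail.deriv
  have t2 : IsTail G₂ := t1.deriv
  have t3 : IsTail G₃ := t2.deriv
  have tg : IsTail (deriv (deriv (deriv g) ∘ Real.arcosh)) := hg.deriv_deriv.isTail.deriv
  have hode {W : ℝ} (hW : 1 < W) : deriv (deriv (deriv g) ∘ Real.arcosh) W =
      (W ^ 2 - 1) * G₃ W + 3 * W * G₂ W + G₁ W := by
    have e : deriv (deriv g) ∘ Real.arcosh =ᶠ[nhds W]
        fun W => ((W ^ 2 - 1 : ℝ) : ℂ) * G₂ W + (W : ℂ) * G₁ W := by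
      refine Filter.eventually_of_mem (isOpen_Ioi.mem_nhds hW) fun V hV => ?_
      have := hg.deriv_deriv_eq (Real.arcosh_pos hV)
      rw [Real.cosh_arcosh (le_of_lt hV)] at this
      simp only [Function.comp_apply, this]
      have hs : Real.sinh (Real.arcosh V) ^ 2 = V ^ 2 - 1 := by
        rw [Real.sinh_sq, Real.cosh_arcosh (le_of_lt hV)]
      rw [← hs]
      push_cast
      ring
    have d1 : HasDerivAt (fun W : ℝ => ((W ^ 2 - 1 : ℝ) : ℂ)) ((2 * W : ℝ) : ℂ) W := by
      have : HasDerivAt (fun W : ℝ => W ^ 2 - 1) (2 * W) W := by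
        simpa using (hasDerivAt_pow 2 W).sub_const 1
      exact this.ofReal_comp
    have d2 := (d1.mul (t2.hasDerivAt hW)).add
      ((hasDerivAt_id W).ofReal_comp.mul (t1.hasDerivAt hW))
    rw [e.deriv_eq]
    refine d2.deriv.trans ?_
    push_cast
    simp only [id, hG₂, hG₃]
    ring
  have hW (v : ℝ) : 1 < w + v ^ 2 / 2 := by
    have := sq_nonneg v
    linarith
  -- With $W=w+v^2/2$, the Laplacian in $W$ under the integral and the Laplacian in $w$ outside
  -- differ through $W^2-w^2=v(wv+v^3/4)$. The discrepancy of the integrands, including the shift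
  -- $-1/4$, is the total derivative of this compactly supported $Q$.
  set Q : ℝ → ℂ := fun v => ((w * v + v ^ 3 / 4 : ℝ) : ℂ) * G₂ (w + v ^ 2 / 2) +
    ((3 / 4 * v : ℝ) : ℂ) * G₁ (w + v ^ 2 / 2)
  set q : ℝ → ℂ := fun v => deriv (deriv (deriv g) ∘ Real.arcosh) (w + v ^ 2 / 2) -
    1 / 4 * G₁ (w + v ^ 2 / 2) - ((w ^ 2 - 1) * G₃ (w + v ^ 2 / 2) + 2 * w * G₂ (w + v ^ 2 / 2))
  have hQ (v : ℝ) : HasDerivAt Q (q v) v := by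
    have dW : HasDerivAt (fun v : ℝ => w + v ^ 2 / 2) v v := by
      have := ((hasDerivAt_pow 2 v).div_const 2).const_add w
      exact this.congr_deriv (by norm_num)
    have d1 : HasDerivAt (fun v : ℝ => w * v + v ^ 3 / 4) (w + 3 / 4 * v ^ 2) v := by
      have := ((hasDerivAt_id v).const_mul w).add ((hasDerivAt_pow 3 v).div_const 4)
      exact this.congr_deriv (by norm_num; ring)
    have d2 : HasDerivAt (fun v : ℝ => 3 / 4 * v) (3 / 4) v := by
      simpa using (hasDerivAt_id v).const_mul (3 / 4 : ℝ)
    have d3 := (t2.hasDerivAt (hW v)).scomp v dW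
    have d4 := (t1.hasDerivAt (hW v)).scomp v dW
    refine ((d1.ofReal_comp.mul d3).add (d2.ofReal_comp.mul d4)).congr_deriv ?_
    simp only [q, hode (hW v), Complex.real_smul, Function.comp_apply]
    push_cast
    ring
  have i1 := t1.integrable hw
  have i2 := t2.integrable hw
  have i3 := t3.integrable hw
  have ig := tg.integrable hw
  have hz {F : ℝ → ℂ} (hF : IsTail F) (v : ℝ) (hv : 2 ≤ |v|) : F (w + v ^ 2 / 2) = 0 :=
    eq_zero_of_two_lt_abs hF.eq_zero hw.le hv
  have hQi : Integrable Q := by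
    refine Continuous.integrable_of_hasCompactSupport
      (continuous_iff_continuousAt.2 fun v => (hQ v).continuousAt) ?_
    refine HasCompactSupport.of_support_subset_isCompact (isCompact_Icc (a := -2) (b := 2)) ?_
    intro v hv
    rw [Set.mem_Icc, ← abs_le]
    by_contra hn
    rw [not_le] at hn
    exact hv (by simp only [Q, hz t1 v hn.le, hz t2 v hn.le]; simp)
  have ia : Integrable fun v => deriv (deriv (deriv g) ∘ Real.arcosh) (w + v ^ 2 / 2) -
      1 / 4 * G₁ (w + v ^ 2 / 2) := ig.sub (i1.const_mul _)
  have ib : Integrable fun v => ((w : ℂ) ^ 2 - 1) * G₃ (w + v ^ 2 / 2) +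
      2 * w * G₂ (w + v ^ 2 / 2) := (i3.const_mul _).add (i2.const_mul _)
  have hqi : Integrable q := ia.sub ib
  have key : ∫ v, q v = 0 := integral_eq_zero_of_hasDerivAt_of_integrable hQ hqi hQi
  simp only [q] at key
  rw [integral_sub ia ib, integral_sub ig (i1.const_mul _), integral_add (i3.const_mul _) (i2.const_mul _),
    integral_const_mul, integral_const_mul, integral_const_mul] at key
  simp only [invAbel, invAbel', invAbel'', abel]
  linear_combination (1 / (2 * Real.pi) : ℂ) * key

/-- Applied twice, the transform integrates a radial function over the plane. Polar coordinates and
the substitution $x=w+r^2/2$ finish the computation. -/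
lemma abel_abel {F : ℝ → ℂ} (hc : Continuous F) (hF : ∀ w, Real.cosh 1 < w → F w = 0) {w : ℝ}
    (hw : 1 ≤ w) : abel (abel F) w = 2 * Real.pi * ∫ x in Set.Ioi w, F x := by
  set f : ℝ × ℝ → ℂ := fun p => F (w + p.1 ^ 2 / 2 + p.2 ^ 2 / 2) with hf
  have hfc : Continuous f := by fun_prop
  have hfs : HasCompactSupport f := by
    refine HasCompactSupport.of_support_subset_isCompact
      ((isCompact_Icc (a := (-2 : ℝ)) (b := 2)).prod (isCompact_Icc (a := (-2 : ℝ)) (b := 2))) ?_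
    intro p hp
    have h1 : |p.1| < 2 := by
      by_contra hn
      rw [not_lt] at hn
      apply hp
      have := eq_zero_of_two_lt_abs hF (w := w + p.2 ^ 2 / 2) (by linarith [sq_nonneg p.2]) hn
      rw [hf]
      simp only
      rw [← this]
      ring_nf
    have h2 : |p.2| < 2 := by
      by_contra hn
      rw [not_lt] at hn
      apply hp
      exact eq_zero_of_two_lt_abs hF (w := w + p.1 ^ 2 / 2) (by linarith [sq_nonneg p.1]) hn
    rw [abs_lt] at h1 h2
    exact ⟨⟨h1.1.le, h1.2.le⟩, ⟨h2.1.le, h2.2.le⟩⟩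
  have h1 : abel (abel F) w = ∫ p, f p := by
    rw [Measure.volume_eq_prod, integral_prod _
      (by rw [← Measure.volume_eq_prod]; exact hfc.integrable_of_hasCompactSupport hfs)]
    rfl
  have h2 (p : ℝ × ℝ) : p.1 • f (polarCoord.symm p) = (p.1 * F (w + p.1 ^ 2 / 2)) * 1 := by
    rw [polarCoord_symm_apply, Complex.real_smul, mul_one]
    simp only [hf]
    congr 2
    have := Real.sin_sq_add_cos_sq p.2
    linear_combination (p.1 ^ 2 / 2) * this
  have h3 := integral_image_eq_integral_abs_deriv_smul (s := Set.Ioi (0 : ℝ))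
    (f := fun r => w + r ^ 2 / 2) (f' := fun r => r) measurableSet_Ioi
    (fun r _ => by
      have := ((hasDerivAt_pow 2 r).div_const 2).const_add w
      exact (this.congr_deriv (by norm_num)).hasDerivWithinAt)
    (fun a ha b hb hab => by
      have h : a ^ 2 = b ^ 2 := by simp only at hab; linarith
      exact (pow_left_inj₀ (le_of_lt ha) (le_of_lt hb) two_ne_zero).1 h) F
  have himg : (fun r => w + r ^ 2 / 2) '' Set.Ioi (0 : ℝ) = Set.Ioi w := by
    ext x
    simp only [Set.mem_image, Set.mem_Ioi]
    constructor
    · rintro ⟨r, hr, rfl⟩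
      have : 0 < r ^ 2 := by positivity
      linarith
    · intro hx
      refine ⟨√(2 * (x - w)), Real.sqrt_pos.2 (by linarith), ?_⟩
      rw [Real.sq_sqrt (by linarith)]
      ring
  rw [himg] at h3
  rw [h1, ← integral_comp_polarCoord_symm, h3]
  simp only [h2]
  rw [polarCoord_target, Measure.volume_eq_prod,
    setIntegral_prod_mul (fun r : ℝ => (r : ℂ) * F (w + r ^ 2 / 2)) (fun _ => (1 : ℂ)),
    setIntegral_const, mul_comm]
  congr 1
  · simp [Measure.real, Real.volume_Ioo]
    rw [ENNReal.toReal_ofReal (by linarith [Real.pi_pos])]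
    push_cast
    ring
  · refine setIntegral_congr_fun measurableSet_Ioi fun r hr => ?_
    simp only [abs_of_pos (show 0 < r from hr), Complex.real_smul]

/-- Differentiating $\mathcal A\mathcal A F(w)=2\pi\int_w^\infty F$ isolates $F$; on the other side
the derivative passes under the outer Abel integral. -/
lemma eq_invAbel {F g : ℝ → ℂ} (hc : Continuous F) (hF : ∀ w, Real.cosh 1 < w → F w = 0)
    (hg : IsProfile g) (h : ∀ u, abel F (Real.cosh u) = g u) {w : ℝ} (hw : 1 < w) :
    F w = invAbel g w := by
  have hG (W : ℝ) (hW : 1 ≤ W) : abel F W = (g ∘ Real.arcosh) W := by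
    rw [Function.comp_apply, ← h, Real.cosh_arcosh hW]
  have h1 {w : ℝ} (hw : 1 ≤ w) :
      abel (g ∘ Real.arcosh) w = 2 * Real.pi * ∫ x in Set.Ioi w, F x := by
    rw [← abel_abel hc hF hw]
    refine integral_congr_ae (Filter.Eventually.of_forall fun v => ?_)
    exact (hG _ (by linarith [sq_nonneg v])).symm
  have hint : IntegrableOn F (Set.Ioi 0) := by
    have : IntegrableOn F (Set.Icc 0 (Real.cosh 1)) := hc.continuousOn.integrableOn_Icc
    refine this.of_forall_sdiff_eq_zero measurableSet_Ioi ?_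
    rintro x ⟨hx, hx'⟩
    apply hF
    by_contra hn
    exact hx' ⟨le_of_lt hx, not_lt.1 hn⟩
  have h2 : (fun w => abel (g ∘ Real.arcosh) w) =ᶠ[nhds w]
      fun w => 2 * Real.pi * ((∫ x in Set.Ioi 0, F x) - ∫ x in (0 : ℝ)..w, F x) := by
    refine Filter.eventually_of_mem (isOpen_Ioi.mem_nhds hw) fun v hv => ?_
    have hv1 : 1 < v := hv
    have := intervalIntegral.integral_interval_add_Ioi hint
      (hint.mono_set (Set.Ioi_subset_Ioi (by linarith : (0 : ℝ) ≤ v)))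
    simp only
    rw [h1 hv1.le, ← this]
    ring
  have d1 := hg.isTail.hasDerivAt_abel hw
  have d2 : HasDerivAt (fun w => 2 * Real.pi * ((∫ x in Set.Ioi 0, F x) - ∫ x in (0 : ℝ)..w, F x))
      (2 * Real.pi * (0 - F w)) w := by
    refine HasDerivAt.const_mul _ ((hasDerivAt_const _ _).sub ?_)
    exact intervalIntegral.integral_hasDerivAt_right (hc.intervalIntegrable _ _)
      (hc.stronglyMeasurableAtFilter _ _) hc.continuousAt
  have d3 := (d1.congr_of_eventuallyEq h2.symm).unique d2
  rw [invAbel, d3]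
  have hpi : (Real.pi : ℂ) ≠ 0 := by exact_mod_cast Real.pi_ne_zero
  field_simp
  ring

lemma isProfile_abelIter {h : 𝓢(ℝ, ℝ)} (hh : IsAdmissible h) {t : ℝ} (ht : 1 ≤ t) {k : ℍ → ℂ}
    (hk : IsSpectralKernel h t k) (j : ℕ) : IsProfile (abelIter h t j) where
  contDiff := contDiff_abelIter hh.even ht j
  even := abelIter_neg t j
  eq_zero := abelIter_eq_zero hh.even ht (fun u hu => by
    rw [← abel_radialProfile hh ht hk]
    refine abel_eq_zero (fun w hw => radialProfile_eq_zero hk.support hw) ?_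
    rw [Real.cosh_lt_cosh]
    simpa using hu) j

/-- The iterates of the shifted radial Laplacian applied to the kernel `k_t`. -/
def kernelIter (h : 𝓢(ℝ, ℝ)) (t : ℝ) (j : ℕ) : ℝ → ℂ := invAbel (abelIter h t j)

lemma radialProfile_eq_kernelIter {h : 𝓢(ℝ, ℝ)} (hh : IsAdmissible h) {t : ℝ} (ht : 1 ≤ t)
    {k : ℍ → ℂ} (hk : IsSpectralKernel h t k) {w : ℝ} (hw : 1 < w) :
    radialProfile k w = kernelIter h t 0 w :=
  eq_invAbel (continuous_radialProfile hk.continuous)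
    (fun _ hw => radialProfile_eq_zero hk.support hw) (isProfile_abelIter hh ht hk 0)
    (abel_radialProfile hh ht hk) hw


/-! ### Pointwise size of the kernel, Schur's test and part (a). -/

/-- The free parameter $v_0$ splits the integral of $G'(w+v^2/2)$. For $v\le v_0$ the bound on $g'$
is used. For $v\ge v_0$ the integrand is $v^{-1}\,\frac{d}{dv}G(w+v^2/2)$, and integration by parts
trades the derivative for $1/v_0$. -/
lemma IsProfile.norm_invAbel_le_add {g : ℝ → ℂ} (hg : IsProfile g) {M₀ M₁ : ℝ}
    (hM₀ : ∀ u, ‖g u‖ ≤ M₀) (hM₁ : ∀ u, ‖deriv g u‖ ≤ M₁) {w v₀ : ℝ} (hw : 1 < w)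
    (hv₀ : 0 < v₀) : ‖invAbel g w‖ ≤ v₀ * (M₁ / √(w - 1)) + 2 * M₀ / v₀ := by
  set H := deriv (g ∘ Real.arcosh) with hH
  have tG := hg.isTail
  have tH : IsTail H := tG.deriv
  -- An endpoint beyond the support of the integrand and never to the left of $v_0$.
  set V := max 2 v₀
  have hV : v₀ ≤ V := le_max_right _ _
  have hV0 : 0 < V := hv₀.trans_le hV
  have hc := tH.continuous_comp hw
  have hW (v : ℝ) : 1 < w + v ^ 2 / 2 := by
    have := sq_nonneg v
    linarith
  have hM₀' : 0 ≤ M₀ := (norm_nonneg _).trans (hM₀ 0)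
  have hM₁' : 0 ≤ M₁ := (norm_nonneg _).trans (hM₁ 0)
  have e1 : abel H w = 2 * ∫ v in (0 : ℝ)..V, H (w + v ^ 2 / 2) := by
    have hi := tH.integrable hw
    have h1 : ∫ v, H (w + v ^ 2 / 2) = 2 * ∫ v in Set.Ioi (0 : ℝ), H (w + v ^ 2 / 2) := by
      have h3 := intervalIntegral.integral_Iic_add_Ioi (b := 0) hi.integrableOn hi.integrableOn
      have h4 := integral_comp_neg_Ioi (0 : ℝ) fun v : ℝ => H (w + v ^ 2 / 2)
      simp only [neg_sq, neg_zero] at h4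
      rw [← h3, ← h4]
      ring
    have h2 : ∫ v in Set.Ioi (0 : ℝ), H (w + v ^ 2 / 2) = ∫ v in Set.Ioc 0 V, H (w + v ^ 2 / 2) := by
      refine (setIntegral_eq_of_subset_of_forall_sdiff_eq_zero measurableSet_Ioi
        (fun x hx => hx.1) ?_)
      rintro v ⟨hv, hv'⟩
      refine eq_zero_of_two_lt_abs tH.eq_zero hw.le ?_
      rw [abs_of_pos hv]
      by_contra hn
      exact hv' ⟨hv, (not_le.1 hn).le.trans (le_max_left _ _)⟩
    rw [abel, h1, h2, intervalIntegral.integral_of_le hV0.le]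
  have e2 : ‖∫ v in (0 : ℝ)..v₀, H (w + v ^ 2 / 2)‖ ≤ v₀ * (M₁ / √(w - 1)) := by
    have := intervalIntegral.norm_integral_le_of_norm_le_const (a := 0) (b := v₀)
      (f := fun v : ℝ => H (w + v ^ 2 / 2)) (C := M₁ / √(w - 1)) (fun v _ => by
        refine (hg.norm_deriv_tail_le' hM₁ (hW v)).trans ?_
        have : 0 < √(w - 1) := Real.sqrt_pos.2 (by linarith)
        gcongr
        linarith [sq_nonneg v])
    rwa [sub_zero, abs_of_pos hv₀, mul_comm] at this
  set U : ℝ → ℂ := fun v => (g ∘ Real.arcosh) (w + v ^ 2 / 2)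
  have hU (v : ℝ) : HasDerivAt U (v * H (w + v ^ 2 / 2)) v := by
    have dW : HasDerivAt (fun v : ℝ => w + v ^ 2 / 2) v v := by
      have := ((hasDerivAt_pow 2 v).div_const 2).const_add w
      exact this.congr_deriv (by norm_num)
    have := (tG.hasDerivAt (hW v)).scomp v dW
    exact this.congr_deriv (by rw [Complex.real_smul])
  have hUb (v : ℝ) : ‖U v‖ ≤ M₀ := hM₀ _
  have hpos {v : ℝ} (hv : v ∈ Set.uIcc v₀ V) : 0 < v := by
    rw [Set.uIcc_of_le hV] at hv
    exact hv₀.trans_le hv.1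
  have hinv {v : ℝ} (hv : v ∈ Set.uIcc v₀ V) :
      HasDerivAt (fun v : ℝ => ((v⁻¹ : ℝ) : ℂ)) ((-(v ^ 2)⁻¹ : ℝ) : ℂ) v :=
    (hasDerivAt_inv (hpos hv).ne').ofReal_comp
  have hci : ContinuousOn (fun v : ℝ => -(v ^ 2)⁻¹) (Set.uIcc v₀ V) :=
    ContinuousOn.neg (ContinuousOn.inv₀ (by fun_prop) fun v hv => pow_ne_zero 2 (hpos hv).ne')
  have hci' : ContinuousOn (fun v : ℝ => M₀ * (v ^ 2)⁻¹) (Set.uIcc v₀ V) :=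
    continuousOn_const.mul (ContinuousOn.inv₀ (by fun_prop) fun v hv => pow_ne_zero 2 (hpos hv).ne')
  have hUc : Continuous U := continuous_iff_continuousAt.2 fun v => (hU v).continuousAt
  have e3 := intervalIntegral.integral_mul_deriv_eq_deriv_mul (a := v₀) (b := V)
    (u := fun v : ℝ => ((v⁻¹ : ℝ) : ℂ)) (v := U) (fun v hv => hinv hv) (fun v _ => hU v)
    ((Complex.continuous_ofReal.comp_continuousOn hci).intervalIntegrable)
    ((Complex.continuous_ofReal.mul hc).intervalIntegrable _ _)
  have e4 : ∫ v in v₀..V, H (w + v ^ 2 / 2) =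
      ∫ v in v₀..V, ((v⁻¹ : ℝ) : ℂ) * (v * H (w + v ^ 2 / 2)) := by
    refine intervalIntegral.integral_congr fun v hv => ?_
    have : (v : ℂ) ≠ 0 := by exact_mod_cast (hpos hv).ne'
    push_cast
    field_simp
  have e5 : ‖∫ v in v₀..V, ((-(v ^ 2)⁻¹ : ℝ) : ℂ) * U v‖ ≤ M₀ * (v₀⁻¹ - V⁻¹) := by
    have hi : ∫ v in v₀..V, M₀ * (v ^ 2)⁻¹ = M₀ * (v₀⁻¹ - V⁻¹) := by
      have := intervalIntegral.integral_eq_sub_of_hasDerivAt (a := v₀) (b := V)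
        (f := fun v : ℝ => M₀ * -v⁻¹) (f' := fun v => M₀ * (v ^ 2)⁻¹)
        (fun v hv => by
          have := (hasDerivAt_inv (hpos hv).ne').neg.const_mul M₀
          exact this.congr_deriv (by rw [neg_neg]))
        hci'.intervalIntegrable
      rw [this]
      ring
    rw [← hi]
    refine intervalIntegral.norm_integral_le_of_norm_le hV
      (Filter.Eventually.of_forall fun v hv => ?_) hci'.intervalIntegrable
    rw [norm_mul, Complex.norm_real, norm_neg, Real.norm_of_nonneg (by positivity), mul_comm]
    gcongr
    exact hUb v
  have e6 : ‖∫ v in v₀..V, H (w + v ^ 2 / 2)‖ ≤ 2 * M₀ / v₀ := by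
    rw [e4, e3]
    have n1 : ‖((V⁻¹ : ℝ) : ℂ) * U V‖ ≤ V⁻¹ * M₀ := by
      rw [norm_mul, Complex.norm_real, Real.norm_of_nonneg (by positivity)]
      gcongr
      exact hUb V
    have n2 : ‖((v₀⁻¹ : ℝ) : ℂ) * U v₀‖ ≤ v₀⁻¹ * M₀ := by
      rw [norm_mul, Complex.norm_real, Real.norm_of_nonneg (by positivity)]
      gcongr
      exact hUb v₀
    calc _ ≤ V⁻¹ * M₀ + v₀⁻¹ * M₀ + M₀ * (v₀⁻¹ - V⁻¹) :=
          (norm_sub_le _ _).trans (add_le_add ((norm_sub_le _ _).trans (add_le_add n1 n2)) e5)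
      _ = _ := by rw [div_eq_mul_inv]; ring
  have hsplit := intervalIntegral.integral_add_adjacent_intervals
    (hc.intervalIntegrable (μ := volume) 0 v₀) (hc.intervalIntegrable (μ := volume) v₀ V)
  have hpi := Real.pi_gt_three
  rw [invAbel, norm_mul, norm_inv_two_pi, e1, ← hsplit, norm_mul]
  have := (norm_add_le _ _).trans (add_le_add e2 e6)
  have h2 : ‖(2 : ℂ)‖ = 2 := by norm_num
  rw [h2, div_mul_eq_mul_div, one_mul, div_le_iff₀ (by positivity)]
  have hnn : 0 ≤ v₀ * (M₁ / √(w - 1)) + 2 * M₀ / v₀ := by positivity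
  nlinarith

lemma exists_norm_kernelIter_zero_le (h : 𝓢(ℝ, ℝ)) (hh : IsAdmissible h) :
    ∃ C, 0 < C ∧ ∀ t : ℝ, 1 ≤ t → ∀ k, IsSpectralKernel h t k → ∀ w, 1 < w →
      ‖kernelIter h t 0 w‖ ≤ C * √t / √√(w - 1) := by
  obtain ⟨C₀, hC₀, h₀⟩ := norm_deriv_abelIter_le hh.even 0 0
  obtain ⟨C₁, hC₁, h₁⟩ := norm_deriv_abelIter_le hh.even 0 1
  refine ⟨C₁ + 2 * C₀, by positivity, fun t ht k hk w hw => ?_⟩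
  have ha : 0 < √t := Real.sqrt_pos.2 (by linarith)
  have hb : 0 < √√(w - 1) := Real.sqrt_pos.2 (Real.sqrt_pos.2 (by linarith))
  have := (isProfile_abelIter hh ht hk 0).norm_invAbel_le_add (M₀ := C₀) (M₁ := C₁ * t)
    (fun u => by simpa using h₀ t ht u) (fun u => by simpa using h₁ t ht u) hw
    -- The splitting point is $v_0=(w-1)^{1/4}t^{-1/2}$, which balances $v_0\,t\,(w-1)^{-1/2}$
    -- against $1/v_0$.
    (div_pos hb ha)
  refine this.trans_eq ?_
  have e1 : t = √t * √t := (Real.mul_self_sqrt (by linarith)).symm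
  have e2 : √(w - 1) = √√(w - 1) * √√(w - 1) := (Real.mul_self_sqrt (Real.sqrt_nonneg _)).symm
  set a := √t
  set b := √√(w - 1)
  rw [e2, e1]
  field_simp

lemma one_add_sq_div_two_le_cosh (y : ℝ) : 1 + y ^ 2 / 2 ≤ Real.cosh y := by
  have h1 := Real.cosh_two_mul (y / 2)
  have h2 := Real.cosh_sq (y / 2)
  rw [mul_div_cancel₀ y two_ne_zero] at h1
  have h3 : (y / 2) ^ 2 ≤ Real.sinh (y / 2) ^ 2 := by
    rcases le_total 0 (y / 2) with hy | hy
    · have := Real.self_le_sinh_iff.2 hy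
      gcongr
    · have := Real.self_le_sinh_iff.2 (neg_nonneg.2 hy)
      rw [Real.sinh_neg] at this
      nlinarith
  nlinarith

/-- Completing to a hyperbolic cosine, $me^x+ne^{-x}=2\sqrt{mn}\cosh(x-c)$ with $2\sqrt{mn}\ge1$,
and $\cosh y\ge1+y^2/2$. -/
lemma exists_center {m n : ℝ} (hm : 0 ≤ m) (hn : 0 ≤ n) (hmn : 1 ≤ 4 * (m * n)) :
    ∃ c, ∀ x, (x - c) ^ 2 / 2 ≤ m * Real.exp x + n * Real.exp (-x) - 1 := by
  have hm' : 0 < m := by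
    rcases hm.eq_or_lt with h | h
    · rw [← h] at hmn; norm_num at hmn
    · exact h
  have hn' : 0 < n := by
    rcases hn.eq_or_lt with h | h
    · rw [← h] at hmn; norm_num at hmn
    · exact h
  refine ⟨(Real.log n - Real.log m) / 2, fun x => ?_⟩
  set c := (Real.log n - Real.log m) / 2
  set L := (Real.log n + Real.log m) / 2
  have e1 : m * Real.exp x = Real.exp L * Real.exp (x - c) := by
    rw [← Real.exp_add]
    nth_rewrite 1 [← Real.exp_log hm']
    rw [← Real.exp_add]
    congr 1
    simp only [L, c]
    ring
  have e2 : n * Real.exp (-x) = Real.exp L * Real.exp (-(x - c)) := by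
    rw [← Real.exp_add]
    nth_rewrite 1 [← Real.exp_log hn']
    rw [← Real.exp_add]
    congr 1
    simp only [L, c]
    ring
  have e3 : Real.exp L ^ 2 = m * n := by
    rw [← Real.exp_nat_mul]
    simp only [L]
    push_cast
    rw [mul_div_cancel₀ _ two_ne_zero, Real.exp_add, Real.exp_log hm', Real.exp_log hn', mul_comm]
  have e4 : 1 ≤ 2 * Real.exp L := by
    have := Real.exp_pos L
    nlinarith
  have e5 := one_add_sq_div_two_le_cosh (x - c)
  rw [e1, e2, ← mul_add]
  have e6 : Real.exp (x - c) + Real.exp (-(x - c)) = 2 * Real.cosh (x - c) := by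
    rw [Real.cosh_eq]; ring
  rw [e6]
  have := Real.cosh_pos (x - c)
  nlinarith

/-- Distance from a fixed point to a moving point of a geodesic grows at least like the distance
along the geodesic from a centre $c$. Here $4mn-1$ is the square
$(g_{00}g_{01}e^{-x_1}+g_{10}g_{11}e^{x_1})^2$, by the determinant condition. -/
lemma exists_center_snd (g : SL(2, ℝ)) (x₁ : ℝ) :
    ∃ c, ∀ x₂, (x₂ - c) ^ 2 / 2 ≤ coshDist g (x₁, x₂) - 1 := by
  have hd := det_eq g
  have h1 : Real.exp x₁ * Real.exp (-x₁) = 1 := by rw [← Real.exp_add]; simp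
  obtain ⟨c, hc⟩ := exists_center
    (m := (g 0 0 ^ 2 * Real.exp (-x₁) + g 1 0 ^ 2 * Real.exp x₁) / 2)
    (n := (g 1 1 ^ 2 * Real.exp x₁ + g 0 1 ^ 2 * Real.exp (-x₁)) / 2)
    (by positivity) (by positivity) (by
      set E := Real.exp x₁
      set E' := Real.exp (-x₁)
      have e2 : (g 0 0 * g 1 1 - g 0 1 * g 1 0) ^ 2 = 1 := by rw [hd]; norm_num
      have e3 := sq_nonneg (g 0 0 * g 0 1 * E' + g 1 0 * g 1 1 * E)
      have e4 : (E * E') ^ 2 = 1 := by rw [h1]; norm_num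
      linear_combination e3 - e2 - (g 0 0 ^ 2 * g 1 1 ^ 2 + g 1 0 ^ 2 * g 0 1 ^ 2 +
        (-2) * g 0 0 * g 0 1 * g 1 0 * g 1 1) * h1)
  refine ⟨c, fun x₂ => (hc x₂).trans_eq ?_⟩
  simp only [coshDist]
  rw [neg_sub, sub_eq_add_neg x₂, sub_eq_add_neg x₁, neg_add, Real.exp_add, Real.exp_add,
    Real.exp_add, Real.exp_add]
  ring

lemma exists_center_fst (g : SL(2, ℝ)) (x₂ : ℝ) :
    ∃ c, ∀ x₁, (x₁ - c) ^ 2 / 2 ≤ coshDist g (x₁, x₂) - 1 := by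
  obtain ⟨c, hc⟩ := exists_center_snd g⁻¹ x₂
  refine ⟨c, fun x₁ => (hc x₁).trans_eq ?_⟩
  have h1 := cosh_dist_geod 1 g x₁ x₂
  have h2 := cosh_dist_geod g 1 x₂ x₁
  rw [inv_one, one_mul] at h1
  rw [mul_one, dist_comm] at h2
  rw [← h1, ← h2]


lemma exists_lintegral_inv_sqrt_le :
    ∃ S : ENNReal, S ≠ ⊤ ∧ ∀ c : ℝ,
      ∫⁻ x in Set.Icc (0 : ℝ) 1, ENNReal.ofReal (1 / √|x - c|) ≤ S := by
  set f : ℝ → ENNReal := fun y => (Set.Icc (-1 : ℝ) 1).indicator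
    (fun y => ENNReal.ofReal (1 / √|y|)) y
  have hfm : Measurable f := Measurable.indicator (by fun_prop) measurableSet_Icc
  have hf : ∫⁻ y, f y ≠ ⊤ := by
    rw [lintegral_indicator measurableSet_Icc]
    have h1 : IntervalIntegrable (fun x : ℝ => 1 / √|x|) volume 0 1 := by
      refine (intervalIntegral.intervalIntegrable_rpow' (r := -(1 / 2)) (by norm_num)).congr ?_
      rw [Set.uIoc_of_le zero_le_one]
      intro x hx
      simp only
      rw [abs_of_pos hx.1, Real.rpow_neg hx.1.le, ← Real.sqrt_eq_rpow, one_div]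
    have h2 : IntervalIntegrable (fun x : ℝ => 1 / √|x|) volume (-1) 0 := by
      have := (IntervalIntegrable.iff_comp_neg (by simp)).1 h1
      simp only [abs_neg, neg_zero] at this
      exact this.symm
    have h3 := h2.trans h1
    rw [intervalIntegrable_iff_integrableOn_Icc_of_le (by norm_num)] at h3
    have h4 := h3.hasFiniteIntegral
    rw [hasFiniteIntegral_iff_ofReal (Filter.Eventually.of_forall fun x => by positivity)] at h4
    exact h4.ne
  refine ⟨(∫⁻ y, f y) + 1, ?_, fun c => ?_⟩
  · exact ENNReal.add_ne_top.2 ⟨hf, ENNReal.one_ne_top⟩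
  · have h1 (x : ℝ) : ENNReal.ofReal (1 / √|x - c|) ≤ f (x - c) + 1 := by
      by_cases hx : x - c ∈ Set.Icc (-1 : ℝ) 1
      · simp only [f, Set.indicator_of_mem hx]
        exact le_self_add
      · refine le_add_left (ENNReal.ofReal_le_one.2 ?_)
        rw [Set.mem_Icc, ← abs_le, not_le] at hx
        rw [div_le_one (by positivity)]
        exact Real.one_le_sqrt.2 hx.le
    calc ∫⁻ x in Set.Icc (0 : ℝ) 1, ENNReal.ofReal (1 / √|x - c|)
        ≤ ∫⁻ x in Set.Icc (0 : ℝ) 1, (f (x - c) + 1) := lintegral_mono h1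
      _ = (∫⁻ x in Set.Icc (0 : ℝ) 1, f (x - c)) + 1 := by
          rw [lintegral_add_right _ measurable_const]
          simp
      _ ≤ (∫⁻ x, f (x - c)) + 1 := by gcongr; exact Measure.restrict_le_self
      _ = _ := by rw [lintegral_sub_right_eq_self]

/-- Apply $2ab\le a^2+b^2$ pointwise, then the row and column bounds to the two squares. -/
lemma schur_test {φ : ℝ → ENNReal} (hφ : Measurable φ) {W : ℝ → ℝ → ENNReal}
    (hW : Measurable (Function.uncurry W)) {μ : Measure ℝ} [SFinite μ] {S : ENNReal}
    (h₁ : ∀ x, ∫⁻ y, W x y ∂μ ≤ S) (h₂ : ∀ y, ∫⁻ x, W x y ∂μ ≤ S) :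
    ∫⁻ x, ∫⁻ y, φ x * φ y * W x y ∂μ ∂μ ≤ S * ∫⁻ x, φ x ^ 2 ∂μ := by
  have hle (a b : ENNReal) : 2 * (a * b) ≤ a ^ 2 + b ^ 2 := by
    rcases le_total a b with h | h
    · obtain ⟨c, rfl⟩ := exists_add_of_le h
      calc 2 * (a * (a + c)) ≤ 2 * (a * (a + c)) + c ^ 2 := le_self_add
        _ = _ := by ring
    · obtain ⟨c, rfl⟩ := exists_add_of_le h
      calc 2 * ((b + c) * b) ≤ 2 * ((b + c) * b) + c ^ 2 := le_self_add
        _ = _ := by ring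
  have hm1 : Measurable fun p : ℝ × ℝ => φ p.1 ^ 2 * W p.1 p.2 :=
    ((hφ.comp measurable_fst).pow_const 2).mul hW
  have hm2 : Measurable fun p : ℝ × ℝ => φ p.2 ^ 2 * W p.1 p.2 :=
    ((hφ.comp measurable_snd).pow_const 2).mul hW
  have hWl (x : ℝ) : Measurable fun y => W x y := hW.comp measurable_prodMk_left
  have hWr (y : ℝ) : Measurable fun x => W x y := hW.comp measurable_prodMk_right
  have e1 : ∫⁻ x, ∫⁻ y, φ x ^ 2 * W x y ∂μ ∂μ ≤ S * ∫⁻ x, φ x ^ 2 ∂μ := by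
    rw [mul_comm, ← lintegral_mul_const _ (hφ.pow_const 2)]
    refine lintegral_mono fun x => ?_
    rw [lintegral_const_mul _ (hWl x)]
    gcongr
    exact h₁ x
  have e2 : ∫⁻ x, ∫⁻ y, φ y ^ 2 * W x y ∂μ ∂μ ≤ S * ∫⁻ x, φ x ^ 2 ∂μ := by
    rw [lintegral_lintegral_swap hm2.aemeasurable, mul_comm,
      ← lintegral_mul_const _ (hφ.pow_const 2)]
    refine lintegral_mono fun y => ?_
    rw [lintegral_const_mul _ (hWr y)]
    gcongr
    exact h₂ y
  have e3 : 2 * ∫⁻ x, ∫⁻ y, φ x * φ y * W x y ∂μ ∂μ ≤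
      ∫⁻ x, ∫⁻ y, φ x ^ 2 * W x y ∂μ ∂μ + ∫⁻ x, ∫⁻ y, φ y ^ 2 * W x y ∂μ ∂μ := by
    rw [← lintegral_add_left hm1.lintegral_prod_right', ← lintegral_const_mul']
    · refine lintegral_mono fun x => ?_
      simp only
      rw [← lintegral_add_left ((hWl x).const_mul _),
        ← lintegral_const_mul' _ _ (by norm_num)]
      refine lintegral_mono fun y => ?_
      simp only
      rw [← mul_assoc, ← add_mul]
      gcongr
      exact hle _ _
    · norm_num
  have e4 := e3.trans (add_le_add e1 e2)
  rw [← two_mul] at e4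
  exact (ENNReal.mul_le_mul_iff_right (by norm_num) (by norm_num)).1 e4

lemma lintegral_enorm_sq (φ : Lp ℂ 2 (volume : Measure ℝ)) (hφ : ‖φ‖ = 1) :
    ∫⁻ x, ‖φ x‖ₑ ^ 2 = 1 := by
  have h1 : eLpNorm φ 2 volume = 1 := by
    rw [Lp.norm_def] at hφ
    rw [← ENNReal.ofReal_toReal (Lp.eLpNorm_ne_top φ), hφ, ENNReal.ofReal_one]
  rw [eLpNorm_eq_lintegral_rpow_enorm_toReal two_ne_zero ENNReal.ofNat_ne_top] at h1
  simp only [ENNReal.toReal_ofNat, ENNReal.rpow_ofNat] at h1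
  have h2 := congrArg (fun x : ENNReal => x ^ (2 : ℝ)) h1
  rw [← ENNReal.rpow_mul] at h2
  norm_num at h2
  exact_mod_cast h2

lemma continuous_coshDist (g : SL(2, ℝ)) : Continuous (coshDist g) := by
  unfold coshDist
  fun_prop

lemma norm_kernel_le_of_center {h : 𝓢(ℝ, ℝ)} (hh : IsAdmissible h) {C t : ℝ} (ht : 1 ≤ t)
    {k : ℍ → ℂ} (hk : IsSpectralKernel h t k) (hC : 0 < C)
    (hCk : ∀ w, 1 < w → ‖kernelIter h t 0 w‖ ≤ C * √t / √√(w - 1)) {x c w : ℝ}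
    (hx : x ≠ c) (hw : (x - c) ^ 2 / 2 ≤ w - 1) :
    ‖radialProfile k w‖ ≤ 2 * C * √t * (1 / √|x - c|) := by
  have h0 : 0 < |x - c| := abs_pos.2 (sub_ne_zero.2 hx)
  have hw1 : 1 < w := by
    have : 0 < (x - c) ^ 2 := by rw [← sq_abs]; positivity
    linarith
  rw [radialProfile_eq_kernelIter hh ht hk hw1]
  refine (hCk w hw1).trans ?_
  have h1 : |x - c| / 2 ≤ √(w - 1) := by
    apply Real.le_sqrt_of_sq_le
    rw [div_pow, sq_abs]
    nlinarith [sq_nonneg (x - c)]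
  have h2 : √|x - c| / 2 ≤ √√(w - 1) := by
    apply Real.le_sqrt_of_sq_le
    rw [div_pow, Real.sq_sqrt h0.le]
    linarith
  have h3 : 0 < √|x - c| := Real.sqrt_pos.2 h0
  calc C * √t / √√(w - 1) ≤ C * √t / (√|x - c| / 2) := by gcongr
    _ = _ := by field_simp

/-- Along either variable the kernel is $O(t^{1/2}|x-c|^{-1/2})$, and $|x-c|^{-1/2}$ is integrable
over $[0,1]$ uniformly in the centre $c$. This is the input for Schur's test. -/
lemma exists_lintegral_kernel_le {h : 𝓢(ℝ, ℝ)} (hh : IsAdmissible h) :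
    ∃ S : ENNReal, S ≠ ⊤ ∧ ∀ t : ℝ, 1 ≤ t → ∀ k, IsSpectralKernel h t k → ∀ g : SL(2, ℝ),
      (∀ x₁, ∫⁻ x₂ in Set.Icc (0 : ℝ) 1, ‖radialProfile k (coshDist g (x₁, x₂))‖ₑ ≤
        S * ENNReal.ofReal √t) ∧
      (∀ x₂, ∫⁻ x₁ in Set.Icc (0 : ℝ) 1, ‖radialProfile k (coshDist g (x₁, x₂))‖ₑ ≤
        S * ENNReal.ofReal √t) := by
  obtain ⟨C, hC, hb⟩ := exists_norm_kernelIter_zero_le h hh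
  obtain ⟨S, hS, hSb⟩ := exists_lintegral_inv_sqrt_le
  refine ⟨ENNReal.ofReal (2 * C) * S, ENNReal.mul_ne_top ENNReal.ofReal_ne_top hS,
    fun t ht k hk g => ?_⟩
  have key (F : ℝ → ℝ) (c : ℝ) (hF : ∀ x, (x - c) ^ 2 / 2 ≤ F x - 1) :
      ∫⁻ x in Set.Icc (0 : ℝ) 1, ‖radialProfile k (F x)‖ₑ ≤
        ENNReal.ofReal (2 * C) * S * ENNReal.ofReal √t := by
    calc ∫⁻ x in Set.Icc (0 : ℝ) 1, ‖radialProfile k (F x)‖ₑ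
        ≤ ∫⁻ x in Set.Icc (0 : ℝ) 1,
            ENNReal.ofReal (2 * C * √t) * ENNReal.ofReal (1 / √|x - c|) := by
          refine lintegral_mono_ae (ae_restrict_of_ae ?_)
          have : ∀ᵐ x : ℝ, x ≠ c := by simp [ae_iff, measure_singleton]
          filter_upwards [this] with x hx
          rw [← ENNReal.ofReal_mul (by positivity), ← ofReal_norm]
          exact ENNReal.ofReal_le_ofReal
            (norm_kernel_le_of_center hh ht hk hC (hb t ht k hk) hx (hF x))
      _ = ENNReal.ofReal (2 * C * √t) * ∫⁻ x in Set.Icc (0 : ℝ) 1,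
            ENNReal.ofReal (1 / √|x - c|) := lintegral_const_mul' _ _ ENNReal.ofReal_ne_top
      _ ≤ ENNReal.ofReal (2 * C * √t) * S := by gcongr; exact hSb c
      _ = _ := by rw [ENNReal.ofReal_mul (by positivity)]; ring
  constructor
  · intro x₁
    obtain ⟨c, hc⟩ := exists_center_snd g x₁
    exact key _ c hc
  · intro x₂
    obtain ⟨c, hc⟩ := exists_center_fst g x₂
    exact key _ c hc

lemma exists_norm_periodIntegral_le {h : 𝓢(ℝ, ℝ)} (hh : IsAdmissible h) {b : ℝ → ℂ}
    (hb : Continuous b) (hb_supp : tsupport b ⊆ Set.Icc (0 : ℝ) 1) :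
    ∃ C : ℝ, 0 < C ∧ ∀ (t : ℝ) (k : ℍ → ℂ) (φ : Lp ℂ 2 (volume : Measure ℝ)) (g₁ g₂ : SL(2, ℝ)),
      1 ≤ t → IsSpectralKernel h t k → ‖φ‖ = 1 →
        ‖periodIntegral b k φ g₁ g₂‖ ≤ C * t ^ (1 / 2 : ℝ) := by
  obtain ⟨S, hS, hSb⟩ := exists_lintegral_kernel_le hh
  obtain ⟨B, hB⟩ := (isCompact_Icc (a := (0 : ℝ)) (b := 1)).exists_bound_of_continuousOn
    hb.continuousOn
  have hb0 (x : ℝ) (hx : x ∉ Set.Icc (0 : ℝ) 1) : b x = 0 :=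
    image_eq_zero_of_notMem_tsupport fun h => hx (hb_supp h)
  have hB0 : 0 ≤ B := (norm_nonneg _).trans (hB 0 (by simp))
  set D : ENNReal := ENNReal.ofReal B ^ 2 * S
  have hD : D ≠ ⊤ := ENNReal.mul_ne_top (by simp) hS
  refine ⟨D.toReal + 1, by positivity, fun t k φ g₁ g₂ ht hk hφ => ?_⟩
  rw [← Real.sqrt_eq_rpow]
  set g := g₁⁻¹ * g₂
  set I := Set.Icc (0 : ℝ) 1
  set W : ℝ → ℝ → ENNReal := fun x₁ x₂ => ‖radialProfile k (coshDist g (x₁, x₂))‖ₑ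
  have hW : Measurable (Function.uncurry W) :=
    (((continuous_radialProfile hk.continuous).comp (continuous_coshDist g)).enorm).measurable
  have hφm : Measurable fun x => ‖φ x‖ₑ := (Lp.stronglyMeasurable φ).enorm
  have hpt (x₁ x₂ : ℝ) : ‖b x₁ * b x₂ * φ x₁ * (starRingEnd ℂ) (φ x₂) *
      pointPair k (geod g₁ x₁) (geod g₂ x₂)‖ₑ ≤
      I.indicator (fun x₁ => I.indicator
        (fun x₂ => ENNReal.ofReal B ^ 2 * (‖φ x₁‖ₑ * ‖φ x₂‖ₑ * W x₁ x₂)) x₂) x₁ := by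
    by_cases h1 : x₁ ∈ I
    · by_cases h2 : x₂ ∈ I
      · rw [Set.indicator_of_mem h1, Set.indicator_of_mem h2, pointPair_geod hk.invariant]
        simp only [enorm_mul, RCLike.enorm_conj]
        have n1 : ‖b x₁‖ₑ ≤ ENNReal.ofReal B := by
          rw [← ofReal_norm]; exact ENNReal.ofReal_le_ofReal (hB _ h1)
        have n2 : ‖b x₂‖ₑ ≤ ENNReal.ofReal B := by
          rw [← ofReal_norm]; exact ENNReal.ofReal_le_ofReal (hB _ h2)
        calc _ ≤ ENNReal.ofReal B * ENNReal.ofReal B * ‖φ x₁‖ₑ * ‖φ x₂‖ₑ * W x₁ x₂ := by gcongr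
          _ = _ := by ring
      · simp [hb0 x₂ h2]
    · simp [hb0 x₁ h1]
  have hmain : ‖periodIntegral b k φ g₁ g₂‖ₑ ≤ D * ENNReal.ofReal √t := by
    calc ‖periodIntegral b k φ g₁ g₂‖ₑ
        ≤ ∫⁻ x₁, ∫⁻ x₂, ‖b x₁ * b x₂ * φ x₁ * (starRingEnd ℂ) (φ x₂) *
            pointPair k (geod g₁ x₁) (geod g₂ x₂)‖ₑ :=
          (enorm_integral_le_lintegral_enorm _).trans
            (lintegral_mono fun x₁ => enorm_integral_le_lintegral_enorm _)
      _ ≤ ∫⁻ x₁, ∫⁻ x₂, I.indicator (fun x₁ => I.indicator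
            (fun x₂ => ENNReal.ofReal B ^ 2 * (‖φ x₁‖ₑ * ‖φ x₂‖ₑ * W x₁ x₂)) x₂) x₁ :=
          lintegral_mono fun x₁ => lintegral_mono fun x₂ => hpt x₁ x₂
      _ = ∫⁻ x₁ in I, ∫⁻ x₂ in I, ENNReal.ofReal B ^ 2 * (‖φ x₁‖ₑ * ‖φ x₂‖ₑ * W x₁ x₂) := by
          rw [← lintegral_indicator (s := I) measurableSet_Icc]
          refine lintegral_congr fun x₁ => ?_
          by_cases h1 : x₁ ∈ I
          · simp only [Set.indicator_of_mem h1]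
            rw [lintegral_indicator (s := I) measurableSet_Icc]
          · simp only [Set.indicator_of_notMem h1, lintegral_zero]
      _ = ENNReal.ofReal B ^ 2 * ∫⁻ x₁ in I, ∫⁻ x₂ in I, ‖φ x₁‖ₑ * ‖φ x₂‖ₑ * W x₁ x₂ := by
          rw [← lintegral_const_mul' _ _ (by simp)]
          refine lintegral_congr fun x₁ => ?_
          rw [lintegral_const_mul' _ _ (by simp)]
      _ ≤ ENNReal.ofReal B ^ 2 * (S * ENNReal.ofReal √t * ∫⁻ x₁ in I, ‖φ x₁‖ₑ ^ 2) := by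
          gcongr
          exact schur_test hφm hW (hSb t ht k hk g).1 (hSb t ht k hk g).2
      _ ≤ ENNReal.ofReal B ^ 2 * (S * ENNReal.ofReal √t * ∫⁻ x₁, ‖φ x₁‖ₑ ^ 2) := by
          gcongr
          exact Measure.restrict_le_self
      _ = _ := by rw [lintegral_enorm_sq φ hφ]; ring
  rw [← ofReal_norm] at hmain
  have := ENNReal.toReal_mono (ENNReal.mul_ne_top hD ENNReal.ofReal_ne_top) hmain
  rw [ENNReal.toReal_ofReal (norm_nonneg _), ENNReal.toReal_mul,
    ENNReal.toReal_ofReal (Real.sqrt_nonneg _)] at this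
  refine this.trans ?_
  gcongr
  linarith


/-! ### Amplitudes with derivatives bounded uniformly in the parameters. -/

/-- The closed unit square. -/
def unitSquare : Set (ℝ × ℝ) := Set.Icc (0 : ℝ) 1 ×ˢ Set.Icc (0 : ℝ) 1

lemma isCompact_unitSquare : IsCompact unitSquare := isCompact_Icc.prod isCompact_Icc

/-- The derivative of `f` in the direction `v`. -/
def dirDeriv {F : Type*} [NormedAddCommGroup F] [NormedSpace ℝ F] (v : ℝ × ℝ) (f : ℝ × ℝ → F)
    (x : ℝ × ℝ) : F :=
  fderiv ℝ f x v

lemma _root_.ContDiff.dirDeriv {F : Type*} [NormedAddCommGroup F] [NormedSpace ℝ F]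
    {f : ℝ × ℝ → F} (hf : ContDiff ℝ ∞ f) (v : ℝ × ℝ) : ContDiff ℝ ∞ (dirDeriv v f) :=
  (hf.fderiv_right (by simp)).clm_apply contDiff_const

/-- A family of smooth functions on the plane, each of whose derivatives is bounded on the unit
square, uniformly over the family. -/
structure IsSymbol {ι F : Type*} [NormedAddCommGroup F] [NormedSpace ℝ F]
    (f : ι → ℝ × ℝ → F) : Prop where
  contDiff : ∀ i, ContDiff ℝ ∞ (f i)
  bounded : ∀ n : ℕ, ∃ C : ℝ, ∀ i, ∀ x ∈ unitSquare, ‖iteratedFDeriv ℝ n (f i) x‖ ≤ C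

namespace IsSymbol

variable {ι F G : Type*} [NormedAddCommGroup F] [NormedSpace ℝ F] [NormedAddCommGroup G]
  [NormedSpace ℝ G]

lemma exists_norm_le {f : ι → ℝ × ℝ → F} (hf : IsSymbol f) :
    ∃ C : ℝ, ∀ i, ∀ x ∈ unitSquare, ‖f i x‖ ≤ C := by
  obtain ⟨C, hC⟩ := hf.bounded 0
  exact ⟨C, fun i x hx => by simpa using hC i x hx⟩

lemma add {f g : ι → ℝ × ℝ → F} (hf : IsSymbol f) (hg : IsSymbol g) :
    IsSymbol fun i x => f i x + g i x where
  contDiff i := (hf.contDiff i).add (hg.contDiff i)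
  bounded n := by
    obtain ⟨C, hC⟩ := hf.bounded n
    obtain ⟨D, hD⟩ := hg.bounded n
    refine ⟨C + D, fun i x hx => ?_⟩
    have : iteratedFDeriv ℝ n (fun x => f i x + g i x) x =
        iteratedFDeriv ℝ n (f i) x + iteratedFDeriv ℝ n (g i) x :=
      iteratedFDeriv_add_apply ((hf.contDiff i).of_le (by exact_mod_cast le_top)).contDiffAt
        ((hg.contDiff i).of_le (by exact_mod_cast le_top)).contDiffAt
    rw [this]
    exact (norm_add_le _ _).trans (add_le_add (hC i x hx) (hD i x hx))

lemma mul {A : Type*} [NormedRing A] [NormedAlgebra ℝ A] {f g : ι → ℝ × ℝ → A}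
    (hf : IsSymbol f) (hg : IsSymbol g) : IsSymbol fun i x => f i x * g i x where
  contDiff i := (hf.contDiff i).mul (hg.contDiff i)
  bounded n := by
    choose C hC using hf.bounded
    choose D hD using hg.bounded
    refine ⟨∑ i ∈ Finset.range (n + 1), (n.choose i : ℝ) * C i * D (n - i), fun i x hx => ?_⟩
    refine (norm_iteratedFDeriv_mul_le (hf.contDiff i) (hg.contDiff i) x
      (by exact_mod_cast le_top)).trans (Finset.sum_le_sum fun m _ => ?_)
    have h1 := hC m i x hx
    have h2 := hD (n - m) i x hx
    have h3 := (norm_nonneg _).trans h1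
    gcongr

lemma const {c : ι → F} (hc : ∃ C, ∀ i, ‖c i‖ ≤ C) : IsSymbol fun i (_ : ℝ × ℝ) => c i where
  contDiff _ := contDiff_const
  bounded n := by
    obtain ⟨C, hC⟩ := hc
    refine ⟨max C 0, fun i x _ => ?_⟩
    rcases n with _ | n
    · simpa using Or.inl (hC i)
    · rw [iteratedFDeriv_succ_const]
      simp

lemma fixed {f : ℝ × ℝ → F} (hf : ContDiff ℝ ∞ f) : IsSymbol fun (_ : ι) x => f x where
  contDiff _ := hf
  bounded n := by
    obtain ⟨C, hC⟩ := isCompact_unitSquare.exists_bound_of_continuousOn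
      (hf.continuous_iteratedFDeriv (m := n) (by exact_mod_cast le_top)).continuousOn
    exact ⟨C, fun _ x hx => hC x hx⟩

lemma dirDeriv {f : ι → ℝ × ℝ → F} (hf : IsSymbol f) (v : ℝ × ℝ) :
    IsSymbol fun i => GeodesicPeriod.dirDeriv v (f i) where
  contDiff i := (hf.contDiff i).dirDeriv v
  bounded n := by
    obtain ⟨C, hC⟩ := hf.bounded (n + 1)
    refine ⟨‖v‖ * C, fun i x hx => ?_⟩
    have h1 : ContDiff ℝ ∞ (fderiv ℝ (f i)) := (hf.contDiff i).fderiv_right (by simp)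
    refine (norm_iteratedFDeriv_clm_apply_const (c := v) (n := n) h1.contDiffAt
      (by exact_mod_cast le_top)).trans ?_
    rw [norm_iteratedFDeriv_fderiv]
    gcongr
    exact hC i x hx

lemma comp [FiniteDimensional ℝ F] {f : ι → ℝ × ℝ → F} (hf : IsSymbol f) {φ : F → G}
    (hφ : ContDiff ℝ ∞ φ) :
    IsSymbol fun i x => φ (f i x) where
  contDiff i := hφ.comp (hf.contDiff i)
  bounded n := by
    choose C hC using hf.bounded
    obtain ⟨R, hR⟩ := hf.exists_norm_le
    have : ProperSpace F := FiniteDimensional.proper_real F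
    have h1 (m : ℕ) : ∃ B, ∀ y ∈ Metric.closedBall (0 : F) R, ‖iteratedFDeriv ℝ m φ y‖ ≤ B :=
      (isCompact_closedBall 0 R).exists_bound_of_continuousOn
        (hφ.continuous_iteratedFDeriv (m := m) (by exact_mod_cast le_top)).continuousOn
    choose B hB using h1
    set B' := ∑ m ∈ Finset.range (n + 1), |B m|
    -- The summand $1$ ensures $D\ge1$, so that $D\le D^m$, the form required by the bound for
    -- derivatives of a composition.
    set D := 1 + ∑ m ∈ Finset.range (n + 1), |C m|
    refine ⟨n.factorial * B' * D ^ n, fun i x hx => ?_⟩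
    refine norm_iteratedFDeriv_comp_le hφ (hf.contDiff i) (by exact_mod_cast le_top) x ?_ ?_
    · intro m hm
      refine (hB m _ (by simpa using hR i x hx)).trans ((le_abs_self _).trans ?_)
      exact Finset.single_le_sum (f := fun m => |B m|) (fun _ _ => abs_nonneg _)
        (Finset.mem_range.2 (by omega))
    · intro m hm1 hm
      have h2 : |C m| ≤ ∑ m ∈ Finset.range (n + 1), |C m| :=
        Finset.single_le_sum (f := fun m => |C m|) (fun _ _ => abs_nonneg _)
          (Finset.mem_range.2 (by omega))
      have h3 : 0 ≤ ∑ m ∈ Finset.range (n + 1), |C m| :=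
        Finset.sum_nonneg fun _ _ => abs_nonneg _
      calc ‖iteratedFDeriv ℝ m (f i) x‖ ≤ C m := hC m i x hx
        _ ≤ D := by have := le_abs_self (C m); linarith
        _ ≤ D ^ m := le_self_pow₀ (by linarith) (by omega)

lemma ofReal {f : ι → ℝ × ℝ → ℝ} (hf : IsSymbol f) : IsSymbol fun i x => (f i x : ℂ) :=
  hf.comp Complex.ofRealCLM.contDiff

lemma const_mul {A : Type*} [NormedRing A] [NormedAlgebra ℝ A] {f : ι → ℝ × ℝ → A}
    (hf : IsSymbol f) {c : ι → A} (hc : ∃ C, ∀ i, ‖c i‖ ≤ C) : IsSymbol fun i x => c i * f i x :=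
  (const hc).mul hf

lemma neg {f : ι → ℝ × ℝ → F} (hf : IsSymbol f) : IsSymbol fun i x => -f i x where
  contDiff i := (hf.contDiff i).neg
  bounded n := by
    obtain ⟨C, hC⟩ := hf.bounded n
    refine ⟨C, fun i x hx => ?_⟩
    have : iteratedFDeriv ℝ n (fun x => -f i x) x = -iteratedFDeriv ℝ n (f i) x :=
      iteratedFDeriv_neg_apply
    rw [this, norm_neg]
    exact hC i x hx

lemma sub {f g : ι → ℝ × ℝ → F} (hf : IsSymbol f) (hg : IsSymbol g) :
    IsSymbol fun i x => f i x - g i x := by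
  simpa only [sub_eq_add_neg] using hf.add hg.neg

lemma pow {A : Type*} [NormedCommRing A] [NormOneClass A] [NormedAlgebra ℝ A] {f : ι → ℝ × ℝ → A}
    (hf : IsSymbol f) (n : ℕ) : IsSymbol fun i x => f i x ^ n := by
  induction n with
  | zero => simpa using const (ι := ι) (c := fun _ => (1 : A)) ⟨1, by simp⟩
  | succ n ih => simpa only [pow_succ] using ih.mul hf

end IsSymbol

/-- A smooth function on the line which equals `1 / x` for `1 ≤ x`. -/
def smoothInv (x : ℝ) : ℝ :=
  (Real.smoothTransition x * x + (1 - Real.smoothTransition x))⁻¹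

lemma contDiff_smoothInv : ContDiff ℝ ∞ smoothInv := by
  have h := Real.smoothTransition.contDiff (n := ⊤)
  refine ((h.mul contDiff_id).add (contDiff_const.sub h)).inv fun x => ?_
  have h0 := Real.smoothTransition.nonneg x
  have h1 := Real.smoothTransition.le_one x
  simp only [id]
  rcases le_or_gt x 0 with hx | hx
  · rw [Real.smoothTransition.zero_of_nonpos hx]
    simp
  · apply ne_of_gt
    rcases eq_or_lt_of_le h1 with h2 | h2
    · rw [h2]; simpa
    · nlinarith [mul_nonneg h0 hx.le]

lemma smoothInv_of_one_le {x : ℝ} (hx : 1 ≤ x) : smoothInv x = 1 / x := by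
  rw [smoothInv, Real.smoothTransition.one_of_one_le hx]
  simp

lemma IsTail.abel {F : ℝ → ℂ} (hF : IsTail F) : IsTail (abel F) where
  contDiffOn := by
    rw [contDiffOn_infty]
    intro n
    induction n generalizing F with
    | zero =>
      exact contDiffOn_zero.2 fun w hw => (hF.hasDerivAt_abel hw).continuousAt.continuousWithinAt
    | succ n ih =>
      refine (contDiffOn_succ_iff_deriv_of_isOpen isOpen_Ioi).2 ⟨fun w hw =>
        (hF.hasDerivAt_abel hw).differentiableAt.differentiableWithinAt, fun h => (WithTop.natCast_ne_top n h).elim, ?_⟩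
      exact (ih hF.deriv).congr fun w hw => (hF.hasDerivAt_abel hw).deriv
  eq_zero _ hw := abel_eq_zero hF.eq_zero hw

lemma IsProfile.isTail_invAbel {g : ℝ → ℂ} (hg : IsProfile g) : IsTail (invAbel g) where
  contDiffOn := contDiffOn_const.mul hg.isTail.deriv.abel.contDiffOn
  eq_zero _ hw := hg.invAbel_eq_zero hw

lemma IsProfile.deriv_deriv_invAbel {g : ℝ → ℂ} (hg : IsProfile g) {w : ℝ} (hw : 1 < w) :
    deriv (deriv (invAbel g)) w = invAbel'' g w := by
  have : deriv (invAbel g) =ᶠ[nhds w] invAbel' g :=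
    Filter.eventually_of_mem (isOpen_Ioi.mem_nhds hw) fun v hv => (hg.hasDerivAt_invAbel hv).deriv
  rw [this.deriv_eq, (hg.hasDerivAt_invAbel' hw).deriv]

/-! ### Operators acting radially on functions of $c$, and integration by parts. -/

section DirDeriv

variable {v : ℝ × ℝ}

lemma dirDeriv_mul {f g : ℝ × ℝ → ℂ} (hf : ContDiff ℝ ∞ f) (hg : ContDiff ℝ ∞ g) :
    dirDeriv v (fun x => f x * g x) = fun x => f x * dirDeriv v g x + dirDeriv v f x * g x := by
  ext x
  simp only [dirDeriv]
  rw [fderiv_fun_mul (hf.differentiable (by simp) x) (hg.differentiable (by simp) x)]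
  simp [mul_comm]

lemma dirDeriv_add {f g : ℝ × ℝ → ℂ} (hf : ContDiff ℝ ∞ f) (hg : ContDiff ℝ ∞ g) :
    dirDeriv v (fun x => f x + g x) = fun x => dirDeriv v f x + dirDeriv v g x := by
  ext x
  simp only [dirDeriv]
  rw [fderiv_fun_add (hf.differentiable (by simp) x) (hg.differentiable (by simp) x)]
  simp

lemma dirDeriv_const_mul {f : ℝ × ℝ → ℂ} (hf : ContDiff ℝ ∞ f) (c : ℂ) :
    dirDeriv v (fun x => c * f x) = fun x => c * dirDeriv v f x := by
  ext x
  simp only [dirDeriv]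
  rw [fderiv_const_mul (hf.differentiable (by simp) x)]
  simp

lemma dirDeriv_ofReal {f : ℝ × ℝ → ℝ} (hf : ContDiff ℝ ∞ f) :
    dirDeriv v (fun x => (f x : ℂ)) = fun x => ((dirDeriv v f x : ℝ) : ℂ) := by
  ext x
  have := (Complex.ofRealCLM.hasFDerivAt (x := f x)).comp x
    (hf.differentiable (by simp) x).hasFDerivAt
  simp only [dirDeriv]
  rw [show (fun x => (f x : ℂ)) = Complex.ofRealCLM ∘ f from rfl, this.fderiv]
  simp

lemma dirDeriv_comp {F : ℝ → ℂ} {f : ℝ × ℝ → ℝ} (hf : ContDiff ℝ ∞ f)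
    (hF : ∀ x, DifferentiableAt ℝ F (f x)) :
    dirDeriv v (fun x => F (f x)) = fun x => deriv F (f x) * ((dirDeriv v f x : ℝ) : ℂ) := by
  ext x
  have := (hF x).hasDerivAt.hasFDerivAt.comp x (hf.differentiable (by simp) x).hasFDerivAt
  simp only [dirDeriv]
  rw [show (fun x => F (f x)) = F ∘ f from rfl, this.fderiv]
  simp [mul_comm]

lemma integral_mul_dirDeriv {f u : ℝ × ℝ → ℂ} (hf : ContDiff ℝ ∞ f) (hfc : HasCompactSupport f)
    (hu : ContDiff ℝ ∞ u) :
    ∫ x, f x * dirDeriv v u x = -∫ x, dirDeriv v f x * u x := by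
  have hd : HasCompactSupport (dirDeriv v f) := hfc.fderiv_apply ℝ v
  refine integral_mul_fderiv_eq_neg_fderiv_mul_of_integrable ?_ ?_ ?_
    (fun x _ => hf.differentiable (by simp) x) (fun x _ => hu.differentiable (by simp) x)
  · exact ((hf.dirDeriv v).continuous.mul hu.continuous).integrable_of_hasCompactSupport
      hd.mul_right
  · exact (hf.continuous.mul (hu.dirDeriv v).continuous).integrable_of_hasCompactSupport
      hfc.mul_right
  · exact (hf.continuous.mul hu.continuous).integrable_of_hasCompactSupport hfc.mul_right

lemma integral_mul_dirDeriv_dirDeriv {f u : ℝ × ℝ → ℂ} (hf : ContDiff ℝ ∞ f)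
    (hfc : HasCompactSupport f) (hu : ContDiff ℝ ∞ u) :
    ∫ x, f x * dirDeriv v (dirDeriv v u) x = ∫ x, dirDeriv v (dirDeriv v f) x * u x := by
  have hd : HasCompactSupport (dirDeriv v f) := hfc.fderiv_apply ℝ v
  rw [integral_mul_dirDeriv hf hfc (hu.dirDeriv v), integral_mul_dirDeriv (hf.dirDeriv v) hd hu,
    neg_neg]

end DirDeriv

/-- The direction in which `x₁ - x₂` increases at unit speed and `x₁ + x₂` is constant. -/
def diffDir : ℝ × ℝ := (1 / 2, -(1 / 2))

/-- The direction in which `x₁ + x₂` increases at unit speed and `x₁ - x₂` is constant. -/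
def sumDir : ℝ × ℝ := (1 / 2, 1 / 2)

/-- A second order operator `α ∂² + γ ∂'² + β ∂ + δ ∂'` which acts on functions of `c` as `η`
times the radial hyperbolic Laplacian in the variable `c = cosh r`. Here `∂` and `∂'` are the
derivatives in the directions `diffDir` and `sumDir`. -/
structure IsRadialOperator (c α γ β δ η : ℝ × ℝ → ℝ) : Prop where
  contDiff_α : ContDiff ℝ ∞ α
  contDiff_γ : ContDiff ℝ ∞ γ
  contDiff_β : ContDiff ℝ ∞ β
  contDiff_δ : ContDiff ℝ ∞ δ
  contDiff_η : ContDiff ℝ ∞ η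
  symbol : ∀ x, α x * dirDeriv diffDir c x ^ 2 + γ x * dirDeriv sumDir c x ^ 2 =
    η x * (c x ^ 2 - 1)
  first_order : ∀ x, α x * dirDeriv diffDir (dirDeriv diffDir c) x +
    γ x * dirDeriv sumDir (dirDeriv sumDir c) x + β x * dirDeriv diffDir c x +
    δ x * dirDeriv sumDir c x = 2 * η x * c x

/-- The formal adjoint of the operator with the given coefficients. -/
def formalAdjoint (α γ β δ : ℝ × ℝ → ℝ) (f : ℝ × ℝ → ℂ) (x : ℝ × ℝ) : ℂ :=
  dirDeriv diffDir (dirDeriv diffDir fun x => α x * f x) x +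
    dirDeriv sumDir (dirDeriv sumDir fun x => γ x * f x) x -
    dirDeriv diffDir (fun x => β x * f x) x - dirDeriv sumDir (fun x => δ x * f x) x

lemma _root_.ContDiff.ofReal_mul {α : ℝ × ℝ → ℝ} {f : ℝ × ℝ → ℂ} (hα : ContDiff ℝ ∞ α)
    (hf : ContDiff ℝ ∞ f) : ContDiff ℝ ∞ fun x => (α x : ℂ) * f x :=
  (Complex.ofRealCLM.contDiff.comp hα).mul hf

namespace IsRadialOperator

variable {c α γ β δ η : ℝ × ℝ → ℝ}

lemma contDiff_formalAdjoint (h : IsRadialOperator c α γ β δ η) {f : ℝ × ℝ → ℂ}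
    (hf : ContDiff ℝ ∞ f) : ContDiff ℝ ∞ (formalAdjoint α γ β δ f) :=
  (((((h.contDiff_α.ofReal_mul hf).dirDeriv _).dirDeriv _).add
    (((h.contDiff_γ.ofReal_mul hf).dirDeriv _).dirDeriv _)).sub
    ((h.contDiff_β.ofReal_mul hf).dirDeriv _)).sub ((h.contDiff_δ.ofReal_mul hf).dirDeriv _)

lemma hasCompactSupport_formalAdjoint {f : ℝ × ℝ → ℂ} (hfc : HasCompactSupport f) :
    HasCompactSupport (formalAdjoint α γ β δ f) := by
  have h1 (a : ℝ × ℝ → ℝ) : HasCompactSupport fun x => (a x : ℂ) * f x := hfc.mul_left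
  have h2 {u : ℝ × ℝ → ℂ} (hu : HasCompactSupport u) (v) : HasCompactSupport (dirDeriv v u) :=
    hu.fderiv_apply ℝ v
  have h3 : HasCompactSupport _ := (h2 (h2 (h1 α) diffDir) diffDir).add
    (h2 (h2 (h1 γ) sumDir) sumDir)
  exact (h3.sub (h2 (h1 β) diffDir)).sub (h2 (h1 δ) sumDir)

/-- Replacing $c$ by $c+\varepsilon$ inside $F$ alone keeps its argument above $1$, where $F$ is
smooth, and does not change the derivatives of $c$. The two identities of a radial operator then
apply with $c$ itself, so the coefficients $c^2-1$ and $2c$ stay unshifted. -/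
lemma integral_shifted (h : IsRadialOperator c α γ β δ η) (hc : ContDiff ℝ ∞ c)
    (hc1 : ∀ x, 1 ≤ c x) {f : ℝ × ℝ → ℂ} (hf : ContDiff ℝ ∞ f) (hfc : HasCompactSupport f)
    {F : ℝ → ℂ} (hF : IsTail F) {ε : ℝ} (hε : 0 < ε) :
    ∫ x, f x * η x * ((c x ^ 2 - 1) * deriv (deriv F) (c x + ε) +
      2 * c x * deriv F (c x + ε)) = ∫ x, formalAdjoint α γ β δ f x * F (c x + ε) := by
  have hw (x : ℝ × ℝ) : 1 < c x + ε := by linarith [hc1 x]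
  have hcε : ContDiff ℝ ∞ fun x => c x + ε := hc.add contDiff_const
  have hsm {F : ℝ → ℂ} (hF : IsTail F) : ContDiff ℝ ∞ fun x => F (c x + ε) :=
    hF.contDiffOn.comp_contDiff hcε hw
  have hdc (v : ℝ × ℝ) : dirDeriv v (fun x => c x + ε) = dirDeriv v c := by
    ext x
    simp [dirDeriv]
  have hdiff {F : ℝ → ℂ} (hF : IsTail F) (v : ℝ × ℝ) : dirDeriv v (fun x => F (c x + ε)) =
      fun x => deriv F (c x + ε) * ((dirDeriv v c x : ℝ) : ℂ) := by
    rw [dirDeriv_comp hcε fun x => (hF.hasDerivAt (hw x)).differentiableAt, hdc]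
  have hofR {a : ℝ × ℝ → ℝ} (ha : ContDiff ℝ ∞ a) : ContDiff ℝ ∞ fun x => (a x : ℂ) :=
    Complex.ofRealCLM.contDiff.comp ha
  have hdd (v : ℝ × ℝ) : dirDeriv v (dirDeriv v fun x => F (c x + ε)) = fun x =>
      deriv F (c x + ε) * ((dirDeriv v (dirDeriv v c) x : ℝ) : ℂ) +
        deriv (deriv F) (c x + ε) * ((dirDeriv v c x : ℝ) : ℂ) ^ 2 := by
    rw [hdiff hF, dirDeriv_mul (hsm hF.deriv) (hofR (hc.dirDeriv v)), hdiff hF.deriv,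
      dirDeriv_ofReal (hc.dirDeriv v)]
    ext x
    ring
  set u := fun x => F (c x + ε)
  have hu : ContDiff ℝ ∞ u := hsm hF
  have hs (a : ℝ × ℝ → ℝ) : HasCompactSupport fun x => (a x : ℂ) * f x := hfc.mul_left
  have hsd {u : ℝ × ℝ → ℂ} (hu : HasCompactSupport u) (v) : HasCompactSupport (dirDeriv v u) :=
    hu.fderiv_apply ℝ v
  have hint {a b : ℝ × ℝ → ℂ} (ha : ContDiff ℝ ∞ a) (hs : HasCompactSupport a)
      (hb : ContDiff ℝ ∞ b) : Integrable fun x => a x * b x :=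
    (ha.continuous.mul hb.continuous).integrable_of_hasCompactSupport hs.mul_right
  have pα := h.contDiff_α.ofReal_mul hf
  have pγ := h.contDiff_γ.ofReal_mul hf
  have pβ := h.contDiff_β.ofReal_mul hf
  have pδ := h.contDiff_δ.ofReal_mul hf
  have e1 : ∀ x, f x * η x * ((c x ^ 2 - 1) * deriv (deriv F) (c x + ε) +
      2 * c x * deriv F (c x + ε)) =
      α x * f x * dirDeriv diffDir (dirDeriv diffDir u) x +
      γ x * f x * dirDeriv sumDir (dirDeriv sumDir u) x +
      β x * f x * dirDeriv diffDir u x + δ x * f x * dirDeriv sumDir u x := by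
    intro x
    rw [hdd, hdd, hdiff hF, hdiff hF]
    have s1 : ((α x * dirDeriv diffDir c x ^ 2 + γ x * dirDeriv sumDir c x ^ 2 : ℝ) : ℂ) =
      ((η x * (c x ^ 2 - 1) : ℝ) : ℂ) := congrArg _ (h.symbol x)
    have s2 : ((α x * dirDeriv diffDir (dirDeriv diffDir c) x +
      γ x * dirDeriv sumDir (dirDeriv sumDir c) x + β x * dirDeriv diffDir c x +
      δ x * dirDeriv sumDir c x : ℝ) : ℂ) = ((2 * η x * c x : ℝ) : ℂ) :=
      congrArg _ (h.first_order x)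
    push_cast at s1 s2
    linear_combination (-(f x * deriv (deriv F) (c x + ε))) * s1 -
      f x * deriv F (c x + ε) * s2
  have e2 : ∀ x, formalAdjoint α γ β δ f x * u x =
      dirDeriv diffDir (dirDeriv diffDir fun x => α x * f x) x * u x +
      dirDeriv sumDir (dirDeriv sumDir fun x => γ x * f x) x * u x -
      dirDeriv diffDir (fun x => β x * f x) x * u x -
      dirDeriv sumDir (fun x => δ x * f x) x * u x := by
    intro x
    rw [formalAdjoint]
    ring
  have i1 := hint pα (hs α) ((hu.dirDeriv diffDir).dirDeriv diffDir)
  have i2 := hint pγ (hs γ) ((hu.dirDeriv sumDir).dirDeriv sumDir)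
  have i3 := hint pβ (hs β) (hu.dirDeriv diffDir)
  have i4 := hint pδ (hs δ) (hu.dirDeriv sumDir)
  have j1 := hint ((pα.dirDeriv diffDir).dirDeriv diffDir) (hsd (hsd (hs α) _) _) hu
  have j2 := hint ((pγ.dirDeriv sumDir).dirDeriv sumDir) (hsd (hsd (hs γ) _) _) hu
  have j3 := hint (pβ.dirDeriv diffDir) (hsd (hs β) _) hu
  have j4 := hint (pδ.dirDeriv sumDir) (hsd (hs δ) _) hu
  rw [integral_congr_ae (Filter.Eventually.of_forall e1),
    integral_congr_ae (Filter.Eventually.of_forall e2)]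
  have add4 {a b c d : ℝ × ℝ → ℂ} (ha : Integrable a) (hb : Integrable b) (hc : Integrable c)
      (hd : Integrable d) : ∫ x, a x + b x + c x + d x =
        (∫ x, a x) + (∫ x, b x) + (∫ x, c x) + ∫ x, d x := by
    rw [← integral_add' ha hb, ← integral_add' (ha.add hb) hc, ← integral_add' ((ha.add hb).add hc) hd]
    rfl
  have sub4 {a b c d : ℝ × ℝ → ℂ} (ha : Integrable a) (hb : Integrable b) (hc : Integrable c)
      (hd : Integrable d) : ∫ x, a x + b x - c x - d x =
        (∫ x, a x) + (∫ x, b x) - (∫ x, c x) - ∫ x, d x := by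
    rw [← integral_add' ha hb, ← integral_sub' (ha.add hb) hc, ← integral_sub' ((ha.add hb).sub hc) hd]
    rfl
  rw [add4 i1 i2 i3 i4, sub4 j1 j2 j3 j4,
    integral_mul_dirDeriv_dirDeriv pα (hs α) hu, integral_mul_dirDeriv_dirDeriv pγ (hs γ) hu,
    integral_mul_dirDeriv pβ (hs β) hu, integral_mul_dirDeriv pδ (hs δ) hu]
  ring

/-- Integration by parts against a function of `c` which may be singular where `c = 1`. -/
lemma integral_laplacian (h : IsRadialOperator c α γ β δ η) (hc : ContDiff ℝ ∞ c)
    (hc1 : ∀ x, 1 ≤ c x) (hnull : ∀ᵐ x, c x ≠ 1) {f : ℝ × ℝ → ℂ} (hf : ContDiff ℝ ∞ f)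
    (hfc : HasCompactSupport f) {g : ℝ → ℂ} (hg : IsProfile g) :
    ∫ x, f x * η x * (invAbel (deriv (deriv g)) (c x) - 1 / 4 * invAbel g (c x)) =
      ∫ x, formalAdjoint α γ β δ f x * invAbel g (c x) := by
  set F := invAbel g with hFdef
  have hF : IsTail F := hg.isTail_invAbel
  obtain ⟨M, hM0, hM⟩ := hg.deriv_deriv.bounded
  obtain ⟨M₄, hM₄0, hM₄⟩ := hg.deriv_deriv.deriv_deriv.bounded
  obtain ⟨M₁, hM₁0, hM₁⟩ := hg.exists_norm_invAbel'_le
  set εs : ℕ → ℝ := fun n => 1 / ((n : ℝ) + 1)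
  have hεs (n : ℕ) : 0 < εs n := by positivity
  have hεs1 (n : ℕ) : εs n ≤ 1 := by
    simp only [εs]
    rw [div_le_one (by positivity)]
    linarith [(Nat.cast_nonneg n : (0 : ℝ) ≤ n)]
  have hεl : Filter.Tendsto εs Filter.atTop (nhds 0) := tendsto_one_div_add_atTop_nhds_zero_nat
  have hcl (x : ℝ × ℝ) : Filter.Tendsto (fun n => c x + εs n) Filter.atTop (nhds (c x)) := by
    simpa using (tendsto_const_nhds (x := c x)).add hεl
  have hcont {G : ℝ → ℂ} (hG : IsTail G) {x : ℝ × ℝ} (hx : 1 < c x) :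
      Filter.Tendsto (fun n => G (c x + εs n)) Filter.atTop (nhds (G (c x))) :=
    ((hG.hasDerivAt hx).continuousAt.tendsto).comp (hcl x)
  have hGm {G : ℝ → ℂ} (hG : IsTail G) (n : ℕ) : Continuous fun x => G (c x + εs n) :=
    hG.contDiffOn.continuousOn.comp_continuous (hc.continuous.add continuous_const)
      fun x => by simp only [Set.mem_Ioi]; linarith [hc1 x, hεs n]
  have hη := h.contDiff_η.continuous
  have hcc := hc.continuous
  have hadj := h.contDiff_formalAdjoint hf
  have lim1 := tendsto_integral_of_dominated_convergence (μ := volume)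
    (F := fun n x => formalAdjoint α γ β δ f x * F (c x + εs n))
    (f := fun x => formalAdjoint α γ β δ f x * F (c x))
    (fun x => ‖formalAdjoint α γ β δ f x‖ * M)
    (fun n => (hadj.continuous.mul (hGm hF n)).aestronglyMeasurable)
    ((hadj.continuous.norm.mul continuous_const).integrable_of_hasCompactSupport
      (hasCompactSupport_formalAdjoint hfc).norm.mul_right)
    (fun n => Filter.Eventually.of_forall fun x => by
      rw [norm_mul]
      gcongr
      exact hg.norm_invAbel_le hM (by linarith [hc1 x, hεs n]))
    (by
      filter_upwards [hnull] with x hx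
      exact (hcont hF (lt_of_le_of_ne (hc1 x) hx.symm)).const_mul _)
  -- The second derivative of $F$ is not bounded a priori near $c=1$; a bound uniform in
  -- $\varepsilon$ is needed for its product with $c^2-1$.
  have lim2 := tendsto_integral_of_dominated_convergence (μ := volume)
    (F := fun n x => f x * η x * ((c x ^ 2 - 1) * deriv (deriv F) (c x + εs n) +
      2 * c x * deriv F (c x + εs n)))
    (f := fun x => f x * η x * ((c x ^ 2 - 1) * deriv (deriv F) (c x) +
      2 * c x * deriv F (c x)))
    (fun x => ‖f x‖ * ‖η x‖ * (M₄ + 1 / 4 * M + 4 * (c x + 1) * M₁))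
    (fun n => by
      have h1 := hGm hF.deriv n
      have h2 := hGm hF.deriv.deriv n
      exact Continuous.aestronglyMeasurable (by have := hf.continuous; fun_prop))
    (Continuous.integrable_of_hasCompactSupport (by have := hf.continuous; fun_prop)
      (HasCompactSupport.mul_right (HasCompactSupport.mul_right hfc.norm)))
    (fun n => Filter.Eventually.of_forall fun x => by
      have hw : 1 < c x + εs n := by linarith [hc1 x, hεs n]
      have e1 := hg.laplacian_invAbel hw
      have b1 := hg.deriv_deriv.norm_invAbel_le hM₄ hw.le
      have b2 := hg.norm_invAbel_le hM hw.le
      have b3 := hM₁ _ hw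
      rw [norm_mul, norm_mul, Complex.norm_real]
      gcongr
      rw [hg.deriv_deriv_invAbel hw, (hg.hasDerivAt_invAbel hw).deriv]
      set w := c x + εs n
      have hcx := hc1 x
      have hw2 : w ≤ c x + 1 := by simp only [w]; linarith [hεs1 n]
      have hcw : c x ≤ w := by simp only [w]; linarith [hεs n]
      have n1 : ‖((c x : ℂ) ^ 2 - 1)‖ = c x ^ 2 - 1 := by
        rw [show ((c x : ℂ) ^ 2 - 1) = ((c x ^ 2 - 1 : ℝ) : ℂ) by push_cast; ring,
          Complex.norm_real, Real.norm_of_nonneg (by nlinarith)]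
      have n2 : ‖((w : ℂ) ^ 2 - 1)‖ = w ^ 2 - 1 := by
        rw [show ((w : ℂ) ^ 2 - 1) = ((w ^ 2 - 1 : ℝ) : ℂ) by push_cast; ring,
          Complex.norm_real, Real.norm_of_nonneg (by nlinarith)]
      have n3 (y : ℝ) (hy : 1 ≤ y) : ‖(2 * (y : ℂ))‖ = 2 * y := by
        rw [norm_mul, Complex.norm_real, Real.norm_of_nonneg (by linarith)]
        simp
      -- The differential equation bounds $(w^2-1)F''$ by bounded quantities, and $c^2-1\le w^2-1$
      -- transfers this to the unshifted coefficient.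
      have n4 : (w ^ 2 - 1) * ‖invAbel'' g w‖ ≤ M₄ + 1 / 4 * M + 2 * w * M₁ := by
        rw [← n2, ← norm_mul, eq_sub_of_add_eq e1]
        refine (norm_sub_le _ _).trans (add_le_add ((norm_sub_le _ _).trans
          (add_le_add b1 ?_)) ?_)
        · rw [norm_mul]
          norm_num
          exact b2
        · rw [norm_mul, n3 w hw.le]
          gcongr
      calc ‖((c x : ℂ) ^ 2 - 1) * invAbel'' g w + 2 * c x * invAbel' g w‖
          ≤ (c x ^ 2 - 1) * ‖invAbel'' g w‖ + 2 * c x * ‖invAbel' g w‖ := by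
            refine (norm_add_le _ _).trans_eq ?_
            rw [norm_mul, norm_mul, n1, n3 _ hcx]
        _ ≤ (w ^ 2 - 1) * ‖invAbel'' g w‖ + 2 * (c x + 1) * M₁ := by
            gcongr
            linarith
        _ ≤ M₄ + 1 / 4 * M + 4 * (c x + 1) * M₁ := by nlinarith)
    (by
      filter_upwards [hnull] with x hx
      have hx1 := lt_of_le_of_ne (hc1 x) hx.symm
      exact (((hcont hF.deriv.deriv hx1).const_mul _).add
        ((hcont hF.deriv hx1).const_mul _)).const_mul _)
  have heq := tendsto_nhds_unique (lim2.congr fun n =>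
    h.integral_shifted hc hc1 hf hfc hF (hεs n)) lim1
  rw [← heq]
  refine integral_congr_ae ?_
  filter_upwards [hnull] with x hx
  have hx1 := lt_of_le_of_ne (hc1 x) hx.symm
  rw [← hg.laplacian_invAbel hx1, hg.deriv_deriv_invAbel hx1, (hg.hasDerivAt_invAbel hx1).deriv]

end IsRadialOperator

/-! ### Oscillatory integrals against the iterated kernels. -/

lemma invAbel_deriv_deriv_abelIter {h : 𝓢(ℝ, ℝ)} (hh : IsAdmissible h) {t : ℝ} (ht : 1 ≤ t)
    {k : ℍ → ℂ} (hk : IsSpectralKernel h t k) (j : ℕ) {w : ℝ} (hw : 1 < w) :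
    invAbel (deriv (deriv (abelIter h t j))) w =
      kernelIter h t (j + 1) w - t ^ 2 * kernelIter h t j w := by
  have p0 := isProfile_abelIter hh ht hk j
  have p1 := isProfile_abelIter hh ht hk (j + 1)
  have e1 : deriv (deriv (abelIter h t j)) ∘ Real.arcosh = fun w =>
      (abelIter h t (j + 1) ∘ Real.arcosh) w - t ^ 2 * (abelIter h t j ∘ Real.arcosh) w := by
    ext w
    simp only [Function.comp]
    rw [abelIter_succ hh.even ht]
    ring
  have e2 (w : ℝ) (hw : 1 < w) : deriv (deriv (deriv (abelIter h t j)) ∘ Real.arcosh) w =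
      deriv (abelIter h t (j + 1) ∘ Real.arcosh) w -
        t ^ 2 * deriv (abelIter h t j ∘ Real.arcosh) w := by
    rw [e1]
    exact ((p1.isTail.hasDerivAt hw).sub ((p0.isTail.hasDerivAt hw).const_mul _)).deriv
  simp only [kernelIter, invAbel]
  have e3 : abel (deriv (deriv (deriv (abelIter h t j)) ∘ Real.arcosh)) w =
      abel (deriv (abelIter h t (j + 1) ∘ Real.arcosh)) w -
        t ^ 2 * abel (deriv (abelIter h t j ∘ Real.arcosh)) w := by
    simp only [abel]
    rw [← integral_const_mul, ← integral_sub (p1.isTail.deriv.integrable hw)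
      ((p0.isTail.deriv.integrable hw).const_mul _)]
    refine integral_congr_ae (Filter.Eventually.of_forall fun v => ?_)
    exact e2 _ (by have := sq_nonneg v; linarith)
  rw [e3]
  ring

lemma exists_norm_kernelIter_le {h : 𝓢(ℝ, ℝ)} (hh : IsAdmissible h) (j : ℕ) :
    ∃ C : ℝ, 0 < C ∧ ∀ t : ℝ, 1 ≤ t → ∀ k, IsSpectralKernel h t k → ∀ w, 1 ≤ w →
      ‖kernelIter h t j w‖ ≤ C * t ^ (j + 2) := by
  obtain ⟨C, hC, hb⟩ := norm_deriv_abelIter_le hh.even j 2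
  refine ⟨C, hC, fun t ht k hk w hw => ?_⟩
  rw [add_comm j]
  exact (isProfile_abelIter hh ht hk j).norm_invAbel_le (fun u => hb t ht u) hw

lemma contDiff_coshDist (g : SL(2, ℝ)) : ContDiff ℝ ∞ (coshDist g) := by
  unfold coshDist
  fun_prop

/-- For fixed $x_1$ the quadratic lower bound allows $c=1$ for at most one $x_2$; Fubini does the
rest. This covers the case of equal geodesics too. -/
lemma ae_coshDist_ne_one (g : SL(2, ℝ)) : ∀ᵐ x, coshDist g x ≠ 1 := by
  have hm : MeasurableSet {x | coshDist g x = 1} :=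
    measurableSet_eq_fun (continuous_coshDist g).measurable measurable_const
  have : (volume : Measure (ℝ × ℝ)) {x | coshDist g x = 1} = 0 := by
    rw [Measure.volume_eq_prod, Measure.measure_prod_null hm]
    refine Filter.Eventually.of_forall fun x₁ => ?_
    obtain ⟨c, hc⟩ := exists_center_snd g x₁
    refine measure_mono_null (t := {c}) (fun x₂ hx => ?_) (measure_singleton c)
    have h1 := hc x₂
    simp only [Set.mem_preimage, Set.mem_ofPred_eq] at hx
    rw [hx] at h1
    have h2 : (x₂ - c) ^ 2 = 0 := le_antisymm (by linarith) (sq_nonneg _)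
    simpa [sub_eq_zero] using h2
  simpa [ae_iff] using this

lemma integrable_mul_invAbel {g : SL(2, ℝ)} {f : ℝ × ℝ → ℂ} (hf : Continuous f)
    (hfc : HasCompactSupport f) {φ : ℝ → ℂ} (hφ : IsProfile φ) :
    Integrable fun x => f x * invAbel φ (coshDist g x) := by
  obtain ⟨M, hM0, hM⟩ := hφ.deriv_deriv.bounded
  refine (hf.integrable_of_hasCompactSupport hfc).mul_bdd (c := M) ?_
    (Filter.Eventually.of_forall fun x => hφ.norm_invAbel_le hM (one_le_coshDist g x))
  have hcont : ContinuousOn (fun x => invAbel φ (coshDist g x)) {x | 1 < coshDist g x} :=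
    hφ.isTail_invAbel.contDiffOn.continuousOn.comp (continuous_coshDist g).continuousOn
      fun x hx => hx
  have hm : MeasurableSet {x | 1 < coshDist g x} :=
    measurableSet_lt measurable_const (continuous_coshDist g).measurable
  have h1 := hcont.aestronglyMeasurable (μ := volume) hm
  rwa [Measure.restrict_eq_self_of_ae_mem] at h1
  filter_upwards [ae_coshDist_ne_one g] with x hx
  exact lt_of_le_of_ne (one_le_coshDist g x) hx.symm

/-- The plane wave with frequency `ξ` in `x₁ - x₂` and `ζ` in `x₁ + x₂`. -/
def planeWave (ξ ζ : ℝ) (x : ℝ × ℝ) : ℂ :=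
  Complex.exp (Complex.I * ((ξ * (x.1 - x.2) + ζ * (x.1 + x.2) : ℝ) : ℂ))

lemma contDiff_planeWave (ξ ζ : ℝ) : ContDiff ℝ ∞ (planeWave ξ ζ) := by
  have h : ContDiff ℝ ∞ fun x : ℝ × ℝ => ξ * (x.1 - x.2) + ζ * (x.1 + x.2) := by fun_prop
  have : ContDiff ℝ ∞ fun x : ℝ × ℝ => ((ξ * (x.1 - x.2) + ζ * (x.1 + x.2) : ℝ) : ℂ) :=
    Complex.ofRealCLM.contDiff.comp h
  exact (contDiff_const.mul this).cexp

lemma norm_planeWave (ξ ζ : ℝ) (x : ℝ × ℝ) : ‖planeWave ξ ζ x‖ = 1 := by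
  rw [planeWave, mul_comm, Complex.norm_exp_ofReal_mul_I]

lemma dirDeriv_planeWave (ξ ζ : ℝ) (v x : ℝ × ℝ) : dirDeriv v (planeWave ξ ζ) x =
    Complex.I * ((ξ * (v.1 - v.2) + ζ * (v.1 + v.2) : ℝ) : ℂ) * planeWave ξ ζ x := by
  set L : ℝ × ℝ →L[ℝ] ℝ := ξ • (ContinuousLinearMap.fst ℝ ℝ ℝ - ContinuousLinearMap.snd ℝ ℝ ℝ) +
    ζ • (ContinuousLinearMap.fst ℝ ℝ ℝ + ContinuousLinearMap.snd ℝ ℝ ℝ) with hL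
  have h1 : HasFDerivAt (fun x => Complex.I * ((L x : ℝ) : ℂ))
      (Complex.I • (Complex.ofRealCLM.comp L)) x :=
    (Complex.ofRealCLM.comp L).hasFDerivAt.const_mul Complex.I
  have h2 : planeWave ξ ζ = fun x => Complex.exp (Complex.I * ((L x : ℝ) : ℂ)) := by
    ext x
    have : L x = ξ * (x.1 - x.2) + ζ * (x.1 + x.2) := by simp [hL]; ring
    rw [this, planeWave]
  rw [dirDeriv, h2, h1.cexp.fderiv]
  simp [hL]
  ring

lemma dirDeriv_eq_zero {f : ℝ × ℝ → ℂ} (hf : ∀ x ∉ unitSquare, f x = 0) (v : ℝ × ℝ) :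
    ∀ x ∉ unitSquare, dirDeriv v f x = 0 := by
  intro x hx
  have : f =ᶠ[nhds x] fun _ => 0 :=
    Filter.eventually_of_mem (isCompact_unitSquare.isClosed.isOpen_compl.mem_nhds hx) hf
  rw [dirDeriv, this.fderiv_eq]
  simp

/-- The contribution of order at most one in the frequencies to the conjugate of `formalAdjoint`
by a plane wave. -/
def conjLower (ξ ζ : ℝ) (α γ β δ : ℝ × ℝ → ℝ) (f : ℝ × ℝ → ℂ) (x : ℝ × ℝ) : ℂ :=
  dirDeriv diffDir (dirDeriv diffDir fun x => α x * f x) x +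
    2 * Complex.I * ξ * dirDeriv diffDir (fun x => α x * f x) x +
    dirDeriv sumDir (dirDeriv sumDir fun x => γ x * f x) x +
    2 * Complex.I * ζ * dirDeriv sumDir (fun x => γ x * f x) x -
    dirDeriv diffDir (fun x => β x * f x) x - Complex.I * ξ * (β x * f x) -
    dirDeriv sumDir (fun x => δ x * f x) x - Complex.I * ζ * (δ x * f x)

lemma dirDeriv_mul_planeWave {f : ℝ × ℝ → ℂ} (hf : ContDiff ℝ ∞ f) (ξ ζ : ℝ) (v : ℝ × ℝ) :
    dirDeriv v (fun x => f x * planeWave ξ ζ x) = fun x =>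
      (dirDeriv v f x + Complex.I * ((ξ * (v.1 - v.2) + ζ * (v.1 + v.2) : ℝ) : ℂ) * f x) *
        planeWave ξ ζ x := by
  rw [dirDeriv_mul hf (contDiff_planeWave ξ ζ)]
  ext x
  rw [dirDeriv_planeWave]
  ring

lemma dirDeriv_dirDeriv_mul_planeWave {f : ℝ × ℝ → ℂ} (hf : ContDiff ℝ ∞ f) (ξ ζ : ℝ)
    (v : ℝ × ℝ) {s : ℝ} (hs : ξ * (v.1 - v.2) + ζ * (v.1 + v.2) = s) :
    dirDeriv v (dirDeriv v (fun x => f x * planeWave ξ ζ x)) = fun x =>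
      (dirDeriv v (dirDeriv v f) x + 2 * Complex.I * s * dirDeriv v f x - s ^ 2 * f x) *
        planeWave ξ ζ x := by
  rw [dirDeriv_mul_planeWave hf, dirDeriv_mul_planeWave
    ((hf.dirDeriv v).add (contDiff_const.mul hf)), dirDeriv_add (hf.dirDeriv v)
    (contDiff_const.mul hf), dirDeriv_const_mul hf, hs]
  ext x
  linear_combination ((s : ℂ) ^ 2 * f x * planeWave ξ ζ x) * Complex.I_sq

/-- Isolates the principal symbol $-(\xi^2\alpha+\zeta^2\gamma)$; with the normalised directions,
the two derivatives of the plane wave are exactly $i\xi$ and $i\zeta$. -/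
lemma formalAdjoint_mul_planeWave {α γ β δ : ℝ × ℝ → ℝ} (hα : ContDiff ℝ ∞ α)
    (hγ : ContDiff ℝ ∞ γ) (hβ : ContDiff ℝ ∞ β) (hδ : ContDiff ℝ ∞ δ) {f : ℝ × ℝ → ℂ}
    (hf : ContDiff ℝ ∞ f) (ξ ζ : ℝ) (x : ℝ × ℝ) :
    formalAdjoint α γ β δ (fun x => f x * planeWave ξ ζ x) x =
      (conjLower ξ ζ α γ β δ f x - (ξ ^ 2 * α x + ζ ^ 2 * γ x) * f x) * planeWave ξ ζ x := by
  have h1 : ξ * (diffDir.1 - diffDir.2) + ζ * (diffDir.1 + diffDir.2) = ξ := by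
    simp only [diffDir]
    ring
  have h2 : ξ * (sumDir.1 - sumDir.2) + ζ * (sumDir.1 + sumDir.2) = ζ := by
    simp only [sumDir]
    ring
  simp only [formalAdjoint, ← mul_assoc]
  rw [dirDeriv_dirDeriv_mul_planeWave (hα.ofReal_mul hf) _ _ _ h1,
    dirDeriv_dirDeriv_mul_planeWave (hγ.ofReal_mul hf) _ _ _ h2,
    dirDeriv_mul_planeWave (hβ.ofReal_mul hf), dirDeriv_mul_planeWave (hδ.ofReal_mul hf), h1, h2,
    conjLower]
  ring

/-- The oscillatory integral with amplitude `f` against the `j`-th iterated kernel. -/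
def oscIntegral (h : 𝓢(ℝ, ℝ)) (t : ℝ) (g : SL(2, ℝ)) (ξ ζ : ℝ) (f : ℝ × ℝ → ℂ) (j : ℕ) : ℂ :=
  ∫ x, f x * planeWave ξ ζ x * kernelIter h t j (coshDist g x)

/-- The equation $\Delta k_{t,j}=k_{t,j+1}-(t^2+\tfrac14)k_{t,j}$ is integrated against $\eta f$
times the plane wave, with $\eta\Delta$ replaced by the radial operator and moved to the amplitude.
The terms quadratic in the frequencies and in $t$ are collected on the left. -/
lemma oscIntegral_by_parts {h : 𝓢(ℝ, ℝ)} (hh : IsAdmissible h) {t : ℝ} (ht : 1 ≤ t) {k : ℍ → ℂ}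
    (hk : IsSpectralKernel h t k) {g : SL(2, ℝ)} {α γ β δ η : ℝ × ℝ → ℝ}
    (hop : IsRadialOperator (coshDist g) α γ β δ η) (ξ ζ : ℝ) {f : ℝ × ℝ → ℂ}
    (hf : ContDiff ℝ ∞ f) (hfc : HasCompactSupport f) (j : ℕ) :
    oscIntegral h t g ξ ζ
      (fun x => (ξ ^ 2 * α x + ζ ^ 2 * γ x - η x * (t ^ 2 + 1 / 4)) * f x) j =
      -oscIntegral h t g ξ ζ (fun x => η x * f x) (j + 1) +
        oscIntegral h t g ξ ζ (conjLower ξ ζ α γ β δ f) j := by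
  have hE := contDiff_planeWave ξ ζ
  have p0 := isProfile_abelIter hh ht hk j
  have p1 := isProfile_abelIter hh ht hk (j + 1)
  have key := hop.integral_laplacian (contDiff_coshDist g) (one_le_coshDist g)
    (ae_coshDist_ne_one g) (hf.mul hE) hfc.mul_right p0
  have e1 : ∀ᵐ x, f x * planeWave ξ ζ x * η x *
      (invAbel (deriv (deriv (abelIter h t j))) (coshDist g x) -
        1 / 4 * invAbel (abelIter h t j) (coshDist g x)) =
      η x * f x * planeWave ξ ζ x * kernelIter h t (j + 1) (coshDist g x) -
        ((t ^ 2 + 1 / 4) * (η x * f x)) * planeWave ξ ζ x * kernelIter h t j (coshDist g x) := by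
    filter_upwards [ae_coshDist_ne_one g] with x hx
    rw [invAbel_deriv_deriv_abelIter hh ht hk j
      (lt_of_le_of_ne (one_le_coshDist g x) hx.symm)]
    simp only [kernelIter]
    ring
  have hcs (a : ℝ × ℝ → ℂ) : HasCompactSupport fun x => a x * f x := hfc.mul_left
  have pη := hop.contDiff_η.ofReal_mul hf
  have pα := hop.contDiff_α.ofReal_mul hf
  have pγ := hop.contDiff_γ.ofReal_mul hf
  have hadj := hop.contDiff_formalAdjoint (hf.mul hE)
  have hadjc : HasCompactSupport (formalAdjoint α γ β δ fun x => f x * planeWave ξ ζ x) :=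
    IsRadialOperator.hasCompactSupport_formalAdjoint hfc.mul_right
  have i1 : Integrable fun x => η x * f x * planeWave ξ ζ x *
      kernelIter h t (j + 1) (coshDist g x) :=
    integrable_mul_invAbel (pη.mul hE).continuous (hcs _).mul_right p1
  have i2 : Integrable fun x => ((t ^ 2 + 1 / 4) * (η x * f x)) * planeWave ξ ζ x *
      kernelIter h t j (coshDist g x) :=
    integrable_mul_invAbel ((contDiff_const.mul pη).mul hE).continuous
      (HasCompactSupport.mul_right (HasCompactSupport.mul_left (hcs _))) p0
  have i3 : Integrable fun x => formalAdjoint α γ β δ (fun x => f x * planeWave ξ ζ x) x *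
      kernelIter h t j (coshDist g x) :=
    integrable_mul_invAbel hadj.continuous hadjc p0
  have i4 : Integrable fun x => (ξ ^ 2 * α x + ζ ^ 2 * γ x) * f x * planeWave ξ ζ x *
      kernelIter h t j (coshDist g x) := by
    have hc1 := hop.contDiff_α.continuous
    have hc2 := hop.contDiff_γ.continuous
    have hc3 := hf.continuous
    have hc4 := hE.continuous
    exact integrable_mul_invAbel (by fun_prop) (hcs _).mul_right p0
  rw [integral_congr_ae e1, integral_sub i1 i2] at key
  have e3 : oscIntegral h t g ξ ζ (conjLower ξ ζ α γ β δ f) j =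
      (∫ x, formalAdjoint α γ β δ (fun x => f x * planeWave ξ ζ x) x *
        kernelIter h t j (coshDist g x)) +
      ∫ x, (ξ ^ 2 * α x + ζ ^ 2 * γ x) * f x * planeWave ξ ζ x *
        kernelIter h t j (coshDist g x) := by
    rw [← integral_add i3 i4]
    refine integral_congr_ae (Filter.Eventually.of_forall fun x => ?_)
    simp only
    rw [formalAdjoint_mul_planeWave hop.contDiff_α hop.contDiff_γ hop.contDiff_β hop.contDiff_δ hf]
    ring
  have e4 : oscIntegral h t g ξ ζ
      (fun x => (ξ ^ 2 * α x + ζ ^ 2 * γ x - η x * (t ^ 2 + 1 / 4)) * f x) j =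
      (∫ x, (ξ ^ 2 * α x + ζ ^ 2 * γ x) * f x * planeWave ξ ζ x *
        kernelIter h t j (coshDist g x)) -
      ∫ x, ((t ^ 2 + 1 / 4) * (η x * f x)) * planeWave ξ ζ x *
        kernelIter h t j (coshDist g x) := by
    rw [← integral_sub i4 i2]
    refine integral_congr_ae (Filter.Eventually.of_forall fun x => ?_)
    simp only
    ring
  rw [e3, e4, oscIntegral]
  change _ = ∫ x, formalAdjoint α γ β δ (fun x => f x * planeWave ξ ζ x) x *
    kernelIter h t j (coshDist g x) at key
  rw [← key]
  ring

lemma norm_oscIntegral_le {h : 𝓢(ℝ, ℝ)} {t : ℝ} {g : SL(2, ℝ)} {ξ ζ : ℝ} {f : ℝ × ℝ → ℂ} {j : ℕ}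
    (hf0 : ∀ x ∉ unitSquare, f x = 0) {M B : ℝ} (hM : ∀ x ∈ unitSquare, ‖f x‖ ≤ M)
    (hB : ∀ w, 1 ≤ w → ‖kernelIter h t j w‖ ≤ B) :
    ‖oscIntegral h t g ξ ζ f j‖ ≤ M * B * (volume : Measure (ℝ × ℝ)).real unitSquare := by
  have h0 : oscIntegral h t g ξ ζ f j =
      ∫ x in unitSquare, f x * planeWave ξ ζ x * kernelIter h t j (coshDist g x) :=
    (setIntegral_eq_integral_of_forall_compl_eq_zero fun x hx => by simp [hf0 x hx]).symm
  rw [h0]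
  refine norm_setIntegral_le_of_norm_le_const isCompact_unitSquare.measure_lt_top fun x hx => ?_
  rw [norm_mul, norm_mul, norm_planeWave, mul_one]
  have h1 := hM x hx
  have h2 := hB _ (one_le_coshDist g x)
  have h3 := (norm_nonneg _).trans h1
  gcongr

/-! ### Repeated integration by parts, uniformly in the parameters. -/

/-- The parameters of an oscillatory integral. -/
structure OscParams where
  g : SL(2, ℝ)
  t : ℝ
  β : ℝ
  ξ : ℝ
  ζ : ℝ

/-- The squared size of the off-diagonal part of `g`. -/
def offDiag (g : SL(2, ℝ)) : ℝ := g 0 1 ^ 2 + g 1 0 ^ 2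

lemma offDiag_nonneg (g : SL(2, ℝ)) : 0 ≤ offDiag g := by unfold offDiag; positivity

/-- The conditions under which the oscillatory integrals are negligible. -/
structure OscParams.Admissible (h : 𝓢(ℝ, ℝ)) (c ε R : ℝ) (p : OscParams) : Prop where
  one_le_β : 1 ≤ p.β
  β_le : p.β ≤ p.t / 2
  exists_kernel : ∃ k, IsSpectralKernel h p.t k
  ξ_near : |p.ξ - p.t| ≤ p.β
  ζ_small : |p.ζ| ≤ p.β
  le_offDiag : c * p.t ^ (-1 + 2 * ε) * p.β ≤ offDiag p.g
  entry_le : ∀ i j, |p.g i j| ≤ R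

namespace OscParams.Admissible

variable {h : 𝓢(ℝ, ℝ)} {c ε R : ℝ} {p : OscParams}

lemma two_le_t (hp : p.Admissible h c ε R) : 2 ≤ p.t := by
  linarith [hp.one_le_β, hp.β_le]

lemma rpow_pos (hp : p.Admissible h c ε R) (s : ℝ) : 0 < p.t ^ s :=
  Real.rpow_pos_of_pos (by linarith [hp.two_le_t]) s

lemma le_mul_offDiag (hp : p.Admissible h c ε R) :
    c * p.t ^ (2 * ε) * p.β ≤ p.t * offDiag p.g := by
  have ht := hp.two_le_t
  have h1 := mul_le_mul_of_nonneg_left hp.le_offDiag (by linarith : (0 : ℝ) ≤ p.t)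
  have h2 : p.t ^ (2 * ε) = p.t * p.t ^ (-1 + 2 * ε) := by
    rw [Real.rpow_add (by linarith), Real.rpow_neg_one]
    field_simp
  rw [h2]
  linarith

lemma offDiag_pos (hp : p.Admissible h c ε R) (hc : 0 < c) : 0 < offDiag p.g := by
  have := hp.rpow_pos (-1 + 2 * ε)
  have := hp.one_le_β
  refine lt_of_lt_of_le ?_ hp.le_offDiag
  positivity

/-- The gain in one integration by parts. -/
lemma inv_scale (hp : p.Admissible h c ε R) (hc : 0 < c) :
    p.t ^ (2 * ε) / (p.t * offDiag p.g) ≤ 1 / c / p.β := by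
  have h1 := hp.le_mul_offDiag
  have h2 := hp.offDiag_pos hc
  have h3 := hp.two_le_t
  have h4 := hp.one_le_β
  rw [div_div, div_le_div_iff₀ (by positivity) (by positivity)]
  linarith

lemma inv_t_mul_offDiag (hp : p.Admissible h c ε R) (hc : 0 < c) (hε : 0 < ε) :
    1 / (p.t * offDiag p.g) ≤ 1 / c / p.β := by
  refine le_trans ?_ (hp.inv_scale hc)
  have h2 := hp.offDiag_pos hc
  have h3 := hp.two_le_t
  gcongr
  exact Real.one_le_rpow (by linarith) (by linarith)

lemma abs_ξ_le (hp : p.Admissible h c ε R) : |p.ξ| ≤ 2 * p.t := by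
  have h1 := abs_le.1 hp.ξ_near
  have h2 := hp.β_le
  have h3 := hp.two_le_t
  rw [abs_le]
  constructor <;> linarith

end OscParams.Admissible

lemma IsSymbol.dirDeriv_dirDeriv {ι : Type*} {f : ι → ℝ × ℝ → ℂ} (hf : IsSymbol f) (v : ℝ × ℝ) :
    IsSymbol fun i => GeodesicPeriod.dirDeriv v (GeodesicPeriod.dirDeriv v (f i)) :=
  (hf.dirDeriv v).dirDeriv v

/-- `conjLower`, for coefficients `γ` and `δ` divided by `n`, and rescaled. -/
def scaledLower (s n ξ ζ : ℝ) (α γ β δ : ℝ × ℝ → ℝ) (f : ℝ × ℝ → ℂ) (x : ℝ × ℝ) : ℂ :=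
  (s : ℂ) * dirDeriv diffDir (dirDeriv diffDir fun x => α x * f x) x +
    2 * Complex.I * ((s * ξ : ℝ) : ℂ) * dirDeriv diffDir (fun x => α x * f x) x +
    ((s / n : ℝ) : ℂ) * dirDeriv sumDir (dirDeriv sumDir fun x => γ x * f x) x +
    2 * Complex.I * ((s / n * ζ : ℝ) : ℂ) * dirDeriv sumDir (fun x => γ x * f x) x -
    (s : ℂ) * dirDeriv diffDir (fun x => β x * f x) x -
    Complex.I * ((s * ξ : ℝ) : ℂ) * (β x * f x) -
    ((s / n : ℝ) : ℂ) * dirDeriv sumDir (fun x => δ x * f x) x -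
    Complex.I * ((s / n * ζ : ℝ) : ℂ) * (δ x * f x)

/-- The dangerous divisions by $n$ are pulled out of the derivatives, so that only the scalars $s$,
$s\xi$, $s/n$, $s\zeta/n$ need bounding. -/
lemma scaledLower_eq {s n ξ ζ : ℝ} {α γ β δ : ℝ × ℝ → ℝ} {f : ℝ × ℝ → ℂ}
    (hγ : ContDiff ℝ ∞ γ) (hδ : ContDiff ℝ ∞ δ) (hf : ContDiff ℝ ∞ f) (x : ℝ × ℝ) :
    scaledLower s n ξ ζ α γ β δ f x =
      s * conjLower ξ ζ α (fun x => γ x / n) β (fun x => δ x / n) f x := by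
  have e1 (a : ℝ × ℝ → ℝ) : (fun x => ((a x / n : ℝ) : ℂ) * f x) =
      fun x => ((n : ℂ)⁻¹) * (a x * f x) := by
    ext x
    push_cast
    ring
  have pγ := hγ.ofReal_mul hf
  have pδ := hδ.ofReal_mul hf
  rw [scaledLower, conjLower, e1 γ, e1 δ, dirDeriv_const_mul pγ, dirDeriv_const_mul pδ,
    dirDeriv_const_mul (pγ.dirDeriv _)]
  push_cast
  ring

lemma scaledLower_eq_zero {s n ξ ζ : ℝ} {α γ β δ : ℝ × ℝ → ℝ} {f : ℝ × ℝ → ℂ}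
    (hf : ∀ x ∉ unitSquare, f x = 0) :
    ∀ x ∉ unitSquare, scaledLower s n ξ ζ α γ β δ f x = 0 := by
  intro x hx
  have h1 (a : ℝ × ℝ → ℝ) : ∀ x ∉ unitSquare, (a x : ℂ) * f x = 0 := fun x hx => by
    rw [hf x hx, mul_zero]
  have h2 (a v) := dirDeriv_eq_zero (h1 a) v x hx
  have h3 (a v) := dirDeriv_eq_zero (dirDeriv_eq_zero (h1 a) v) v x hx
  simp only [scaledLower, h1 _ x hx, h2, h3]
  simp

lemma isSymbol_scaledLower {ι : Type*} {s n ξ ζ : ι → ℝ} {α γ β δ : ι → ℝ × ℝ → ℝ}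
    {f : ι → ℝ × ℝ → ℂ} (hα : IsSymbol α) (hγ : IsSymbol γ) (hβ : IsSymbol β) (hδ : IsSymbol δ)
    (hf : IsSymbol f) {B : ℝ} (h1 : ∀ i, |s i| ≤ B) (h2 : ∀ i, |s i * ξ i| ≤ B)
    (h3 : ∀ i, |s i / n i| ≤ B) (h4 : ∀ i, |s i / n i * ζ i| ≤ B) :
    IsSymbol fun i => scaledLower (s i) (n i) (ξ i) (ζ i) (α i) (γ i) (β i) (δ i) (f i) := by
  have c {r : ι → ℝ} (hr : ∀ i, |r i| ≤ B) : ∃ C, ∀ i, ‖((r i : ℝ) : ℂ)‖ ≤ C :=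
    ⟨B, fun i => by rw [Complex.norm_real]; exact hr i⟩
  have c' {r : ι → ℝ} (hr : ∀ i, |r i| ≤ B) : ∃ C, ∀ i, ‖Complex.I * ((r i : ℝ) : ℂ)‖ ≤ C :=
    ⟨B, fun i => by rw [norm_mul, Complex.norm_I, one_mul, Complex.norm_real]; exact hr i⟩
  have c'' {r : ι → ℝ} (hr : ∀ i, |r i| ≤ B) : ∃ C, ∀ i, ‖2 * Complex.I * ((r i : ℝ) : ℂ)‖ ≤ C :=
    ⟨2 * B, fun i => by
      rw [norm_mul, norm_mul, Complex.norm_I, mul_one, Complex.norm_real]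
      norm_num
      exact hr i⟩
  have pα := hα.ofReal.mul hf
  have pγ := hγ.ofReal.mul hf
  have pβ := hβ.ofReal.mul hf
  have pδ := hδ.ofReal.mul hf
  exact (((((((((pα.dirDeriv_dirDeriv diffDir).const_mul (c h1)).add
    ((pα.dirDeriv diffDir).const_mul (c'' h2))).add
    ((pγ.dirDeriv_dirDeriv sumDir).const_mul (c h3))).add
    ((pγ.dirDeriv sumDir).const_mul (c'' h4))).sub
    ((pβ.dirDeriv diffDir).const_mul (c h1))).sub
    (pβ.const_mul (c' h2))).sub ((pδ.dirDeriv sumDir).const_mul (c h3))).sub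
    (pδ.const_mul (c' h4)))

/-- The amplitude matters only where the kernel lives, so the symbol has to be inverted only where
$c\le\cosh1$. -/
lemma oscIntegral_congr {h : 𝓢(ℝ, ℝ)} {t : ℝ} {g : SL(2, ℝ)} {ξ ζ : ℝ} {f₁ f₂ : ℝ × ℝ → ℂ} {j : ℕ}
    (hj : ∀ w, Real.cosh 1 < w → kernelIter h t j w = 0)
    (hf : ∀ x, coshDist g x ≤ Real.cosh 1 → f₁ x = f₂ x) :
    oscIntegral h t g ξ ζ f₁ j = oscIntegral h t g ξ ζ f₂ j := by
  refine integral_congr_ae (Filter.Eventually.of_forall fun x => ?_)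
  rcases le_or_gt (coshDist g x) (Real.cosh 1) with hx | hx
  · simp only [hf x hx]
  · simp only [hj _ hx, mul_zero]

lemma oscIntegral_const_mul {h : 𝓢(ℝ, ℝ)} {t : ℝ} {g : SL(2, ℝ)} {ξ ζ : ℝ} (a : ℂ)
    (f : ℝ × ℝ → ℂ) (j : ℕ) :
    oscIntegral h t g ξ ζ (fun x => a * f x) j = a * oscIntegral h t g ξ ζ f j := by
  rw [oscIntegral, oscIntegral, ← integral_const_mul]
  simp only [mul_assoc]

/-- Repeated integration by parts. -/
lemma exists_norm_oscIntegral_le {h : 𝓢(ℝ, ℝ)} (hh : IsAdmissible h) {c ε R : ℝ} (hc : 0 < c)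
    (hε : 0 < ε) {ι : Type*} {p : ι → OscParams} (hp : ∀ i, (p i).Admissible h c ε R)
    {α γ β δ η σ : ι → ℝ × ℝ → ℝ} (hα : IsSymbol α) (hγ : IsSymbol γ) (hβ : IsSymbol β)
    (hδ : IsSymbol δ) (hη : IsSymbol η) (hσ : IsSymbol σ)
    (hop : ∀ i, IsRadialOperator (coshDist (p i).g) (α i) (fun x => γ i x / offDiag (p i).g)
      (β i) (fun x => δ i x / offDiag (p i).g) (η i))
    (hσ_eq : ∀ i x, (p i).t ^ 2 * offDiag (p i).g * σ i x = (p i).ξ ^ 2 * α i x +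
      (p i).ζ ^ 2 * (γ i x / offDiag (p i).g) - η i x * ((p i).t ^ 2 + 1 / 4))
    {θ : ℝ} (hθ : 0 < θ)
    (hσθ : ∀ i, ∀ x ∈ unitSquare, coshDist (p i).g x ≤ Real.cosh 1 → θ ≤ σ i x) (N : ℕ) :
    ∀ (j : ℕ) (f : ι → ℝ × ℝ → ℂ), IsSymbol f → (∀ i, ∀ x ∉ unitSquare, f i x = 0) →
      ∃ C : ℝ, 0 ≤ C ∧ ∀ i, ‖oscIntegral h (p i).t (p i).g (p i).ξ (p i).ζ (f i) j‖ ≤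
        C * (p i).t ^ (j + 2) * ((p i).t ^ (-(2 * ε))) ^ N := by
  -- The induction runs over all $j$ and all amplitude families at once: one step replaces $(f,j)$
  -- by $(\eta\Phi,j+1)$ and $(Q,j)$.
  induction N with
  | zero =>
    intro j f hf hf0
    obtain ⟨M, hM⟩ := hf.exists_norm_le
    obtain ⟨B, hB0, hB⟩ := exists_norm_kernelIter_le hh j
    refine ⟨max M 0 * B * (volume : Measure (ℝ × ℝ)).real unitSquare, by positivity, fun i => ?_⟩
    obtain ⟨k, hk⟩ := (hp i).exists_kernel
    have ht := (hp i).two_le_t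
    refine (norm_oscIntegral_le (hf0 i) (fun x hx => (hM i x hx).trans (le_max_left M 0))
      (hB (p i).t (by linarith) k hk)).trans_eq ?_
    ring
  | succ N ih =>
    intro j f hf hf0
    -- This is $f/\sigma$ wherever $\sigma\ge\theta$. The globally smooth substitute for the
    -- reciprocal keeps it a symbol where $\sigma$ has no lower bound.
    set Φ : ι → ℝ × ℝ → ℂ := fun i x =>
      ((1 / θ * smoothInv (1 / θ * σ i x) : ℝ) : ℂ) * f i x with hΦ
    have hΦs : IsSymbol Φ := by
      have hθc : ∃ C, ∀ _ : ι, ‖1 / θ‖ ≤ C := ⟨_, fun _ => le_rfl⟩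
      exact IsSymbol.mul (((hσ.const_mul hθc).comp contDiff_smoothInv).const_mul hθc).ofReal hf
    have hΦ0 : ∀ i, ∀ x ∉ unitSquare, Φ i x = 0 := fun i x hx => by
      simp only [hΦ, hf0 i x hx, mul_zero]
    have hσΦ : ∀ i x, coshDist (p i).g x ≤ Real.cosh 1 → f i x = σ i x * Φ i x := by
      intro i x hx
      by_cases hxK : x ∈ unitSquare
      · have h1 := hσθ i x hxK hx
        have h2 : 0 < σ i x := hθ.trans_le h1
        simp only [hΦ]
        rw [smoothInv_of_one_le (by rw [one_div_mul_eq_div]; exact (one_le_div hθ).2 h1),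
          ← mul_assoc, ← Complex.ofReal_mul]
        rw [show σ i x * (1 / θ * (1 / (1 / θ * σ i x))) = 1 by field_simp]
        simp
      · rw [hf0 i x hxK, hΦ0 i x hxK, mul_zero]
    -- The normalisation is $s\,t^{-2\varepsilon}=1/(t^2n)$: the gain $t^{-2\varepsilon}$ is set
    -- aside, and $s$ is still small enough to bound both the lower-order amplitude and $ts$.
    set s : ι → ℝ := fun i => (p i).t ^ (2 * ε) / ((p i).t ^ 2 * offDiag (p i).g) with hs
    have hn (i : ι) := (hp i).offDiag_pos hc
    have ht (i : ι) := (hp i).two_le_t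
    have hts (i : ι) : (p i).t * s i ≤ 1 / c / (p i).β := by
      refine le_trans (le_of_eq ?_) ((hp i).inv_scale hc)
      have := hn i
      have := ht i
      simp only [hs]
      field_simp
    have hβ1 (i : ι) := (hp i).one_le_β
    have hs0 (i : ι) : 0 ≤ s i := by
      have := hn i
      have := ht i
      have := (hp i).rpow_pos (2 * ε)
      simp only [hs]
      positivity
    have hcc : 0 < 1 / c := by positivity
    have hcβ (i : ι) : 1 / c / (p i).β ≤ 1 / c := div_le_self hcc.le (hβ1 i)
    set B := 1 / c + 2 * (1 / c) + (1 / c) * (1 / c)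
    have hsB (i : ι) : s i ≤ 1 / c := by
      have := ht i
      have := hs0 i
      have := hts i
      have := hcβ i
      nlinarith
    -- The loss $\beta/n$ from the $x_1+x_2$ direction is paid by using the lower bound for $tn$
    -- twice, which leaves a spare factor $1/\beta$.
    have hsn (i : ι) : s i / offDiag (p i).g * (p i).β ≤ (1 / c) * (1 / c) := by
      have h1 := hts i
      have h2 := (hp i).inv_t_mul_offDiag hc hε
      have h3 := hn i
      have h4 := ht i
      have h5 := hβ1 i
      calc s i / offDiag (p i).g * (p i).β
          = ((p i).t * s i) * (1 / ((p i).t * offDiag (p i).g)) * (p i).β := by field_simp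
        _ ≤ (1 / c / (p i).β) * (1 / c / (p i).β) * (p i).β := by
            have := hs0 i
            gcongr
        _ = (1 / c) * (1 / c) / (p i).β := by field_simp
        _ ≤ _ := div_le_self (by positivity) h5
    have hb1 (i : ι) : |s i| ≤ B := by
      rw [abs_of_nonneg (hs0 i)]
      have := hsB i
      have : 0 ≤ (1 / c) * (1 / c) := by positivity
      simp only [B]
      linarith
    have hb2 (i : ι) : |s i * (p i).ξ| ≤ B := by
      rw [abs_mul, abs_of_nonneg (hs0 i)]
      have h1 := mul_le_mul_of_nonneg_left (hp i).abs_ξ_le (hs0 i)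
      have h2 := hts i
      have h3 := hcβ i
      have : 0 ≤ (1 / c) * (1 / c) := by positivity
      simp only [B]
      linarith
    have hb3' (i : ι) : s i / offDiag (p i).g ≤ (1 / c) * (1 / c) := by
      refine le_trans ?_ (hsn i)
      exact le_mul_of_one_le_right (div_nonneg (hs0 i) (hn i).le) (hβ1 i)
    have hb3 (i : ι) : |s i / offDiag (p i).g| ≤ B := by
      rw [abs_of_nonneg (div_nonneg (hs0 i) (hn i).le)]
      have := hb3' i
      simp only [B]
      linarith
    have hb4 (i : ι) : |s i / offDiag (p i).g * (p i).ζ| ≤ B := by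
      rw [abs_mul, abs_of_nonneg (div_nonneg (hs0 i) (hn i).le)]
      have h1 := mul_le_mul_of_nonneg_left (hp i).ζ_small (div_nonneg (hs0 i) (hn i).le)
      have h2 := hsn i
      simp only [B]
      linarith
    set Q : ι → ℝ × ℝ → ℂ := fun i => scaledLower (s i) (offDiag (p i).g) (p i).ξ (p i).ζ
      (α i) (γ i) (β i) (δ i) (Φ i) with hQ
    have hQs : IsSymbol Q := isSymbol_scaledLower hα hγ hβ hδ hΦs hb1 hb2 hb3 hb4
    obtain ⟨C₁, hC₁0, hC₁⟩ := ih (j + 1) (fun i x => η i x * Φ i x) (hη.ofReal.mul hΦs)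
      fun i x hx => by rw [hΦ0 i x hx, mul_zero]
    obtain ⟨C₂, hC₂0, hC₂⟩ := ih j Q hQs fun i => scaledLower_eq_zero (hΦ0 i)
    refine ⟨1 / c * C₁ + C₂, by positivity, fun i => ?_⟩
    obtain ⟨k, hk⟩ := (hp i).exists_kernel
    have ht1 : 1 ≤ (p i).t := by linarith [ht i]
    have hρ := (hp i).rpow_pos (-(2 * ε))
    set ρ := (p i).t ^ (-(2 * ε)) with hρdef
    have hsρ : s i * ρ * ((p i).t ^ 2 * offDiag (p i).g) = 1 := by
      have h1 := hn i
      have h2 := ht i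
      have h3 : (p i).t ^ (2 * ε) * ρ = 1 := by
        rw [hρdef, ← Real.rpow_add (by linarith), add_neg_cancel, Real.rpow_zero]
      simp only [hs]
      field_simp
      linarith
    have hΦc : HasCompactSupport (Φ i) :=
      HasCompactSupport.intro isCompact_unitSquare (hΦ0 i)
    have key := oscIntegral_by_parts hh ht1 hk (hop i) (p i).ξ (p i).ζ (hΦs.contDiff i) hΦc j
    have e1 : oscIntegral h (p i).t (p i).g (p i).ξ (p i).ζ (f i) j =
        ((s i * ρ : ℝ) : ℂ) * oscIntegral h (p i).t (p i).g (p i).ξ (p i).ζ (fun x =>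
          ((p i).ξ ^ 2 * α i x + (p i).ζ ^ 2 * ((γ i x / offDiag (p i).g : ℝ) : ℂ) -
            η i x * ((p i).t ^ 2 + 1 / 4)) * Φ i x) j := by
      rw [← oscIntegral_const_mul]
      refine oscIntegral_congr
        (fun w hw => (isProfile_abelIter hh ht1 hk j).invAbel_eq_zero hw) fun x hx => ?_
      rw [hσΦ i x hx]
      have h1 := congrArg (fun y : ℝ => (y : ℂ)) (hσ_eq i x)
      have h2 := congrArg (fun y : ℝ => (y : ℂ)) hsρ
      push_cast at h1 h2
      push_cast
      rw [← h1]
      linear_combination (-(σ i x * Φ i x) : ℂ) * h2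
    have e2 : oscIntegral h (p i).t (p i).g (p i).ξ (p i).ζ (Q i) j = (s i : ℂ) *
        oscIntegral h (p i).t (p i).g (p i).ξ (p i).ζ (conjLower (p i).ξ (p i).ζ (α i)
          (fun x => γ i x / offDiag (p i).g) (β i) (fun x => δ i x / offDiag (p i).g) (Φ i)) j := by
      rw [← oscIntegral_const_mul]
      congr 1
      ext x
      exact scaledLower_eq (hγ.contDiff i) (hδ.contDiff i) (hΦs.contDiff i) x
    rw [e1, key]
    have e3 : ((s i * ρ : ℝ) : ℂ) * (-oscIntegral h (p i).t (p i).g (p i).ξ (p i).ζ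
        (fun x => η i x * Φ i x) (j + 1) + oscIntegral h (p i).t (p i).g (p i).ξ (p i).ζ
        (conjLower (p i).ξ (p i).ζ (α i) (fun x => γ i x / offDiag (p i).g) (β i)
          (fun x => δ i x / offDiag (p i).g) (Φ i)) j) =
        (ρ : ℂ) * (-((s i : ℂ) * oscIntegral h (p i).t (p i).g (p i).ξ (p i).ζ
          (fun x => η i x * Φ i x) (j + 1)) +
          oscIntegral h (p i).t (p i).g (p i).ξ (p i).ζ (Q i) j) := by
      rw [e2]
      push_cast
      ring
    rw [e3, norm_mul, Complex.norm_real, Real.norm_of_nonneg hρ.le]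
    have b1 := hC₁ i
    have b2 := hC₂ i
    -- The next iterate is larger by a factor $t$, which $s$ absorbs.
    have hT : (p i).t * s i ≤ 1 / c := (hts i).trans (hcβ i)
    have hpow : 0 ≤ (p i).t ^ (j + 2) * ρ ^ N := by positivity
    calc ρ * ‖-((s i : ℂ) * oscIntegral h (p i).t (p i).g (p i).ξ (p i).ζ
          (fun x => η i x * Φ i x) (j + 1)) +
          oscIntegral h (p i).t (p i).g (p i).ξ (p i).ζ (Q i) j‖
        ≤ ρ * (s i * (C₁ * (p i).t ^ (j + 1 + 2) * ρ ^ N) + C₂ * (p i).t ^ (j + 2) * ρ ^ N) := by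
          gcongr
          refine (norm_add_le _ _).trans (add_le_add ?_ b2)
          rw [norm_neg, norm_mul, Complex.norm_real, Real.norm_of_nonneg (hs0 i)]
          exact mul_le_mul_of_nonneg_left b1 (hs0 i)
      _ = ρ * (((p i).t * s i) * (C₁ * ((p i).t ^ (j + 2) * ρ ^ N)) +
            C₂ * (p i).t ^ (j + 2) * ρ ^ N) := by ring
      _ ≤ ρ * ((1 / c) * (C₁ * ((p i).t ^ (j + 2) * ρ ^ N)) +
            C₂ * (p i).t ^ (j + 2) * ρ ^ N) := by gcongr
      _ = _ := by ring

/-! ### Explicit radial operators in three ranges of $g_{01}g_{10}$. -/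

/-- A linear combination of the exponentials of `±(x₁ - x₂)` and `±(x₁ + x₂)`. -/
def expComb (u v w z : ℝ) (x : ℝ × ℝ) : ℝ :=
  u * Real.exp (-(x.1 - x.2)) + v * Real.exp (x.1 - x.2) + w * Real.exp (-(x.1 + x.2)) +
    z * Real.exp (x.1 + x.2)

lemma dirDeriv_expComb (u v w z : ℝ) (d : ℝ × ℝ) :
    dirDeriv d (expComb u v w z) = expComb (-(d.1 - d.2) * u) ((d.1 - d.2) * v)
      (-(d.1 + d.2) * w) ((d.1 + d.2) * z) := by
  ext x
  have h1 : HasFDerivAt (fun x : ℝ × ℝ => x.1 - x.2)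
      (ContinuousLinearMap.fst ℝ ℝ ℝ - ContinuousLinearMap.snd ℝ ℝ ℝ) x :=
    hasFDerivAt_fst.sub hasFDerivAt_snd
  have h2 : HasFDerivAt (fun x : ℝ × ℝ => x.1 + x.2)
      (ContinuousLinearMap.fst ℝ ℝ ℝ + ContinuousLinearMap.snd ℝ ℝ ℝ) x :=
    hasFDerivAt_fst.add hasFDerivAt_snd
  have h3 := (((h1.neg.exp.const_mul u).add (h1.exp.const_mul v)).add
    (h2.neg.exp.const_mul w)).add (h2.exp.const_mul z)
  have h4 : fderiv ℝ (expComb u v w z) x = _ := h3.fderiv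
  rw [dirDeriv, h4]
  simp [expComb]
  ring

lemma dirDeriv_diffDir_expComb (u v w z : ℝ) :
    dirDeriv diffDir (expComb u v w z) = expComb (-u) v 0 0 := by
  rw [dirDeriv_expComb]
  norm_num [diffDir]

lemma dirDeriv_sumDir_expComb (u v w z : ℝ) :
    dirDeriv sumDir (expComb u v w z) = expComb 0 0 (-w) z := by
  rw [dirDeriv_expComb]
  norm_num [sumDir]

lemma coshDist_eq_expComb (g : SL(2, ℝ)) : coshDist g =
    expComb (g 0 0 ^ 2 / 2) (g 1 1 ^ 2 / 2) (g 0 1 ^ 2 / 2) (g 1 0 ^ 2 / 2) := by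
  ext x
  rw [coshDist, expComb]
  ring

/-- Twice the part of `coshDist` depending on `x₁ - x₂`. -/
def diffPart (g : SL(2, ℝ)) : ℝ × ℝ → ℝ := expComb (g 0 0 ^ 2) (g 1 1 ^ 2) 0 0

/-- The derivative of `diffPart`. -/
def diffPart' (g : SL(2, ℝ)) : ℝ × ℝ → ℝ := expComb (-g 0 0 ^ 2) (g 1 1 ^ 2) 0 0

/-- Twice the part of `coshDist` depending on `x₁ + x₂`. -/
def sumPart (g : SL(2, ℝ)) : ℝ × ℝ → ℝ := expComb 0 0 (g 0 1 ^ 2) (g 1 0 ^ 2)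

/-- The derivative of `sumPart`. -/
def sumPart' (g : SL(2, ℝ)) : ℝ × ℝ → ℝ := expComb 0 0 (-g 0 1 ^ 2) (g 1 0 ^ 2)

/-- The product of the off-diagonal entries. -/
def offProd (g : SL(2, ℝ)) : ℝ := g 0 1 * g 1 0

lemma coshDist_eq (g : SL(2, ℝ)) (x : ℝ × ℝ) : coshDist g x = (diffPart g x + sumPart g x) / 2 := by
  rw [coshDist, diffPart, sumPart, expComb, expComb]
  ring

lemma dirDeriv_diffDir_coshDist (g : SL(2, ℝ)) (x : ℝ × ℝ) :
    dirDeriv diffDir (coshDist g) x = diffPart' g x / 2 := by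
  rw [coshDist_eq_expComb, dirDeriv_diffDir_expComb, diffPart', expComb, expComb]
  ring

lemma dirDeriv_sumDir_coshDist (g : SL(2, ℝ)) (x : ℝ × ℝ) :
    dirDeriv sumDir (coshDist g) x = sumPart' g x / 2 := by
  rw [coshDist_eq_expComb, dirDeriv_sumDir_expComb, sumPart', expComb, expComb]
  ring

lemma dirDeriv_diffDir_diffDir_coshDist (g : SL(2, ℝ)) (x : ℝ × ℝ) :
    dirDeriv diffDir (dirDeriv diffDir (coshDist g)) x = diffPart g x / 2 := by
  rw [coshDist_eq_expComb, dirDeriv_diffDir_expComb, dirDeriv_diffDir_expComb, diffPart, expComb,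
    expComb]
  ring

lemma dirDeriv_sumDir_sumDir_coshDist (g : SL(2, ℝ)) (x : ℝ × ℝ) :
    dirDeriv sumDir (dirDeriv sumDir (coshDist g)) x = sumPart g x / 2 := by
  rw [coshDist_eq_expComb, dirDeriv_sumDir_expComb, dirDeriv_sumDir_expComb, sumPart, expComb,
    expComb]
  ring

/-- Below, $A$ and $B$ denote the parts of $2c$ depending on $x_1-x_2$ and $x_1+x_2$, primes their
derivatives, and $E=g_{01}g_{10}$. The constant comes from $e^ue^{-u}=1$ and $g_{00}g_{11}=1+E$.
This relation and its analogue for $B$ make the search for radial operators algebraic. -/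
lemma diffPart'_sq (g : SL(2, ℝ)) (x : ℝ × ℝ) :
    diffPart' g x ^ 2 = diffPart g x ^ 2 - 4 * (1 + offProd g) ^ 2 := by
  have h1 : Real.exp (-(x.1 - x.2)) * Real.exp (x.1 - x.2) = 1 := by rw [← Real.exp_add]; simp
  have h2 : g 0 0 * g 1 1 = 1 + offProd g := by
    have := det_eq g
    rw [offProd]
    linarith
  rw [diffPart', diffPart, expComb, expComb, ← h2]
  linear_combination (-4 * g 0 0 ^ 2 * g 1 1 ^ 2) * h1

lemma sumPart'_sq (g : SL(2, ℝ)) (x : ℝ × ℝ) :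
    sumPart' g x ^ 2 = sumPart g x ^ 2 - 4 * offProd g ^ 2 := by
  have h1 : Real.exp (-(x.1 + x.2)) * Real.exp (x.1 + x.2) = 1 := by rw [← Real.exp_add]; simp
  rw [sumPart', sumPart, expComb, expComb, offProd]
  linear_combination (-4 * g 0 1 ^ 2 * g 1 0 ^ 2) * h1

lemma diffPart_nonneg (g : SL(2, ℝ)) (x : ℝ × ℝ) : 0 ≤ diffPart g x := by
  rw [diffPart, expComb]
  positivity

lemma sumPart_nonneg (g : SL(2, ℝ)) (x : ℝ × ℝ) : 0 ≤ sumPart g x := by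
  rw [sumPart, expComb]
  positivity

lemma le_diffPart (g : SL(2, ℝ)) (x : ℝ × ℝ) : 2 * (1 + offProd g) ≤ diffPart g x := by
  have h1 := diffPart'_sq g x
  have h2 := diffPart_nonneg g x
  exact le_of_sq_le_sq (by nlinarith [sq_nonneg (diffPart' g x)]) h2

lemma abs_le_sumPart (g : SL(2, ℝ)) (x : ℝ × ℝ) : 2 * |offProd g| ≤ sumPart g x := by
  have h1 := sumPart'_sq g x
  have h2 := sumPart_nonneg g x
  exact le_of_sq_le_sq (by nlinarith [sq_nonneg (sumPart' g x), sq_abs (offProd g)]) h2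

lemma offDiag_le_sumPart (g : SL(2, ℝ)) {x : ℝ × ℝ} (hx : x ∈ unitSquare) :
    Real.exp (-2) * offDiag g ≤ sumPart g x := by
  obtain ⟨⟨h1, h2⟩, h3, h4⟩ := hx
  have e1 : Real.exp (-2) ≤ Real.exp (-(x.1 + x.2)) := Real.exp_le_exp.2 (by linarith)
  have e2 : Real.exp (-2) ≤ Real.exp (x.1 + x.2) := Real.exp_le_exp.2 (by linarith)
  have m1 := mul_le_mul_of_nonneg_left e1 (sq_nonneg (g 0 1))
  have m2 := mul_le_mul_of_nonneg_left e2 (sq_nonneg (g 1 0))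
  rw [sumPart, expComb, offDiag]
  linarith

lemma abs_offProd_le (g : SL(2, ℝ)) : 2 * |offProd g| ≤ offDiag g := by
  rw [offProd, offDiag, abs_mul]
  nlinarith [sq_nonneg (|g 0 1| - |g 1 0|), sq_abs (g 0 1), sq_abs (g 1 0)]

/-- The defining conditions rewritten in $A$, $B$, $A'$, $B'$, with $2c=A+B$, so that verifying an
operator becomes a polynomial identity. -/
lemma isRadialOperator_of_identities {g : SL(2, ℝ)} {α γ β δ η : ℝ × ℝ → ℝ}
    (hα : ContDiff ℝ ∞ α) (hγ : ContDiff ℝ ∞ γ) (hβ : ContDiff ℝ ∞ β) (hδ : ContDiff ℝ ∞ δ)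
    (hη : ContDiff ℝ ∞ η)
    (h₁ : ∀ x, α x * diffPart' g x ^ 2 + γ x * sumPart' g x ^ 2 =
      η x * ((diffPart g x + sumPart g x) ^ 2 - 4))
    (h₂ : ∀ x, α x * diffPart g x + γ x * sumPart g x + β x * diffPart' g x + δ x * sumPart' g x =
      2 * η x * (diffPart g x + sumPart g x)) :
    IsRadialOperator (coshDist g) α γ β δ η where
  contDiff_α := hα
  contDiff_γ := hγ
  contDiff_β := hβ
  contDiff_δ := hδ
  contDiff_η := hη
  symbol x := by
    rw [dirDeriv_diffDir_coshDist, dirDeriv_sumDir_coshDist, coshDist_eq]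
    linear_combination h₁ x / 4
  first_order x := by
    rw [dirDeriv_diffDir_diffDir_coshDist, dirDeriv_sumDir_sumDir_coshDist,
      dirDeriv_diffDir_coshDist, dirDeriv_sumDir_coshDist, coshDist_eq]
    linear_combination h₂ x / 2

lemma IsSymbol.comp_index {ι κ F : Type*} [NormedAddCommGroup F] [NormedSpace ℝ F]
    {f : ι → ℝ × ℝ → F} (hf : IsSymbol f) (e : κ → ι) : IsSymbol fun i => f (e i) where
  contDiff i := hf.contDiff (e i)
  bounded n := by
    obtain ⟨C, hC⟩ := hf.bounded n
    exact ⟨C, fun i => hC (e i)⟩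

namespace OscParams.Admissible

variable {h : 𝓢(ℝ, ℝ)} {c ε R : ℝ} {p : OscParams}

lemma inv_t_mul_offDiag_le (hp : p.Admissible h c ε R) (hc : 0 < c) :
    p.β / (p.t * offDiag p.g) ≤ 1 / c / p.t ^ (2 * ε) := by
  have h1 := hp.le_mul_offDiag
  have h2 := hp.offDiag_pos hc
  have h3 := hp.two_le_t
  have h4 := hp.rpow_pos (2 * ε)
  rw [div_div, div_le_div_iff₀ (by positivity) (by positivity)]
  linarith

/-- Since $\xi^2-t^2=O(\beta t)$, this error relative to the main size $t^2n$ is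
$O(\beta/(tn))=O(t^{-2\varepsilon})$. -/
lemma abs_symbol_error_le (hp : p.Admissible h c ε R) (hc : 0 < c) :
    |(p.ξ ^ 2 - p.t ^ 2 - 1 / 4) / (p.t ^ 2 * offDiag p.g)| ≤ 4 * (1 / c / p.t ^ (2 * ε)) := by
  have h1 := hp.inv_t_mul_offDiag_le hc
  have h2 := hp.offDiag_pos hc
  have h3 := hp.two_le_t
  have h4 := hp.one_le_β
  have h5 : |p.ξ ^ 2 - p.t ^ 2 - 1 / 4| ≤ 4 * p.β * p.t := by
    have e1 := abs_le.1 hp.ξ_near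
    have e2 := hp.β_le
    rw [abs_le]
    constructor <;> nlinarith
  rw [abs_div, abs_of_nonneg (by positivity : 0 ≤ p.t ^ 2 * offDiag p.g)]
  calc |p.ξ ^ 2 - p.t ^ 2 - 1 / 4| / (p.t ^ 2 * offDiag p.g)
      ≤ 4 * p.β * p.t / (p.t ^ 2 * offDiag p.g) := by gcongr
    _ = 4 * (p.β / (p.t * offDiag p.g)) := by field_simp
    _ ≤ _ := by gcongr

/-- The term $\zeta^2\gamma/n$, relative to $t^2n$, is at most the square of $\beta/(tn)$, so the
extra $1/n$ is harmless. -/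
lemma transverse_le (hp : p.Admissible h c ε R) (hc : 0 < c) (hε : 0 < ε) :
    p.ζ ^ 2 / (p.t ^ 2 * offDiag p.g ^ 2) ≤ 1 / c * (1 / c / p.t ^ (2 * ε)) := by
  have h1 := hp.inv_t_mul_offDiag_le hc
  have h2 := hp.offDiag_pos hc
  have h3 := hp.two_le_t
  have h4 := hp.one_le_β
  have h5 : (1 : ℝ) ≤ p.t ^ (2 * ε) := Real.one_le_rpow (by linarith) (by linarith)
  have h6 : p.ζ ^ 2 ≤ p.β ^ 2 := sq_le_sq' (by linarith [abs_le.1 hp.ζ_small])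
    (abs_le.1 hp.ζ_small).2
  calc p.ζ ^ 2 / (p.t ^ 2 * offDiag p.g ^ 2) ≤ p.β ^ 2 / (p.t ^ 2 * offDiag p.g ^ 2) := by gcongr
    _ = (p.β / (p.t * offDiag p.g)) * (p.β / (p.t * offDiag p.g)) := by field_simp
    _ ≤ (1 / c / p.t ^ (2 * ε)) * (1 / c / p.t ^ (2 * ε)) := by gcongr
    _ ≤ _ := mul_le_mul_of_nonneg_right (div_le_self (by positivity) h5) (by positivity)

lemma quarter_le (hp : p.Admissible h c ε R) : 1 / 4 ≤ p.ξ ^ 2 / p.t ^ 2 := by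
  have e1 := abs_le.1 hp.ξ_near
  have e2 := hp.β_le
  have h3 := hp.two_le_t
  rw [div_le_div_iff₀ (by norm_num) (by positivity)]
  nlinarith

lemma sq_ratio_le (hp : p.Admissible h c ε R) : p.ξ ^ 2 / p.t ^ 2 ≤ 4 := by
  have e1 := abs_le.1 hp.abs_ξ_le
  have h3 := hp.two_le_t
  rw [div_le_iff₀ (by positivity)]
  nlinarith

end OscParams.Admissible

/-- Reduces the lower bound on the full symbol to the lower bound on $\kappa=(\alpha-\eta)/n$: the
deviations caused by $\xi\ne t$, $\zeta\ne0$ and the constant $1/4$ are of relative size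
$t^{-2\varepsilon}$. -/
lemma exists_norm_oscIntegral_le_of_operator {h : 𝓢(ℝ, ℝ)} (hh : IsAdmissible h) {c ε R : ℝ}
    (hc : 0 < c) (hε : 0 < ε) {ι : Type*} {p : ι → OscParams}
    (hp : ∀ i, (p i).Admissible h c ε R) {α γ β δ η κ : ι → ℝ × ℝ → ℝ} (hα : IsSymbol α)
    (hγ : IsSymbol γ) (hβ : IsSymbol β) (hδ : IsSymbol δ) (hη : IsSymbol η) (hκ : IsSymbol κ)
    (hop : ∀ i, IsRadialOperator (coshDist (p i).g) (α i) (fun x => γ i x / offDiag (p i).g)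
      (β i) (fun x => δ i x / offDiag (p i).g) (η i))
    (hκ_eq : ∀ i x, α i x - η i x = offDiag (p i).g * κ i x) {m : ℝ} (hm : 0 < m)
    (hκm : ∀ i, ∀ x ∈ unitSquare, coshDist (p i).g x ≤ Real.cosh 1 → m ≤ κ i x)
    {f : ℝ × ℝ → ℂ} (hf : ContDiff ℝ ∞ f) (hf0 : ∀ x ∉ unitSquare, f x = 0) (N : ℕ) :
    ∃ t₀ C : ℝ, ∀ i, t₀ ≤ (p i).t →
      ‖oscIntegral h (p i).t (p i).g (p i).ξ (p i).ζ f 0‖ ≤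
        C * (p i).t ^ 2 * ((p i).t ^ (-(2 * ε))) ^ N := by
  obtain ⟨Mη, hMη⟩ := hη.exists_norm_le
  obtain ⟨Mγ, hMγ⟩ := hγ.exists_norm_le
  set T := (4 * |Mη| + 1 / c * |Mγ|) * (1 / c) / (m / 8)
  -- Once $t^{2\varepsilon}\ge T$, both error terms together are at most $m/8$. The main term is at
  -- least $m/4$ because $\xi\ge t/2$, which leaves $\theta=m/8$.
  have hT : 0 ≤ T := by positivity
  obtain ⟨t₀, ht₀⟩ := Filter.eventually_atTop.1
    ((tendsto_rpow_atTop (by linarith : 0 < 2 * ε)).eventually_ge_atTop T)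
  set ι' := {i : ι // t₀ ≤ (p i).t}
  set σ : ι' → ℝ × ℝ → ℝ := fun i x => ((p i).ξ ^ 2 / (p i).t ^ 2) * κ i x +
    ((p i).ξ ^ 2 - (p i).t ^ 2 - 1 / 4) / ((p i).t ^ 2 * offDiag (p i).g) * η i x +
    (p i).ζ ^ 2 / ((p i).t ^ 2 * offDiag (p i).g ^ 2) * γ i x with hσdef
  have hdecay (i : ι) : 1 / c / (p i).t ^ (2 * ε) ≤ 1 / c := by
    have ht := (hp i).two_le_t
    exact div_le_self (by positivity) (Real.one_le_rpow (by linarith) (by linarith))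
  have hσ : IsSymbol σ := by
    refine IsSymbol.add (IsSymbol.add ?_ ?_) ?_
    · refine (hκ.comp_index Subtype.val).const_mul ⟨4, fun i => ?_⟩
      rw [Real.norm_of_nonneg (by positivity)]
      exact (hp i).sq_ratio_le
    · refine (hη.comp_index Subtype.val).const_mul ⟨4 * (1 / c), fun i => ?_⟩
      have := hdecay i
      exact ((hp i).abs_symbol_error_le hc).trans (by gcongr)
    · refine (hγ.comp_index Subtype.val).const_mul ⟨1 / c * (1 / c), fun i => ?_⟩
      have := hdecay i
      rw [Real.norm_of_nonneg (by positivity)]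
      exact ((hp i).transverse_le hc hε).trans (by gcongr)
  obtain ⟨C, -, hC⟩ := exists_norm_oscIntegral_le hh hc hε (p := fun i : ι' => p i)
    (fun i => hp i) (hα.comp_index _) (hγ.comp_index _) (hβ.comp_index _) (hδ.comp_index _)
    (hη.comp_index _) hσ (fun i => hop i) (fun i x => by
      have h1 := (hp i).offDiag_pos hc
      have h2 := (hp i).two_le_t
      rw [eq_add_of_sub_eq (hκ_eq i x)]
      simp only [hσdef]
      field_simp
      ring) (θ := m / 8) (by positivity) (fun i x hx hcosh => by
      have h1 := hκm i x hx hcosh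
      have h2 := (hp i).quarter_le
      have h3 := (hp i).abs_symbol_error_le hc
      have h4 := (hp i).transverse_le hc hε
      have h5 := (hMη i x hx).trans (le_abs_self Mη)
      have h6 := (hMγ i x hx).trans (le_abs_self Mγ)
      have h7 := ht₀ _ i.2
      have h8 := (hp i).rpow_pos (2 * ε)
      set r := 1 / c / (p i).t ^ (2 * ε) with hr
      have hr0 : 0 ≤ r := by positivity
      have h9 : (4 * |Mη| + 1 / c * |Mγ|) * r ≤ m / 8 := by
        rw [hr, ← mul_div_assoc, div_le_iff₀ h8]
        have h10 : T * (m / 8) = (4 * |Mη| + 1 / c * |Mγ|) * (1 / c) := by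
          simp only [T]
          field_simp
        rw [← h10]
        nlinarith
      have e1 : 1 / 4 * m ≤ ((p i).ξ ^ 2 / (p i).t ^ 2) * κ i x := by gcongr
      have e2 : |((p i).ξ ^ 2 - (p i).t ^ 2 - 1 / 4) / ((p i).t ^ 2 * offDiag (p i).g) * η i x| ≤
          4 * r * |Mη| := by
        rw [abs_mul]
        exact mul_le_mul h3 h5 (abs_nonneg _) (by positivity)
      have e3 : |(p i).ζ ^ 2 / ((p i).t ^ 2 * offDiag (p i).g ^ 2) * γ i x| ≤
          1 / c * r * |Mγ| := by
        rw [abs_mul, abs_of_nonneg (by positivity)]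
        exact mul_le_mul h4 h6 (abs_nonneg _) (by positivity)
      have e2' := (abs_le.1 e2).1
      have e3' := (abs_le.1 e3).1
      simp only [hσdef]
      linarith) N 0 (fun _ => f) (IsSymbol.fixed hf) (fun _ => hf0)
  exact ⟨t₀, C, fun i hi => by simpa using hC ⟨i, hi⟩⟩

lemma isSymbol_expComb {ι : Type*} {u v w z : ι → ℝ} (hu : ∃ C, ∀ i, ‖u i‖ ≤ C)
    (hv : ∃ C, ∀ i, ‖v i‖ ≤ C) (hw : ∃ C, ∀ i, ‖w i‖ ≤ C) (hz : ∃ C, ∀ i, ‖z i‖ ≤ C) :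
    IsSymbol fun i => expComb (u i) (v i) (w i) (z i) := by
  have e {f : ℝ × ℝ → ℝ} (hf : ContDiff ℝ ∞ f) : IsSymbol fun (_ : ι) x => f x := IsSymbol.fixed hf
  exact ((((e (by fun_prop)).const_mul hu).add ((e (by fun_prop)).const_mul hv)).add
    ((e (by fun_prop)).const_mul hw)).add ((e (by fun_prop)).const_mul hz)

section Symbols

variable {h : 𝓢(ℝ, ℝ)} {c ε R : ℝ} {ι : Type*} {p : ι → OscParams}

lemma exists_sq_entry_le (hp : ∀ i, (p i).Admissible h c ε R) (r s : Fin 2) :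
    ∃ C, ∀ i, ‖(p i).g r s ^ 2‖ ≤ C := by
  refine ⟨R ^ 2, fun i => ?_⟩
  rw [norm_pow]
  exact pow_le_pow_left₀ (norm_nonneg _) ((hp i).entry_le r s) 2

lemma exists_neg_le {u : ι → ℝ} (hu : ∃ C, ∀ i, ‖u i‖ ≤ C) : ∃ C, ∀ i, ‖-u i‖ ≤ C := by
  simpa only [norm_neg] using hu

lemma isSymbol_diffPart (hp : ∀ i, (p i).Admissible h c ε R) :
    IsSymbol fun i => diffPart (p i).g :=
  isSymbol_expComb (exists_sq_entry_le hp _ _) (exists_sq_entry_le hp _ _) ⟨0, by simp⟩ ⟨0, by simp⟩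

lemma isSymbol_diffPart' (hp : ∀ i, (p i).Admissible h c ε R) :
    IsSymbol fun i => diffPart' (p i).g :=
  isSymbol_expComb (exists_neg_le (exists_sq_entry_le hp _ _)) (exists_sq_entry_le hp _ _)
    ⟨0, by simp⟩ ⟨0, by simp⟩

lemma isSymbol_sumPart (hp : ∀ i, (p i).Admissible h c ε R) :
    IsSymbol fun i => sumPart (p i).g :=
  isSymbol_expComb ⟨0, by simp⟩ ⟨0, by simp⟩ (exists_sq_entry_le hp _ _) (exists_sq_entry_le hp _ _)

lemma isSymbol_sumPart' (hp : ∀ i, (p i).Admissible h c ε R) :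
    IsSymbol fun i => sumPart' (p i).g :=
  isSymbol_expComb ⟨0, by simp⟩ ⟨0, by simp⟩ (exists_neg_le (exists_sq_entry_le hp _ _))
    (exists_sq_entry_le hp _ _)

lemma exists_sq_ratio_le (hp : ∀ i, (p i).Admissible h c ε R) (hc : 0 < c) :
    (∃ C, ∀ i, ‖(p i).g 0 1 ^ 2 / offDiag (p i).g‖ ≤ C) ∧
      ∃ C, ∀ i, ‖(p i).g 1 0 ^ 2 / offDiag (p i).g‖ ≤ C := by
  constructor <;> refine ⟨1, fun i => ?_⟩ <;> have h1 := (hp i).offDiag_pos hc <;>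
    rw [Real.norm_of_nonneg (by positivity), div_le_one h1, offDiag]
  · linarith [sq_nonneg ((p i).g 1 0)]
  · linarith [sq_nonneg ((p i).g 0 1)]

lemma isSymbol_sumPart_div (hp : ∀ i, (p i).Admissible h c ε R) (hc : 0 < c) :
    IsSymbol fun i x => sumPart (p i).g x / offDiag (p i).g := by
  have := isSymbol_expComb (ι := ι) (u := fun _ => 0) (v := fun _ => 0) ⟨0, by simp⟩ ⟨0, by simp⟩
    (exists_sq_ratio_le hp hc).1 (exists_sq_ratio_le hp hc).2
  convert! this using 3
  rw [sumPart, expComb, expComb]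
  ring

lemma isSymbol_sumPart'_div (hp : ∀ i, (p i).Admissible h c ε R) (hc : 0 < c) :
    IsSymbol fun i x => sumPart' (p i).g x / offDiag (p i).g := by
  have := isSymbol_expComb (ι := ι) (u := fun _ => 0) (v := fun _ => 0) ⟨0, by simp⟩ ⟨0, by simp⟩
    (exists_neg_le (exists_sq_ratio_le hp hc).1) (exists_sq_ratio_le hp hc).2
  convert! this using 3
  rw [sumPart', expComb, expComb]
  ring

lemma offDiag_le (hp : ∀ i, (p i).Admissible h c ε R) (i : ι) : offDiag (p i).g ≤ 2 * R ^ 2 := by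
  have h1 (r s : Fin 2) : (p i).g r s ^ 2 ≤ R ^ 2 :=
    sq_le_sq' (abs_le.1 ((hp i).entry_le r s)).1 (abs_le.1 ((hp i).entry_le r s)).2
  rw [offDiag]
  linarith [h1 0 1, h1 1 0]

lemma isSymbol_offDiag (hp : ∀ i, (p i).Admissible h c ε R) :
    IsSymbol fun i (_ : ℝ × ℝ) => offDiag (p i).g :=
  IsSymbol.const ⟨2 * R ^ 2, fun i => by
    rw [Real.norm_of_nonneg (offDiag_nonneg _)]
    exact offDiag_le hp i⟩

lemma isSymbol_offProd (hp : ∀ i, (p i).Admissible h c ε R) :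
    IsSymbol fun i (_ : ℝ × ℝ) => offProd (p i).g :=
  IsSymbol.const ⟨2 * R ^ 2, fun i => by
    have h1 := abs_offProd_le (p i).g
    have h2 := offDiag_le hp i
    have h3 := abs_nonneg (offProd (p i).g)
    rw [Real.norm_eq_abs]
    linarith⟩

lemma isSymbol_offProd_div (hp : ∀ i, (p i).Admissible h c ε R) (hc : 0 < c) :
    IsSymbol fun i (_ : ℝ × ℝ) => offProd (p i).g / offDiag (p i).g :=
  IsSymbol.const ⟨1, fun i => by
    have h1 := abs_offProd_le (p i).g
    have h2 := (hp i).offDiag_pos hc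
    have h3 := abs_nonneg (offProd (p i).g)
    rw [norm_div, Real.norm_of_nonneg h2.le, div_le_one h2, Real.norm_eq_abs]
    linarith⟩

lemma exp_neg_two_le (hp : ∀ i, (p i).Admissible h c ε R) (hc : 0 < c) (i : ι) {x : ℝ × ℝ}
    (hx : x ∈ unitSquare) : Real.exp (-2) ≤ sumPart (p i).g x / offDiag (p i).g := by
  rw [le_div_iff₀ ((hp i).offDiag_pos hc)]
  exact offDiag_le_sumPart _ hx

lemma exists_norm_oscIntegral_le_of_identities (hh : IsAdmissible h) (hc : 0 < c) (hε : 0 < ε)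
    (hp : ∀ i, (p i).Admissible h c ε R) {α γ β δ η κ : ι → ℝ × ℝ → ℝ} (hα : IsSymbol α)
    (hγ : IsSymbol γ) (hβ : IsSymbol β) (hδ : IsSymbol δ) (hη : IsSymbol η) (hκ : IsSymbol κ)
    (h₁ : ∀ i x, offDiag (p i).g * α i x * diffPart' (p i).g x ^ 2 +
      γ i x * sumPart' (p i).g x ^ 2 =
      offDiag (p i).g * η i x * ((diffPart (p i).g x + sumPart (p i).g x) ^ 2 - 4))
    (h₂ : ∀ i x, offDiag (p i).g * (α i x * diffPart (p i).g x + β i x * diffPart' (p i).g x) +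
      γ i x * sumPart (p i).g x + δ i x * sumPart' (p i).g x =
      2 * offDiag (p i).g * η i x * (diffPart (p i).g x + sumPart (p i).g x))
    (hκ_eq : ∀ i x, α i x - η i x = offDiag (p i).g * κ i x) {m : ℝ} (hm : 0 < m)
    (hκm : ∀ i, ∀ x ∈ unitSquare, coshDist (p i).g x ≤ Real.cosh 1 → m ≤ κ i x)
    {f : ℝ × ℝ → ℂ} (hf : ContDiff ℝ ∞ f) (hf0 : ∀ x ∉ unitSquare, f x = 0) (N : ℕ) :
    ∃ t₀ C : ℝ, ∀ i, t₀ ≤ (p i).t →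
      ‖oscIntegral h (p i).t (p i).g (p i).ξ (p i).ζ f 0‖ ≤
        C * (p i).t ^ 2 * ((p i).t ^ (-(2 * ε))) ^ N := by
  refine exists_norm_oscIntegral_le_of_operator hh hc hε hp hα hγ hβ hδ hη hκ (fun i => ?_) hκ_eq
    hm hκm hf hf0 N
  have hn := (hp i).offDiag_pos hc
  refine isRadialOperator_of_identities (hα.contDiff i) ((hγ.contDiff i).div_const _)
    (hβ.contDiff i) ((hδ.contDiff i).div_const _) (hη.contDiff i) (fun x => ?_) fun x => ?_
  · have := h₁ i x
    field_simp
    linarith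
  · have := h₂ i x
    field_simp
    linarith

/-- In this range $A\ge2(1+E)$ and $B\ge2E\ge0$. For the polynomial operator with $\eta=(A-B)^2-4$
one finds $\alpha-\eta=2AB+8E-8E^2\ge4B$, and $B\ge e^{-2}n$ on the square. The argument breaks down
for crossing segments: at $c=1$ with $-1<E<0$ the same difference equals $-16E^2$. -/
lemma exists_norm_oscIntegral_le_of_nonneg (hh : IsAdmissible h) (hc : 0 < c) (hε : 0 < ε)
    (hp : ∀ i, (p i).Admissible h c ε R) (hE : ∀ i, 0 ≤ offProd (p i).g)
    {f : ℝ × ℝ → ℂ} (hf : ContDiff ℝ ∞ f) (hf0 : ∀ x ∉ unitSquare, f x = 0) (N : ℕ) :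
    ∃ t₀ C : ℝ, ∀ i, t₀ ≤ (p i).t →
      ‖oscIntegral h (p i).t (p i).g (p i).ξ (p i).ζ f 0‖ ≤
        C * (p i).t ^ 2 * ((p i).t ^ (-(2 * ε))) ^ N := by
  have hA := isSymbol_diffPart hp
  have hA' := isSymbol_diffPart' hp
  have hB := isSymbol_sumPart hp
  have hB' := isSymbol_sumPart' hp
  have hn := isSymbol_offDiag hp
  have hE' := isSymbol_offProd hp
  have hBn := isSymbol_sumPart_div hp hc
  have hEn := isSymbol_offProd_div hp hc
  have hcst (a : ℝ) : IsSymbol fun (_ : ι) (_ : ℝ × ℝ) => a := IsSymbol.fixed contDiff_const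
  refine exists_norm_oscIntegral_le_of_identities hh hc hε hp
    (α := fun i x => diffPart (p i).g x ^ 2 - 4 * (1 + offProd (p i).g) ^ 2 +
      (sumPart (p i).g x ^ 2 - 4 * offProd (p i).g ^ 2) + 16 * offProd (p i).g)
    -- The factor $n$ cancels the division by $n$ built into the general statement; here the
    -- $x_1+x_2$ coefficients are already bounded.
    (γ := fun i x => offDiag (p i).g * ((sumPart (p i).g x ^ 2 - 4 * offProd (p i).g ^ 2) -
      3 * (diffPart (p i).g x ^ 2 - 4 * (1 + offProd (p i).g) ^ 2) - 16 * (1 + offProd (p i).g)))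
    (β := fun i x => (diffPart (p i).g x + sumPart (p i).g x) * diffPart' (p i).g x)
    (δ := fun i x => offDiag (p i).g * ((sumPart (p i).g x - 3 * diffPart (p i).g x) *
      sumPart' (p i).g x))
    (η := fun i x => (diffPart (p i).g x - sumPart (p i).g x) ^ 2 - 4)
    (κ := fun i x => 2 * diffPart (p i).g x * (sumPart (p i).g x / offDiag (p i).g) -
      (8 * offProd (p i).g - 8) * (offProd (p i).g / offDiag (p i).g))
    ?_ ?_ ?_ ?_ ?_ ?_ (fun i x => ?_) (fun i x => ?_) (fun i x => ?_)
    (m := 4 * Real.exp (-2)) (by positivity) (fun i x hx _ => ?_) hf hf0 N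
  · exact (((hA.pow 2).sub ((hcst 4).mul (((hcst 1).add hE').pow 2))).add
      ((hB.pow 2).sub ((hcst 4).mul (hE'.pow 2)))).add ((hcst 16).mul hE')
  · exact hn.mul ((((hB.pow 2).sub ((hcst 4).mul (hE'.pow 2))).sub ((hcst 3).mul
      ((hA.pow 2).sub ((hcst 4).mul (((hcst 1).add hE').pow 2))))).sub
      ((hcst 16).mul ((hcst 1).add hE')))
  · exact (hA.add hB).mul hA'
  · exact hn.mul ((hB.sub ((hcst 3).mul hA)).mul hB')
  · exact ((hA.sub hB).pow 2).sub (hcst 4)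
  · exact (((hcst 2).mul hA).mul hBn).sub ((((hcst 8).mul hE').sub (hcst 8)).mul hEn)
  · rw [diffPart'_sq, sumPart'_sq]
    ring
  · have h1 := diffPart'_sq (p i).g x
    have h2 := sumPart'_sq (p i).g x
    linear_combination offDiag (p i).g * (diffPart (p i).g x + sumPart (p i).g x) * h1 +
      offDiag (p i).g * (sumPart (p i).g x - 3 * diffPart (p i).g x) * h2
  · have := (hp i).offDiag_pos hc
    field_simp
    ring
  · have hn := (hp i).offDiag_pos hc
    have h1 := exp_neg_two_le hp hc i hx
    have h2 := le_diffPart (p i).g x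
    have h3 := abs_le_sumPart (p i).g x
    rw [abs_of_nonneg (hE i)] at h3
    have h4 : 2 * (offProd (p i).g / offDiag (p i).g) ≤ sumPart (p i).g x / offDiag (p i).g := by
      rw [← mul_div_assoc]
      gcongr
    have h5 : 0 ≤ offProd (p i).g / offDiag (p i).g := div_nonneg (hE i) hn.le
    have h6 := hE i
    set b := sumPart (p i).g x / offDiag (p i).g
    set e := offProd (p i).g / offDiag (p i).g
    have h7 : 0 ≤ b := by linarith
    have h8 := mul_le_mul_of_nonneg_right h2 h7
    nlinarith [mul_nonneg h6 (sub_nonneg.2 h4)]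

/-- With $F=A+2(1+E)$ and $G=B-2E$ one has $A'^2=F(A-2(1+E))$, $B'^2=G(B+2E)$ and $F+G=2c+2$.
Choosing $\alpha$ and $\gamma/n$ proportional to $F(F+G)G^2$ and $F^2(F+G)G$ makes the second-order
part $F^2G^2(4c^2-4)$, with no division by a quantity vanishing at $c=1$. Then $\alpha-\eta$ is
proportional to $FG^3$, and $E\ge-1/2$, $E\le0$ give $F\ge1$ and $G\ge e^{-2}n$. -/
lemma exists_norm_oscIntegral_le_of_mem_Icc (hh : IsAdmissible h) (hc : 0 < c) (hε : 0 < ε)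
    (hp : ∀ i, (p i).Admissible h c ε R) (hE : ∀ i, offProd (p i).g ∈ Set.Icc (-(1 / 2)) 0)
    {f : ℝ × ℝ → ℂ} (hf : ContDiff ℝ ∞ f) (hf0 : ∀ x ∉ unitSquare, f x = 0) (N : ℕ) :
    ∃ t₀ C : ℝ, ∀ i, t₀ ≤ (p i).t →
      ‖oscIntegral h (p i).t (p i).g (p i).ξ (p i).ζ f 0‖ ≤
        C * (p i).t ^ 2 * ((p i).t ^ (-(2 * ε))) ^ N := by
  have hA := isSymbol_diffPart hp
  have hA' := isSymbol_diffPart' hp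
  have hB := isSymbol_sumPart hp
  have hE' := isSymbol_offProd hp
  have hBn' := isSymbol_sumPart'_div hp hc
  have hcst (a : ℝ) : IsSymbol fun (_ : ι) (_ : ℝ × ℝ) => a := IsSymbol.fixed contDiff_const
  set F : ι → ℝ × ℝ → ℝ := fun i x => diffPart (p i).g x + 2 * (1 + offProd (p i).g) with hFdef
  set G : ι → ℝ × ℝ → ℝ := fun i x => sumPart (p i).g x - 2 * offProd (p i).g with hGdef
  set Gn : ι → ℝ × ℝ → ℝ := fun i x => sumPart (p i).g x / offDiag (p i).g -
    2 * (offProd (p i).g / offDiag (p i).g) with hGndef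
  have hF : IsSymbol F := hA.add ((hcst 2).mul ((hcst 1).add hE'))
  have hG : IsSymbol G := hB.sub ((hcst 2).mul hE')
  have hGn : IsSymbol Gn :=
    (isSymbol_sumPart_div hp hc).sub ((hcst 2).mul (isSymbol_offProd_div hp hc))
  have hrel (i : ι) (x : ℝ × ℝ) : offDiag (p i).g * Gn i x = G i x := by
    have := (hp i).offDiag_pos hc
    simp only [hGndef, hGdef]
    field_simp
  have hrel' (i : ι) (x : ℝ × ℝ) : sumPart' (p i).g x / offDiag (p i).g * sumPart' (p i).g x =
      Gn i x * (sumPart (p i).g x + 2 * offProd (p i).g) := by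
    have := (hp i).offDiag_pos hc
    have h2 := sumPart'_sq (p i).g x
    simp only [hGndef]
    field_simp
    linarith
  refine exists_norm_oscIntegral_le_of_identities hh hc hε hp
    -- All coefficients are divided by $n^2$ and written through $G/n$, which is bounded above and
    -- below; this is where the $1/n$ in the $x_1+x_2$ coefficients is really needed.
    (α := fun i x => F i x * (F i x + G i x) * Gn i x ^ 2)
    (γ := fun i x => F i x ^ 2 * (F i x + G i x) * Gn i x)
    (β := fun i x => 1 / 2 * (F i x - G i x) * diffPart' (p i).g x * Gn i x ^ 2)
    (δ := fun i x => -(1 / 2) * (F i x - G i x) * F i x ^ 2 *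
      (sumPart' (p i).g x / offDiag (p i).g))
    (η := fun i x => F i x ^ 2 * Gn i x ^ 2)
    (κ := fun i x => F i x * Gn i x ^ 3)
    ((hF.mul (hF.add hG)).mul (hGn.pow 2)) (((hF.pow 2).mul (hF.add hG)).mul hGn)
    ((((hcst (1 / 2)).mul (hF.sub hG)).mul hA').mul (hGn.pow 2))
    ((((hcst (-(1 / 2))).mul (hF.sub hG)).mul (hF.pow 2)).mul hBn')
    ((hF.pow 2).mul (hGn.pow 2)) (hF.mul (hGn.pow 3))
    (fun i x => ?_) (fun i x => ?_) (fun i x => ?_)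
    (m := 1 * Real.exp (-2) ^ 3) (by positivity) (fun i x hx _ => ?_) hf hf0 N
  · have h1 := diffPart'_sq (p i).g x
    have h2 := sumPart'_sq (p i).g x
    have h3 := hrel i x
    simp only [hFdef, hGdef] at h3 ⊢
    set A := diffPart (p i).g x
    set B := sumPart (p i).g x
    set E := offProd (p i).g
    set n := offDiag (p i).g
    set Gh := Gn i x
    linear_combination n * (A + 2 * (1 + E)) * (A + 2 * (1 + E) + (B - 2 * E)) * Gh ^ 2 * h1 +
      (A + 2 * (1 + E)) ^ 2 * (A + 2 * (1 + E) + (B - 2 * E)) * Gh * h2 -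
      (A + 2 * (1 + E)) ^ 2 * (A + 2 * (1 + E) + (B - 2 * E)) * Gh * (B + 2 * E) * h3
  · have h1 := diffPart'_sq (p i).g x
    have h3 := hrel i x
    have h4 := hrel' i x
    simp only [hFdef, hGdef] at h3 ⊢
    set A := diffPart (p i).g x
    set B := sumPart (p i).g x
    set E := offProd (p i).g
    set n := offDiag (p i).g
    set Gh := Gn i x
    linear_combination 1 / 2 * n * (A + 2 * (1 + E) - (B - 2 * E)) * Gh ^ 2 * h1 -
      1 / 2 * (A + 2 * (1 + E) - (B - 2 * E)) * (A + 2 * (1 + E)) ^ 2 * h4 +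
      (A + 2 * (1 + E)) * Gh * ((A + 2 * (1 + E) + (B - 2 * E)) * A +
        1 / 2 * (A + 2 * (1 + E) - (B - 2 * E)) * (A - 2 * (1 + E)) -
        2 * (A + 2 * (1 + E)) * (A + B)) * h3
  · rw [← hrel i x]
    ring
  · have h1 := exp_neg_two_le hp hc i hx
    have h2 := diffPart_nonneg (p i).g x
    have h3 := (hE i).1
    have h4 : offProd (p i).g / offDiag (p i).g ≤ 0 :=
      div_nonpos_of_nonpos_of_nonneg (hE i).2 (offDiag_nonneg _)
    have h5 : 1 ≤ F i x := by
      simp only [hFdef]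
      linarith
    have h6 : Real.exp (-2) ≤ Gn i x := by
      simp only [hGndef]
      linarith
    gcongr

/-- Now $n\ge2|E|>1$, so powers of $n$ are harmless. With $\eta=4-(A-B)^2$ one has
$\alpha-\eta=2B(B-A)-8E$, whose positivity uses the support of the kernel, $A+B=2c\le2\cosh1$. -/
lemma exists_norm_oscIntegral_le_of_lt (hh : IsAdmissible h) (hc : 0 < c) (hε : 0 < ε)
    (hp : ∀ i, (p i).Admissible h c ε R) (hE : ∀ i, offProd (p i).g < -(1 / 2))
    {f : ℝ × ℝ → ℂ} (hf : ContDiff ℝ ∞ f) (hf0 : ∀ x ∉ unitSquare, f x = 0) (N : ℕ) :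
    ∃ t₀ C : ℝ, ∀ i, t₀ ≤ (p i).t →
      ‖oscIntegral h (p i).t (p i).g (p i).ξ (p i).ζ f 0‖ ≤
        C * (p i).t ^ 2 * ((p i).t ^ (-(2 * ε))) ^ N := by
  have hA := isSymbol_diffPart hp
  have hA' := isSymbol_diffPart' hp
  have hB := isSymbol_sumPart hp
  have hB' := isSymbol_sumPart' hp
  have hn := isSymbol_offDiag hp
  have hE' := isSymbol_offProd hp
  have hcst (a : ℝ) : IsSymbol fun (_ : ι) (_ : ℝ × ℝ) => a := IsSymbol.fixed contDiff_const
  have hn1 (i : ι) : 1 ≤ offDiag (p i).g := by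
    have h1 := abs_offProd_le (p i).g
    rw [abs_of_neg (by linarith [hE i])] at h1
    linarith [hE i]
  have hni : IsSymbol fun i (_ : ℝ × ℝ) => 1 / offDiag (p i).g :=
    IsSymbol.const ⟨1, fun i => by
      have := hn1 i
      rw [Real.norm_of_nonneg (by positivity)]
      exact (div_le_one (by linarith)).2 this⟩
  refine exists_norm_oscIntegral_le_of_identities hh hc hε hp
    (α := fun i x => (sumPart (p i).g x ^ 2 - 4 * offProd (p i).g ^ 2) -
      (diffPart (p i).g x ^ 2 - 4 * (1 + offProd (p i).g) ^ 2) - 16 * offProd (p i).g)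
    (γ := fun i x => offDiag (p i).g * ((diffPart (p i).g x ^ 2 - 4 * (1 + offProd (p i).g) ^ 2) -
      (sumPart (p i).g x ^ 2 - 4 * offProd (p i).g ^ 2) + 16 * (1 + offProd (p i).g)))
    (β := fun i x => (sumPart (p i).g x - diffPart (p i).g x) * diffPart' (p i).g x)
    (δ := fun i x => offDiag (p i).g * ((diffPart (p i).g x - sumPart (p i).g x) *
      sumPart' (p i).g x))
    (η := fun i x => 4 - (diffPart (p i).g x - sumPart (p i).g x) ^ 2)
    (κ := fun i x => 1 / offDiag (p i).g * (2 * sumPart (p i).g x *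
      (sumPart (p i).g x - diffPart (p i).g x) - 8 * offProd (p i).g))
    ?_ ?_ ?_ ?_ ?_ ?_ (fun i x => ?_) (fun i x => ?_) (fun i x => ?_)
    (m := 1 / (2 * R ^ 2 + 1) * (9 / 5)) (by positivity) (fun i x hx hcosh => ?_) hf hf0 N
  · exact ((((hB.pow 2).sub ((hcst 4).mul (hE'.pow 2))).sub
      ((hA.pow 2).sub ((hcst 4).mul (((hcst 1).add hE').pow 2))))).sub ((hcst 16).mul hE')
  · exact hn.mul ((((hA.pow 2).sub ((hcst 4).mul (((hcst 1).add hE').pow 2))).sub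
      ((hB.pow 2).sub ((hcst 4).mul (hE'.pow 2)))).add ((hcst 16).mul ((hcst 1).add hE')))
  · exact (hB.sub hA).mul hA'
  · exact hn.mul ((hA.sub hB).mul hB')
  · exact (hcst 4).sub ((hA.sub hB).pow 2)
  · exact hni.mul ((((hcst 2).mul hB).mul (hB.sub hA)).sub ((hcst 8).mul hE'))
  · rw [diffPart'_sq, sumPart'_sq]
    ring
  · have h1 := diffPart'_sq (p i).g x
    have h2 := sumPart'_sq (p i).g x
    linear_combination offDiag (p i).g * (sumPart (p i).g x - diffPart (p i).g x) * h1 +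
      offDiag (p i).g * (diffPart (p i).g x - sumPart (p i).g x) * h2
  · have := hn1 i
    field_simp
    ring
  · have h1 := hn1 i
    have h2 := offDiag_le hp i
    have h3 := abs_le_sumPart (p i).g x
    have h4 := hE i
    rw [abs_of_neg (by linarith)] at h3
    have h5 := cosh_one_lt
    rw [coshDist_eq] at hcosh
    -- From $A\le3.1-B$, $B\ge1$ and $-8E>4$ the worst case is $2(2-3.1)+4=9/5$.
    have h6 : 9 / 5 ≤ 2 * sumPart (p i).g x * (sumPart (p i).g x - diffPart (p i).g x) -
        8 * offProd (p i).g := by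
      set A := diffPart (p i).g x
      set B := sumPart (p i).g x
      have h7 : A ≤ 3.1 - B := by linarith
      have h8 : 1 ≤ B := by linarith
      have h9 : 2 * B * (2 * B - 3.1) ≤ 2 * B * (B - A) :=
        mul_le_mul_of_nonneg_left (by linarith) (by linarith)
      nlinarith
    have h7 : 1 / (2 * R ^ 2 + 1) ≤ 1 / offDiag (p i).g := by
      apply one_div_le_one_div_of_le <;> linarith
    gcongr

end Symbols

lemma exists_norm_oscIntegral_le_of_admissible {h : 𝓢(ℝ, ℝ)} {c ε : ℝ} (hh : IsAdmissible h)
    (hc : 0 < c) (hε : 0 < ε) (R : ℝ) {f : ℝ × ℝ → ℂ} (hf : ContDiff ℝ ∞ f)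
    (hf0 : ∀ x ∉ unitSquare, f x = 0) (N : ℕ) :
    ∃ t₀ C : ℝ, ∀ p : OscParams, p.Admissible h c ε R → t₀ ≤ p.t →
      ‖oscIntegral h p.t p.g p.ξ p.ζ f 0‖ ≤ C * p.t ^ 2 * (p.t ^ (-(2 * ε))) ^ N := by
  obtain ⟨t₁, C₁, h₁⟩ := exists_norm_oscIntegral_le_of_nonneg hh hc hε (R := R)
    (p := fun i : {p : OscParams // p.Admissible h c ε R ∧ 0 ≤ offProd p.g} => i.1)
    (fun i => i.2.1) (fun i => i.2.2) hf hf0 N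
  obtain ⟨t₂, C₂, h₂⟩ := exists_norm_oscIntegral_le_of_mem_Icc hh hc hε (R := R)
    (p := fun i : {p : OscParams // p.Admissible h c ε R ∧
      offProd p.g ∈ Set.Icc (-(1 / 2)) 0} => i.1)
    (fun i => i.2.1) (fun i => i.2.2) hf hf0 N
  obtain ⟨t₃, C₃, h₃⟩ := exists_norm_oscIntegral_le_of_lt hh hc hε (R := R)
    (p := fun i : {p : OscParams // p.Admissible h c ε R ∧ offProd p.g < -(1 / 2)} => i.1)
    (fun i => i.2.1) (fun i => i.2.2) hf hf0 N
  refine ⟨max t₁ (max t₂ t₃), max C₁ (max C₂ C₃), fun p hp ht => ?_⟩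
  have hpos : 0 ≤ p.t ^ 2 * (p.t ^ (-(2 * ε))) ^ N := by
    have := hp.rpow_pos (-(2 * ε))
    positivity
  rw [mul_assoc]
  rcases le_or_gt 0 (offProd p.g) with hE | hE
  · refine (h₁ ⟨p, hp, hE⟩ ((le_max_left _ _).trans ht)).trans ?_
    rw [mul_assoc]
    gcongr
    exact le_max_left _ _
  rcases lt_or_ge (offProd p.g) (-(1 / 2)) with hE' | hE'
  · refine (h₃ ⟨p, hp, hE'⟩
      (((le_max_right _ _).trans (le_max_right _ _)).trans ht)).trans ?_
    rw [mul_assoc]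
    gcongr
    exact (le_max_right _ _).trans (le_max_right _ _)
  · refine (h₂ ⟨p, hp, hE', hE.le⟩
      (((le_max_left _ _).trans (le_max_right _ _)).trans ht)).trans ?_
    rw [mul_assoc]
    gcongr
    exact (le_max_left _ _).trans (le_max_right _ _)

/-! ### From the geometry of the segments to the size of the matrix entries. -/

/-- Some pair of points of the segments is at distance less than $2$. There $c\le\cosh2$, every
exponential is at least $e^{-2}$, and so the squared entries are bounded. -/
lemma exists_abs_entry_le :
    ∃ R : ℝ, 1 ≤ R ∧ ∀ g₁ g₂ : SL(2, ℝ), segDist g₁ g₂ ≤ 1 → ∀ i j, |(g₁⁻¹ * g₂) i j| ≤ R := by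
  refine ⟨1 + 2 * Real.exp 2 * Real.cosh 2, by
    have := Real.cosh_pos 2
    have := Real.exp_pos 2
    nlinarith, fun g₁ g₂ hd => ?_⟩
  obtain ⟨r, ⟨x₁, hx₁, x₂, hx₂, rfl⟩, hr⟩ := exists_lt_of_csInf_lt
    (s := {r : ℝ | ∃ x₁ ∈ Set.Icc (0 : ℝ) 1, ∃ x₂ ∈ Set.Icc (0 : ℝ) 1,
      r = dist (geod g₁ x₁) (geod g₂ x₂)})
    ⟨_, 0, by simp, 0, by simp, rfl⟩ (lt_of_le_of_lt hd one_lt_two)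
  have h1 : coshDist (g₁⁻¹ * g₂) (x₁, x₂) ≤ Real.cosh 2 := by
    rw [← cosh_dist_geod, Real.cosh_le_cosh, abs_of_nonneg dist_nonneg, abs_of_pos two_pos]
    exact hr.le
  set g := g₁⁻¹ * g₂
  have hexp (y : ℝ) (hy : -2 ≤ y) : 1 ≤ Real.exp 2 * Real.exp y := by
    rw [← Real.exp_add]
    exact Real.one_le_exp (by linarith)
  obtain ⟨a1, a2⟩ := hx₁
  obtain ⟨b1, b2⟩ := hx₂
  have e1 := hexp (-(x₁ - x₂)) (by linarith)
  have e2 := hexp (x₁ - x₂) (by linarith)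
  have e3 := hexp (-(x₁ + x₂)) (by linarith)
  have e4 := hexp (x₁ + x₂) (by linarith)
  have m1 := mul_le_mul_of_nonneg_left e1 (sq_nonneg (g 0 0))
  have m2 := mul_le_mul_of_nonneg_left e2 (sq_nonneg (g 1 1))
  have m3 := mul_le_mul_of_nonneg_left e3 (sq_nonneg (g 0 1))
  have m4 := mul_le_mul_of_nonneg_left e4 (sq_nonneg (g 1 0))
  have h2 := mul_le_mul_of_nonneg_left h1 (by positivity : 0 ≤ 2 * Real.exp 2)
  rw [coshDist] at h2
  have h3 : g 0 0 ^ 2 + g 1 1 ^ 2 + g 0 1 ^ 2 + g 1 0 ^ 2 ≤ 2 * Real.exp 2 * Real.cosh 2 := by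
    linarith
  have key (y : ℝ) (hy : y ^ 2 ≤ 2 * Real.exp 2 * Real.cosh 2) :
      |y| ≤ 1 + 2 * Real.exp 2 * Real.cosh 2 := by
    rw [← sq_abs] at hy
    nlinarith [sq_nonneg (|y| - 1)]
  intro i j
  apply key
  fin_cases i <;> fin_cases j <;> simp only [Fin.zero_eta, Fin.mk_one] <;>
    linarith [sq_nonneg (g 0 0), sq_nonneg (g 1 1), sq_nonneg (g 0 1), sq_nonneg (g 1 0)]

lemma pathLength_nonneg (γ : ℝ → SL(2, ℝ)) : 0 ≤ pathLength γ :=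
  intervalIntegral.integral_nonneg zero_le_one fun _ _ => Real.sqrt_nonneg _

lemma distG_nonneg (g₁ g₂ : SL(2, ℝ)) : 0 ≤ distG g₁ g₂ := by
  refine Real.sInf_nonneg ?_
  rintro _ ⟨γ, -, -, -, rfl⟩
  exact pathLength_nonneg γ

lemma segAngle_le_distG (g₁ g₂ : SL(2, ℝ)) (y : ℝ) :
    segAngle g₁ g₂ ≤ distG (g₁⁻¹ * g₂) (diagA y) :=
  csInf_le ⟨0, by rintro _ ⟨y, rfl⟩; exact distG_nonneg _ _⟩ ⟨y, rfl⟩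

lemma distG_le_pathLength {g₁ g₂ : SL(2, ℝ)} {γ : ℝ → SL(2, ℝ)}
    (hγ : ∀ i j, ContDiff ℝ 1 fun τ => (γ τ) i j) (h0 : γ 0 = g₁) (h1 : γ 1 = g₂ ∨ γ 1 = -g₂) :
    distG g₁ g₂ ≤ pathLength γ :=
  csInf_le ⟨0, by rintro _ ⟨γ, -, -, -, rfl⟩; exact pathLength_nonneg γ⟩ ⟨γ, hγ, h0, h1, rfl⟩

/-- The path which contracts the off-diagonal entries of a matrix to zero. -/
def contractPath (a b c : ℝ) (ha : a ≠ 0) (τ : ℝ) : SL(2, ℝ) :=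
  ⟨!![a, (1 - τ) * b; (1 - τ) * c, (1 + (1 - τ) ^ 2 * (b * c)) / a], by
    rw [Matrix.det_fin_two_of]
    field_simp
    ring⟩

lemma lieNorm_le (X : Matrix (Fin 2) (Fin 2) ℝ) :
    lieNorm X ≤ |X 0 0| + |X 0 1| + |X 1 0| := by
  rw [lieNorm]
  refine Real.sqrt_le_iff.2 ⟨by positivity, ?_⟩
  have h1 := abs_nonneg (X 0 0)
  have h2 := abs_nonneg (X 0 1)
  have h3 := abs_nonneg (X 1 0)
  rw [← sq_abs (X 0 0), ← sq_abs (X 0 1), ← sq_abs (X 1 0)]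
  nlinarith [mul_nonneg h1 h2, mul_nonneg h1 h3, mul_nonneg h2 h3]

lemma velocity_contractPath (a b c : ℝ) (ha : a ≠ 0) (τ : ℝ) :
    velocity (contractPath a b c ha) τ =
      !![0, -b; -c, -(2 * (1 - τ) * (b * c)) / a] := by
  have h1 : HasDerivAt (fun τ : ℝ => 1 - τ) (-1) τ := by
    simpa using (hasDerivAt_id τ).const_sub 1
  ext i j
  fin_cases i <;> fin_cases j <;> simp only [velocity, Matrix.of_apply, contractPath,
    Fin.zero_eta, Fin.mk_one, Matrix.cons_val', Matrix.cons_val_zero, Matrix.cons_val_one,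
    Matrix.cons_val_fin_one, deriv_const']
  · exact ((h1.mul_const b).deriv).trans (by ring)
  · exact ((h1.mul_const c).deriv).trans (by ring)
  · exact (((((h1.pow 2).mul_const (b * c)).const_add 1).div_const a).deriv).trans (by
      norm_num)

/-- The velocity is linear in $b$, $c$ and $bc$, so the speed in the left-invariant metric is
$O(\nu)$ while $a$, $1/a$ and $b$ stay bounded. -/
lemma pathLength_contractPath_le {a b c R ν : ℝ} (ha : a ≠ 0) (haR : |a| ≤ R)
    (haR' : 1 / |a| ≤ 2 * R) (hbR : |b| ≤ R) (hb : |b| ≤ ν) (hc : |c| ≤ ν)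
    (hbc : |b * c| ≤ 1 / 2) :
    pathLength (contractPath a b c ha) ≤ (5 * R + 4 * R ^ 3) * ν := by
  have hν : 0 ≤ ν := (abs_nonneg b).trans hb
  have hR : 0 ≤ R := (abs_nonneg a).trans haR
  have h : ∀ τ ∈ Set.uIoc (0 : ℝ) 1, ‖lieNorm (((contractPath a b c ha τ)⁻¹ : SL(2, ℝ)).1 *
      velocity (contractPath a b c ha) τ)‖ ≤ (5 * R + 4 * R ^ 3) * ν := by
    intro τ hτ
    rw [Set.uIoc_of_le zero_le_one] at hτ
    rw [lieNorm, Real.norm_of_nonneg (Real.sqrt_nonneg _), ← lieNorm]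
    refine (lieNorm_le _).trans ?_
    rw [velocity_contractPath, Matrix.SpecialLinearGroup.coe_inv, contractPath]
    simp only [Matrix.adjugate_fin_two_of, Matrix.mul_apply, Fin.sum_univ_two, Matrix.of_apply,
      Matrix.cons_val', Matrix.cons_val_zero, Matrix.cons_val_one, Matrix.cons_val_fin_one]
    set s := 1 - τ
    have hs0 : 0 ≤ s := by simp only [s]; linarith [hτ.2]
    have hs1 : s ≤ 1 := by simp only [s]; linarith [hτ.1]
    have hsabs : |s| ≤ 1 := by rw [abs_of_nonneg hs0]; exact hs1
    have hs2 : |s ^ 2| ≤ 1 := by rw [abs_pow]; exact pow_le_one₀ (abs_nonneg _) hsabs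
    have t1 : |(1 + s ^ 2 * (b * c)) / a * 0 + -(s * b) * -c| ≤ R * ν := by
      have : (1 + s ^ 2 * (b * c)) / a * 0 + -(s * b) * -c = s * (b * c) := by ring
      rw [this, abs_mul, abs_mul]
      calc |s| * (|b| * |c|) ≤ 1 * (R * ν) := by gcongr
        _ = _ := one_mul _
    have t2 : |(1 + s ^ 2 * (b * c)) / a * -b + -(s * b) * (-(2 * s * (b * c)) / a)| ≤
        3 * R * ν + 4 * R ^ 3 * ν := by
      have : (1 + s ^ 2 * (b * c)) / a * -b + -(s * b) * (-(2 * s * (b * c)) / a) =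
          -((1 + s ^ 2 * (b * c)) * b * (1 / a)) + 2 * (s ^ 2 * (b * (b * c)) * (1 / a)) := by
        field_simp
      rw [this]
      have u1 : |1 + s ^ 2 * (b * c)| ≤ 3 / 2 := by
        refine (abs_add_le _ _).trans ?_
        rw [abs_one, abs_mul]
        have : |s ^ 2| * |b * c| ≤ 1 * (1 / 2) := by gcongr
        linarith
      have u2 : |1 / a| ≤ 2 * R := by rwa [abs_div, abs_one]
      refine (abs_add_le _ _).trans (add_le_add ?_ ?_)
      · rw [abs_neg, abs_mul, abs_mul]
        calc |1 + s ^ 2 * (b * c)| * |b| * |1 / a| ≤ 3 / 2 * ν * (2 * R) := by gcongr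
          _ = _ := by ring
      · rw [abs_mul, abs_mul, abs_mul, abs_mul, abs_mul, abs_two]
        calc 2 * (|s ^ 2| * (|b| * (|b| * |c|)) * |1 / a|)
            ≤ 2 * (1 * (R * (R * ν)) * (2 * R)) := by gcongr
          _ = _ := by ring
    have t3 : |-(s * c) * 0 + a * -c| ≤ R * ν := by
      have : -(s * c) * 0 + a * -c = -(a * c) := by ring
      rw [this, abs_neg, abs_mul]
      gcongr
    linarith
  refine (le_abs_self _).trans ?_
  rw [← Real.norm_eq_abs, pathLength]
  exact (intervalIntegral.norm_integral_le_of_norm_le_const h).trans_eq (by simp)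

/-- Contracting the off-diagonal entries gives a short path to the diagonal group. Small
off-diagonal part forces $g_{00}g_{11}\ge1/2$, so $g_{00}$ stays away from $0$ and can be kept
constant. -/
lemma segAngle_le {R : ℝ} {g₁ g₂ : SL(2, ℝ)} (hR : ∀ i j, |(g₁⁻¹ * g₂) i j| ≤ R)
    (ho : offDiag (g₁⁻¹ * g₂) < 1) :
    segAngle g₁ g₂ ≤ (5 * R + 4 * R ^ 3) * √(offDiag (g₁⁻¹ * g₂)) := by
  set g := g₁⁻¹ * g₂ with hg
  have hbc : |g 0 1 * g 1 0| ≤ 1 / 2 := by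
    have := abs_offProd_le g
    rw [offProd] at this
    linarith
  have hdet := det_eq g
  have had : 1 / 2 ≤ g 0 0 * g 1 1 := by linarith [(abs_le.1 hbc).1]
  have ha : g 0 0 ≠ 0 := by
    intro h
    rw [h] at had
    norm_num at had
  have ha' : 1 / |g 0 0| ≤ 2 * R := by
    have h1 := hR 1 1
    have h2 : 1 / 2 ≤ |g 0 0| * |g 1 1| := by
      rw [← abs_mul]
      exact had.trans (le_abs_self _)
    have h3 := abs_pos.2 ha
    rw [div_le_iff₀ h3]
    nlinarith
  have hb : |g 0 1| ≤ √(offDiag g) := by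
    apply Real.abs_le_sqrt
    rw [offDiag]
    linarith [sq_nonneg (g 1 0)]
  have hc : |g 1 0| ≤ √(offDiag g) := by
    apply Real.abs_le_sqrt
    rw [offDiag]
    linarith [sq_nonneg (g 0 1)]
  have h0 : contractPath (g 0 0) (g 0 1) (g 1 0) ha 0 = g := by
    ext i j
    fin_cases i <;> fin_cases j <;> simp [contractPath]
    field_simp
    linarith
  -- The endpoint is $\mathrm{diag}(a,1/a)$ with $a=g_{00}$; a negative $a$ is the same class in
  -- $PSL_2(\mathbb R)$, hence the alternative with a sign.
  have h1 : contractPath (g 0 0) (g 0 1) (g 1 0) ha 1 = diagA (2 * Real.log |g 0 0|) ∨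
      contractPath (g 0 0) (g 0 1) (g 1 0) ha 1 = -diagA (2 * Real.log |g 0 0|) := by
    rcases lt_or_gt_of_ne ha with h | h
    · right
      ext i j
      rw [Matrix.SpecialLinearGroup.coe_neg]
      fin_cases i <;> fin_cases j <;>
        simp [contractPath, diagA, Real.exp_neg, abs_of_neg h, Real.exp_log_eq_abs ha]
    · left
      ext i j
      fin_cases i <;> fin_cases j <;>
        simp [contractPath, diagA, Real.exp_neg, abs_of_pos h, Real.exp_log_eq_abs ha]
  refine (segAngle_le_distG g₁ g₂ _).trans ((distG_le_pathLength (fun i j => ?_) h0 h1).trans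
    (pathLength_contractPath_le ha (hR 0 0) ha' (hR 0 1) hb hc hbc))
  fin_cases i <;> fin_cases j <;> simp only [contractPath, Fin.zero_eta, Fin.mk_one,
    Matrix.of_apply, Matrix.cons_val', Matrix.cons_val_zero, Matrix.cons_val_one,
    Matrix.cons_val_fin_one] <;> fun_prop

/-- A lower bound for the off-diagonal part of `g₁⁻¹ g₂` in terms of the angle. -/
lemma exists_le_offDiag {ε : ℝ} (hε : ε ≤ 1 / 10) : ∃ c R : ℝ, 0 < c ∧ ∀ (t β : ℝ) (g₁ g₂ : SL(2, ℝ)),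
    1 ≤ t → 1 ≤ β → β ≤ t ^ (2 / 3 : ℝ) → segDist g₁ g₂ ≤ 1 →
    t ^ (-(1 / 2) + ε : ℝ) * β ^ (1 / 2 : ℝ) ≤ segAngle g₁ g₂ →
    c * t ^ (-1 + 2 * ε) * β ≤ offDiag (g₁⁻¹ * g₂) ∧ ∀ i j, |(g₁⁻¹ * g₂) i j| ≤ R := by
  obtain ⟨R, hR1, hR⟩ := exists_abs_entry_le
  set K := 5 * R + 4 * R ^ 3
  have hK : 1 ≤ K := by
    have : 0 ≤ R ^ 3 := by positivity
    simp only [K]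
    linarith
  refine ⟨1 / K ^ 2, R, by positivity, fun t β g₁ g₂ ht hβ hβt hd hn => ⟨?_, hR g₁ g₂ hd⟩⟩
  have hK2 : 1 / K ^ 2 ≤ 1 := (div_le_one (by positivity)).2 (one_le_pow₀ hK)
  have ht0 : 0 < t := by linarith
  have hp : 0 < t ^ (-1 + 2 * ε) := Real.rpow_pos_of_pos ht0 _
  -- The path is available only for small off-diagonal part. Otherwise the claim is trivial, because
  -- $t^{-1+2\varepsilon}\beta\le t^{-1+1/5+2/3}\le1$.
  rcases lt_or_ge (offDiag (g₁⁻¹ * g₂)) 1 with ho | ho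
  · have h1 := hn.trans (segAngle_le (hR g₁ g₂ hd) ho)
    have h2 : 0 ≤ t ^ (-(1 / 2) + ε : ℝ) * β ^ (1 / 2 : ℝ) := by positivity
    have h3 := pow_le_pow_left₀ h2 h1 2
    rw [mul_pow, mul_pow, Real.sq_sqrt (offDiag_nonneg _), ← Real.rpow_natCast,
      ← Real.rpow_natCast, ← Real.rpow_mul ht0.le, ← Real.rpow_mul (by linarith)] at h3
    norm_num at h3
    rw [mul_assoc, one_div, inv_mul_le_iff₀ (by positivity)]
    convert h3 using 3
    ring
  · refine le_trans ?_ ho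
    have h4 : t ^ (-1 + 2 * ε) * β ≤ 1 := by
      calc t ^ (-1 + 2 * ε) * β ≤ t ^ (-1 + 2 * ε) * t ^ (2 / 3 : ℝ) := by gcongr
        _ = t ^ (-1 + 2 * ε + 2 / 3) := (Real.rpow_add ht0 _ _).symm
        _ ≤ 1 := Real.rpow_le_one_of_one_le_of_nonpos ht (by linarith)
    rw [mul_assoc]
    calc 1 / K ^ 2 * (t ^ (-1 + 2 * ε) * β) ≤ 1 * 1 := by gcongr
      _ = 1 := one_mul 1

/-! ### Reduction of the sesquilinear form to pure exponentials. -/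

lemma continuous_fourierInv_of_integrable {ψ : ℝ → ℂ} (hψ : Integrable ψ) : Continuous (𝓕⁻ ψ) :=
  VectorFourier.fourierIntegral_continuous Real.continuous_fourierChar (L := -innerₗ ℝ)
    (by
      simp only [LinearMap.neg_apply]
      exact (continuous_inner (𝕜 := ℝ) (E := ℝ)).neg) hψ

/-- Fourier inversion for square integrable functions with integrable Fourier transform. -/
lemma ae_eq_fourierInv (φ : Lp ℂ 2 (volume : Measure ℝ))
    (hφ : Integrable (𝓕 φ : Lp ℂ 2 (volume : Measure ℝ))) :
    φ =ᵐ[volume] 𝓕⁻ ((𝓕 φ : Lp ℂ 2 (volume : Measure ℝ)) : ℝ → ℂ) := by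
  set ψ : Lp ℂ 2 (volume : Measure ℝ) := 𝓕 φ with hψ
  have hinv : 𝓕⁻ ψ = φ := FourierTransform.fourierInv_fourier_eq φ
  have hcont := continuous_fourierInv_of_integrable hφ
  have hpair (u : 𝓢(ℝ, ℂ)) : ∫ x, u x • φ x = ∫ x, u x • 𝓕⁻ (ψ : ℝ → ℂ) x := by
    have h1 := congrArg (fun T : TemperedDistribution ℝ ℂ => T u)
      (Lp.fourierInv_toTemperedDistribution_eq ψ)
    simp only [hinv, TemperedDistribution.fourierInv_apply, Lp.toTemperedDistribution_apply] at h1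
    rw [← h1]
    have h2 := VectorFourier.integral_fourierIntegral_smul_eq_flip (μ := volume) (ν := volume)
      (L := -innerₗ ℝ) (f := u) (g := ψ) Real.continuous_fourierChar
      (by
        simp only [LinearMap.neg_apply]
        exact (continuous_inner (𝕜 := ℝ) (E := ℝ)).neg) u.integrable hφ
    rw [SchwartzMap.fourierInv_coe]
    have h3 : (-innerₗ ℝ : ℝ →ₗ[ℝ] ℝ →ₗ[ℝ] ℝ).flip = -innerₗ ℝ := by
      ext
      simp
    rw [h3] at h2
    exact h2
  have hloc : LocallyIntegrable (fun x => φ x - 𝓕⁻ (ψ : ℝ → ℂ) x) :=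
    ((Lp.memLp φ).locallyIntegrable (by norm_num)).sub hcont.locallyIntegrable
  have h0 := ae_eq_zero_of_integral_contDiff_smul_eq_zero hloc fun g hg hgc => by
    have hg₁ : HasCompactSupport (Complex.ofRealCLM ∘ g) := hgc.comp_left rfl
    have hg₂ : ContDiff ℝ ∞ (Complex.ofRealCLM ∘ g) := by fun_prop
    have h1 := hpair (hg₁.toSchwartzMap hg₂)
    simp only [HasCompactSupport.toSchwartzMap_toFun, Function.comp_apply, smul_eq_mul,
      Complex.ofRealCLM_apply] at h1
    simp only [Complex.real_smul, mul_sub]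
    rw [integral_sub, sub_eq_zero]
    · exact h1
    · have := ((Lp.memLp φ).locallyIntegrable
        (by norm_num)).integrable_smul_left_of_hasCompactSupport hg.continuous hgc
      simpa using this
    · exact Continuous.integrable_of_hasCompactSupport
        ((Complex.continuous_ofReal.comp hg.continuous).mul hcont) hg₁.mul_right
  filter_upwards [h0] with x hx
  exact sub_eq_zero.1 hx

/-- On the spectral interval, whose length is $\beta/\pi$, use $|\psi|\le1+|\psi|^2$; the total is
at most $\beta/\pi+1\le2\beta$. -/
lemma integrable_fourier_of_hasSpectrumNear {t β : ℝ} (hβ : 1 ≤ β)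
    {φ : Lp ℂ 2 (volume : Measure ℝ)} (hφ : ‖φ‖ = 1) (hs : HasSpectrumNear t β φ) :
    Integrable (𝓕 φ : Lp ℂ 2 (volume : Measure ℝ)) ∧
      ∫ η, ‖(𝓕 φ : Lp ℂ 2 (volume : Measure ℝ)) η‖ ≤ 2 * β := by
  set ψ : Lp ℂ 2 (volume : Measure ℝ) := 𝓕 φ with hψ
  have hψ1 : ‖ψ‖ = 1 := by rw [hψ, Lp.norm_fourier_eq, hφ]
  have hpi := Real.pi_gt_three
  set S := Set.Icc ((t - β) / (2 * Real.pi)) ((t + β) / (2 * Real.pi))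
  have hle : ∀ᵐ η, ‖ψ η‖ₑ ≤ S.indicator 1 η + ‖ψ η‖ₑ ^ 2 := by
    filter_upwards [hs] with η hη
    by_cases hS : η ∈ S
    · rw [Set.indicator_of_mem hS, Pi.one_apply]
      rcases le_total ‖ψ η‖ₑ 1 with h | h
      · exact h.trans le_self_add
      · exact le_add_left (le_self_pow₀ h two_ne_zero)
    · rw [hη]
      · simp
      · contrapose! hS
        obtain ⟨h1, h2⟩ := hS
        constructor
        · rw [div_le_iff₀ (by positivity)]
          linarith
        · rw [le_div_iff₀ (by positivity)]
          linarith
  have hlint : ∫⁻ η, ‖ψ η‖ₑ ≤ ENNReal.ofReal (2 * β) := by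
    refine (lintegral_mono_ae hle).trans ?_
    rw [lintegral_add_left (measurable_one.indicator measurableSet_Icc),
      lintegral_indicator_one measurableSet_Icc, lintegral_enorm_sq ψ hψ1, Real.volume_Icc,
      ← ENNReal.ofReal_one, ← ENNReal.ofReal_add _ zero_le_one]
    · refine ENNReal.ofReal_le_ofReal ?_
      have : (t + β) / (2 * Real.pi) - (t - β) / (2 * Real.pi) = β / Real.pi := by
        field_simp
        ring
      rw [this]
      have : β / Real.pi ≤ β := div_le_self (by linarith) (by linarith)
      linarith
    · have : (t + β) / (2 * Real.pi) - (t - β) / (2 * Real.pi) = β / Real.pi := by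
        field_simp
        ring
      rw [this]
      positivity
  have hint : Integrable ψ :=
    ⟨Lp.aestronglyMeasurable ψ, lt_of_le_of_lt hlint ENNReal.ofReal_lt_top⟩
  refine ⟨hint, ?_⟩
  rw [integral_norm_eq_lintegral_enorm hint.aestronglyMeasurable]
  exact ENNReal.toReal_le_of_le_ofReal (by linarith) hlint

/-- A sesquilinear form in a function with spectrum in `[t - β, t + β]` is controlled by its values
at pure exponentials. -/
lemma norm_sesquilinear_le {t β : ℝ} (hβ : 1 ≤ β) {φ : Lp ℂ 2 (volume : Measure ℝ)}
    (hφ : ‖φ‖ = 1) (hs : HasSpectrumNear t β φ) {H : ℝ × ℝ → ℂ} (hH : Continuous H)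
    (hHc : HasCompactSupport H) {B : ℝ}
    (hB : ∀ ξ₁ ∈ Set.Icc (t - β) (t + β), ∀ ξ₂ ∈ Set.Icc (t - β) (t + β),
      ‖∫ x : ℝ × ℝ, H x * Complex.exp (Complex.I * ((ξ₁ * x.1 - ξ₂ * x.2 : ℝ) : ℂ))‖ ≤ B) :
    ‖∫ x₁, ∫ x₂, H (x₁, x₂) * (φ x₁ * (starRingEnd ℂ) (φ x₂))‖ ≤ (2 * β) ^ 2 * B := by
  obtain ⟨hint, hnorm⟩ := integrable_fourier_of_hasSpectrumNear hβ hφ hs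
  have hinv := ae_eq_fourierInv φ hint
  set ψ : Lp ℂ 2 (volume : Measure ℝ) := 𝓕 φ with hψ
  set Φ : ℝ → ℂ := 𝓕⁻ (ψ : ℝ → ℂ) with hΦ
  have hΦc : Continuous Φ := continuous_fourierInv_of_integrable hint
  have hΦe (x : ℝ) : Φ x = ∫ η, Complex.exp (Complex.I * ((2 * Real.pi * η * x : ℝ) : ℂ)) * ψ η := by
    rw [hΦ, Real.fourierInv_eq']
    refine integral_congr_ae (Filter.Eventually.of_forall fun η => ?_)
    simp only [smul_eq_mul]
    congr 2
    rw [mul_comm]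
    congr 2
    simp
    ring
  have e1 : ∫ x₁, ∫ x₂, H (x₁, x₂) * (φ x₁ * (starRingEnd ℂ) (φ x₂)) =
      ∫ x : ℝ × ℝ, H x * (Φ x.1 * (starRingEnd ℂ) (Φ x.2)) := by
    rw [Measure.volume_eq_prod, integral_prod]
    · refine integral_congr_ae ?_
      filter_upwards [hinv] with x₁ h1
      refine integral_congr_ae ?_
      filter_upwards [hinv] with x₂ h2
      rw [h1, h2]
    · refine Continuous.integrable_of_hasCompactSupport ?_ hHc.mul_right
      have := Complex.continuous_conj
      fun_prop
  set E : ℝ × ℝ → ℝ × ℝ → ℂ := fun x η =>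
    Complex.exp (Complex.I * ((2 * Real.pi * η.1 * x.1 - 2 * Real.pi * η.2 * x.2 : ℝ) : ℂ)) with hE
  set Ψ : ℝ × ℝ → ℂ := fun η => ψ η.1 * (starRingEnd ℂ) (ψ η.2) with hΨ
  have hconj : Integrable fun η => (starRingEnd ℂ) (ψ η) :=
    (LinearIsometryEquiv.integrable_comp_iff Complex.conjLIE).2 hint
  have hΨint : Integrable Ψ := hint.mul_prod hconj
  have e2 (x : ℝ × ℝ) : H x * (Φ x.1 * (starRingEnd ℂ) (Φ x.2)) = ∫ η, H x * Ψ η * E x η := by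
    rw [hΦe, hΦe, ← integral_conj, ← integral_prod_mul, ← Measure.volume_eq_prod,
      ← integral_const_mul]
    refine integral_congr_ae (Filter.Eventually.of_forall fun η => ?_)
    simp only [hE, hΨ, map_mul, ← Complex.exp_conj, Complex.conj_I, Complex.conj_ofReal]
    push_cast
    rw [show Complex.I * (2 * Real.pi * η.1 * x.1 - 2 * Real.pi * η.2 * x.2 : ℂ) =
      Complex.I * (2 * Real.pi * η.1 * x.1) + -Complex.I * (2 * Real.pi * η.2 * x.2) by ring,
      Complex.exp_add]
    ring
  have hjoint : Integrable (Function.uncurry fun x η => H x * Ψ η * E x η)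
      (volume.prod volume) := by
    refine ((hH.integrable_of_hasCompactSupport hHc).mul_prod hΨint).mul_bdd (c := 1) ?_
      (Filter.Eventually.of_forall fun z => ?_)
    · exact Continuous.aestronglyMeasurable (by fun_prop)
    · simp only [hE]
      rw [mul_comm, Complex.norm_exp_ofReal_mul_I]
  -- After Fubini the form is an average, against $\psi\otimes\overline\psi$, of its values at pairs
  -- of exponentials. Bounding $\|\psi\|_1^2$ by $(2\beta)^2$ loses a power of $\beta$, which is
  -- affordable because the target is arbitrary decay.
  rw [e1, integral_congr_ae (Filter.Eventually.of_forall e2), integral_integral_swap hjoint]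
  have hB0 : 0 ≤ B := (norm_nonneg _).trans (hB t ⟨by linarith, by linarith⟩ t
    ⟨by linarith, by linarith⟩)
  have hs1 : ∀ᵐ η : ℝ × ℝ, 2 * Real.pi * η.1 ∉ Set.Icc (t - β) (t + β) → ψ η.1 = 0 :=
    Measure.quasiMeasurePreserving_fst.ae hs
  have hs2 : ∀ᵐ η : ℝ × ℝ, 2 * Real.pi * η.2 ∉ Set.Icc (t - β) (t + β) → ψ η.2 = 0 :=
    Measure.quasiMeasurePreserving_snd.ae hs
  have hbd : ∀ᵐ η : ℝ × ℝ, ‖∫ x, H x * Ψ η * E x η‖ ≤ ‖ψ η.1‖ * ‖ψ η.2‖ * B := by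
    filter_upwards [hs1, hs2] with η h1 h2
    by_cases m1 : 2 * Real.pi * η.1 ∈ Set.Icc (t - β) (t + β)
    · by_cases m2 : 2 * Real.pi * η.2 ∈ Set.Icc (t - β) (t + β)
      · have h3 : ∫ x, H x * Ψ η * E x η = Ψ η * ∫ x, H x * E x η := by
          rw [← integral_const_mul]
          refine integral_congr_ae (Filter.Eventually.of_forall fun x => ?_)
          simp only
          ring
        rw [h3, norm_mul]
        have h4 : ‖Ψ η‖ = ‖ψ η.1‖ * ‖ψ η.2‖ := by
          simp only [hΨ, norm_mul, RCLike.norm_conj]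
        rw [h4]
        gcongr
        exact hB _ m1 _ m2
      · simp only [hΨ, h2 m2]
        simp
    · simp only [hΨ, h1 m1]
      simp
  have hbint : Integrable fun η : ℝ × ℝ => ‖ψ η.1‖ * ‖ψ η.2‖ * B :=
    (hint.norm.mul_prod hint.norm).mul_const B
  refine (norm_integral_le_of_norm_le hbint hbd).trans ?_
  rw [integral_mul_const, Measure.volume_eq_prod,
    integral_prod_mul (fun η => ‖ψ η‖) (fun η => ‖ψ η‖), sq]
  have h0 : 0 ≤ ∫ η, ‖ψ η‖ := integral_nonneg fun _ => norm_nonneg _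
  gcongr

/-! ### Assembly of the proposition. -/

lemma one_le_of_one_le_rpow {t : ℝ} (h : 1 ≤ t ^ (2 / 3 : ℝ)) : 1 ≤ t := by
  by_contra! ht
  rcases lt_or_ge t 0 with h0 | h0
  · rw [Real.rpow_def_of_neg h0] at h
    have hpi := Real.pi_pos
    have h1 : Real.cos (2 / 3 * Real.pi) < 0 :=
      Real.cos_neg_of_pi_div_two_lt_of_lt (by linarith) (by linarith)
    nlinarith [Real.exp_pos (Real.log t * (2 / 3))]
  · exact absurd h (not_le.2 (Real.rpow_lt_one h0 ht (by norm_num)))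

lemma rpow_two_thirds_le {t : ℝ} (ht : 8 ≤ t) : t ^ (2 / 3 : ℝ) ≤ t / 2 := by
  have ht0 : 0 < t := by linarith
  have h1 : (2 : ℝ) ≤ t ^ (1 / 3 : ℝ) := by
    calc (2 : ℝ) = (8 : ℝ) ^ (1 / 3 : ℝ) := by
          rw [show (8 : ℝ) = 2 ^ (3 : ℝ) by norm_num, ← Real.rpow_mul (by norm_num)]
          norm_num
      _ ≤ _ := by gcongr
  have h2 : t ^ (2 / 3 : ℝ) * t ^ (1 / 3 : ℝ) = t := by
    rw [← Real.rpow_add ht0]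
    norm_num
  have h3 : 0 < t ^ (2 / 3 : ℝ) := Real.rpow_pos_of_pos ht0 _
  nlinarith

section Cutoff

variable {b : ℝ → ℂ}

lemma cutoff_eq_zero (hb_supp : tsupport b ⊆ Set.Icc (0 : ℝ) 1) :
    ∀ x ∉ unitSquare, b x.1 * b x.2 = 0 := by
  intro x hx
  have hb0 (y : ℝ) (hy : y ∉ Set.Icc (0 : ℝ) 1) : b y = 0 :=
    image_eq_zero_of_notMem_tsupport fun h => hy (hb_supp h)
  by_cases h1 : x.1 ∈ Set.Icc (0 : ℝ) 1
  · rw [hb0 x.2 fun h2 => hx ⟨h1, h2⟩, mul_zero]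
  · rw [hb0 x.1 h1, zero_mul]

lemma contDiff_cutoff (hb : ContDiff ℝ ∞ b) : ContDiff ℝ ∞ fun x : ℝ × ℝ => b x.1 * b x.2 :=
  (hb.comp contDiff_fst).mul (hb.comp contDiff_snd)

/-- Uses $\xi_1x_1-\xi_2x_2=\xi(x_1-x_2)+\zeta(x_1+x_2)$ with $\xi$ the mean and $\zeta$ half the
difference. Conjugating the second factor makes the large frequency fall on $x_1-x_2$. The kernels
are identified off the null set $c=1$. -/
lemma integral_exp_eq_oscIntegral {h : 𝓢(ℝ, ℝ)} (hh : IsAdmissible h) {t : ℝ} (ht : 1 ≤ t)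
    {k : ℍ → ℂ} (hk : IsSpectralKernel h t k) (g : SL(2, ℝ)) (ξ₁ ξ₂ : ℝ) :
    ∫ x : ℝ × ℝ, b x.1 * b x.2 * radialProfile k (coshDist g x) *
        Complex.exp (Complex.I * ((ξ₁ * x.1 - ξ₂ * x.2 : ℝ) : ℂ)) =
      oscIntegral h t g ((ξ₁ + ξ₂) / 2) ((ξ₁ - ξ₂) / 2) (fun x => b x.1 * b x.2) 0 := by
  refine integral_congr_ae ?_
  filter_upwards [ae_coshDist_ne_one g] with x hx
  rw [radialProfile_eq_kernelIter hh ht hk (lt_of_le_of_ne (one_le_coshDist g x) hx.symm),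
    planeWave, show (ξ₁ + ξ₂) / 2 * (x.1 - x.2) + (ξ₁ - ξ₂) / 2 * (x.1 + x.2) =
      ξ₁ * x.1 - ξ₂ * x.2 by ring]
  ring

lemma norm_periodIntegral_le_of_oscIntegral {h : 𝓢(ℝ, ℝ)} (hh : IsAdmissible h)
    (hb : ContDiff ℝ ∞ b) (hb_supp : tsupport b ⊆ Set.Icc (0 : ℝ) 1) {t β : ℝ} (ht : 1 ≤ t)
    (hβ : 1 ≤ β) {k : ℍ → ℂ} (hk : IsSpectralKernel h t k) {φ : Lp ℂ 2 (volume : Measure ℝ)}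
    (hφ : ‖φ‖ = 1) (hs : HasSpectrumNear t β φ) {g₁ g₂ : SL(2, ℝ)} {B : ℝ}
    (hB : ∀ ξ ζ : ℝ, |ξ - t| ≤ β → |ζ| ≤ β →
      ‖oscIntegral h t (g₁⁻¹ * g₂) ξ ζ (fun x => b x.1 * b x.2) 0‖ ≤ B) :
    ‖periodIntegral b k φ g₁ g₂‖ ≤ (2 * β) ^ 2 * B := by
  set g := g₁⁻¹ * g₂
  have e1 : periodIntegral b k φ g₁ g₂ = ∫ x₁, ∫ x₂,
      b x₁ * b x₂ * radialProfile k (coshDist g (x₁, x₂)) *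
        (φ x₁ * (starRingEnd ℂ) (φ x₂)) := by
    rw [periodIntegral]
    congr 1
    ext x₁
    congr 1
    ext x₂
    rw [pointPair_geod hk.invariant]
    ring
  have hcut := cutoff_eq_zero hb_supp
  have hc : Continuous fun x : ℝ × ℝ => b x.1 * b x.2 * radialProfile k (coshDist g x) :=
    (contDiff_cutoff hb).continuous.mul
      ((continuous_radialProfile hk.continuous).comp (continuous_coshDist g))
  rw [e1]
  refine norm_sesquilinear_le hβ hφ hs hc
    (HasCompactSupport.intro isCompact_unitSquare fun x hx => by rw [hcut x hx, zero_mul])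
    fun ξ₁ h₁ ξ₂ h₂ => ?_
  rw [integral_exp_eq_oscIntegral hh ht hk]
  obtain ⟨a1, a2⟩ := h₁
  obtain ⟨b1, b2⟩ := h₂
  apply hB <;> rw [abs_le] <;> constructor <;> linarith

lemma exists_norm_periodIntegral_le_rpow_neg {h : 𝓢(ℝ, ℝ)} (hh : IsAdmissible h)
    (hb : ContDiff ℝ ∞ b) (hb_supp : tsupport b ⊆ Set.Icc (0 : ℝ) 1) {ε : ℝ} (hε : 0 < ε)
    (A : ℝ) : ∃ C : ℝ, 0 < C ∧ ∀ (t β : ℝ) (k : ℍ → ℂ) (φ : Lp ℂ 2 (volume : Measure ℝ))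
      (g₁ g₂ : SL(2, ℝ)), 1 ≤ β → β ≤ t ^ (2 / 3 : ℝ) → IsSpectralKernel h t k →
        HasSpectrumNear t β φ → ‖φ‖ = 1 → segDist g₁ g₂ ≤ 1 →
        t ^ (-(1 / 2) + ε : ℝ) * β ^ (1 / 2 : ℝ) ≤ segAngle g₁ g₂ →
        ‖periodIntegral b k φ g₁ g₂‖ ≤ C * t ^ (-A) := by
  obtain ⟨C₁, hC₁, h₁⟩ := exists_norm_periodIntegral_le hh hb.continuous hb_supp
  -- Decreasing $\varepsilon$ weakens the angle hypothesis, so it may be assumed small enough for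
  -- the lower bound on the off-diagonal part.
  set ε' := min ε (1 / 10) with hε'
  have hε'0 : 0 < ε' := lt_min hε (by norm_num)
  obtain ⟨c, R, hc, hoff⟩ := exists_le_offDiag (min_le_right ε (1 / 10))
  -- The decay $t^{-2\varepsilon'N}$ must beat $t^{-A}$ and a loss of $t^4$: $t^2$ from the trivial
  -- bound on the kernel and $t^2$ from $(2\beta)^2$.
  obtain ⟨N, hN⟩ := exists_nat_ge ((4 + A) / (2 * ε'))
  rw [div_le_iff₀ (by positivity)] at hN
  obtain ⟨t₀, C₂, h₂⟩ := exists_norm_oscIntegral_le_of_admissible hh hc hε'0 R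
    (contDiff_cutoff hb) (cutoff_eq_zero hb_supp) N
  set T := max t₀ 8
  have hT : 8 ≤ T := le_max_right _ _
  have hT0 : 0 < T := by linarith
  refine ⟨C₁ * T ^ (1 / 2 : ℝ) * T ^ |A| + 4 * |C₂|, by positivity,
    fun t β k φ g₁ g₂ hβ hβt hk hs hφ hd hn => ?_⟩
  have ht : 1 ≤ t := one_le_of_one_le_rpow (hβ.trans hβt)
  have ht0 : 0 < t := by linarith
  have htA : 0 < t ^ (-A) := Real.rpow_pos_of_pos ht0 _
  rcases lt_or_ge t T with hlt | hge
  -- For bounded $t$ the estimate of part (a) suffices, with a constant depending on $T$.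
  · have e1 : 1 ≤ T ^ |A| * t ^ (-A) := by
      calc (1 : ℝ) ≤ T ^ |A| * T ^ (-|A|) := by
            rw [← Real.rpow_add hT0, add_neg_cancel, Real.rpow_zero]
        _ ≤ T ^ |A| * t ^ (-|A|) := by
            gcongr 1
            exact Real.rpow_le_rpow_of_nonpos ht0 hlt.le (by simp)
        _ ≤ T ^ |A| * t ^ (-A) := by
            gcongr
            exact le_abs_self A
    calc ‖periodIntegral b k φ g₁ g₂‖ ≤ C₁ * t ^ (1 / 2 : ℝ) := h₁ t k φ g₁ g₂ ht hk hφ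
      _ ≤ C₁ * T ^ (1 / 2 : ℝ) * 1 := by rw [mul_one]; gcongr
      _ ≤ C₁ * T ^ (1 / 2 : ℝ) * (T ^ |A| * t ^ (-A)) := by gcongr
      _ ≤ (C₁ * T ^ (1 / 2 : ℝ) * T ^ |A| + 4 * |C₂|) * t ^ (-A) := by
        have := mul_nonneg (abs_nonneg C₂) htA.le
        linarith
  · have ht8 : 8 ≤ t := hT.trans hge
    have hβ2 : β ≤ t / 2 := hβt.trans (rpow_two_thirds_le ht8)
    have hn' : t ^ (-(1 / 2) + ε' : ℝ) * β ^ (1 / 2 : ℝ) ≤ segAngle g₁ g₂ := by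
      refine le_trans ?_ hn
      gcongr
      exact min_le_left _ _
    obtain ⟨ho, hR⟩ := hoff t β g₁ g₂ ht hβ hβt hd hn'
    have hosc (ξ ζ : ℝ) (hξ : |ξ - t| ≤ β) (hζ : |ζ| ≤ β) :
        ‖oscIntegral h t (g₁⁻¹ * g₂) ξ ζ (fun x => b x.1 * b x.2) 0‖ ≤
          |C₂| * t ^ 2 * (t ^ (-(2 * ε'))) ^ N := by
      have hp : OscParams.Admissible h c ε' R ⟨g₁⁻¹ * g₂, t, β, ξ, ζ⟩ :=
        { one_le_β := hβ
          β_le := hβ2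
          exists_kernel := ⟨k, hk⟩
          ξ_near := hξ
          ζ_small := hζ
          le_offDiag := ho
          entry_le := hR }
      refine (h₂ _ hp ((le_max_left _ _).trans hge)).trans ?_
      gcongr
      exact le_abs_self C₂
    have hpow : t ^ 2 * t ^ 2 * (t ^ (-(2 * ε'))) ^ N ≤ t ^ (-A) := by
      rw [← Real.rpow_natCast, ← Real.rpow_natCast, ← Real.rpow_mul ht0.le, ← Real.rpow_add ht0,
        ← Real.rpow_add ht0]
      refine Real.rpow_le_rpow_of_exponent_le ht ?_
      push_cast
      linarith
    calc ‖periodIntegral b k φ g₁ g₂‖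
        ≤ (2 * β) ^ 2 * (|C₂| * t ^ 2 * (t ^ (-(2 * ε'))) ^ N) :=
          norm_periodIntegral_le_of_oscIntegral hh hb hb_supp ht hβ hk hφ hs hosc
      _ ≤ (2 * t) ^ 2 * (|C₂| * t ^ 2 * (t ^ (-(2 * ε'))) ^ N) := by
          have : β ≤ t := by linarith
          gcongr
      _ = 4 * |C₂| * (t ^ 2 * t ^ 2 * (t ^ (-(2 * ε'))) ^ N) := by ring
      _ ≤ 4 * |C₂| * t ^ (-A) := by gcongr
      _ ≤ _ := by
        have : 0 ≤ C₁ * T ^ (1 / 2 : ℝ) * T ^ |A| := by positivity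
        nlinarith

end Cutoff

end GeodesicPeriod

end

open GeodesicPeriod in
theorem mainTheorem8 (h : 𝓢(ℝ, ℝ)) (hh : IsAdmissible h)
    (b : ℝ → ℂ) (hb : ContDiff ℝ ∞ b) (hb_supp : tsupport b ⊆ Set.Icc (0 : ℝ) 1) :
    (∃ C : ℝ, 0 < C ∧
      ∀ (t β : ℝ) (k : ℍ → ℂ) (φ : Lp ℂ 2 (volume : Measure ℝ)) (g₁ g₂ : SL(2, ℝ)),
        1 ≤ β → β ≤ t ^ (2 / 3 : ℝ) → IsSpectralKernel h t k →
        HasSpectrumNear t β φ → ‖φ‖ = 1 → segDist g₁ g₂ ≤ 1 →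
        ‖periodIntegral b k φ g₁ g₂‖ ≤ C * t ^ (1 / 2 : ℝ)) ∧
    (∀ ε : ℝ, 0 < ε → ∀ A : ℝ, ∃ C : ℝ, 0 < C ∧
      ∀ (t β : ℝ) (k : ℍ → ℂ) (φ : Lp ℂ 2 (volume : Measure ℝ)) (g₁ g₂ : SL(2, ℝ)),
        1 ≤ β → β ≤ t ^ (2 / 3 : ℝ) → IsSpectralKernel h t k →
        HasSpectrumNear t β φ → ‖φ‖ = 1 → segDist g₁ g₂ ≤ 1 →
        t ^ (-(1 / 2) + ε : ℝ) * β ^ (1 / 2 : ℝ) ≤ segAngle g₁ g₂ →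
        ‖periodIntegral b k φ g₁ g₂‖ ≤ C * t ^ (-A)) := by
  refine ⟨?_, fun ε hε A => exists_norm_periodIntegral_le_rpow_neg hh hb hb_supp hε A⟩
  obtain ⟨C, hC, hbound⟩ := exists_norm_periodIntegral_le hh hb.continuous hb_supp
  exact ⟨C, hC, fun t β k φ g₁ g₂ hβ hβt hk _ hφ _ =>
    hbound t k φ g₁ g₂ (one_le_of_one_le_rpow (hβ.trans hβt)) hk hφ⟩
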